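/- Let $(E,C)$ be a finite bipartite separated graph: $E^0=E^{0,0}\sqcup E^{0,1}$ and $E^1$ are finite, every edge $e$ has source $s(e)\in E^{0,1}$ and range $r(e)\in E^{0,0}$, $s(E^1)=E^{0,1}$, $r(E^1)=E^{0,0}$, and for each $v\in E^{0,0}$, $C_v$ is a partition of $r^{-1}(v)$ into nonempty subsets. For $e\in E^1$ let $X_e\in C_{r(e)}$ be the set containing $e$. **Condition (L).** An *admissible path* starting with an edge is a path $e_n^{(*)}\cdots e_3e_2^*e_1$ ($n\ge1$; edges with odd index unstarred, edges with even index starred, read from right to left) with $r(e_{2i-1})=r(e_{2i})$, $X_{e_{2i-1}}\ne X_{e_{2i}}$, $s(e_{2i})=s(e_{2i+1})$ and $e_{2i}\neq e_{2i+1}$ whenever these edges occur. A *cycle* is an admissible path $e_{2r}^*e_{2r-1}\cdots e_2^*e_1$, $r\ge1$, with $s(e_1)=s(e_{2r})$, $e_1\ne e_{2r}$ and $s(e_{2i-1})\neq s(e_{2j})$ for $1\le i\le j<r$. An *entry* of it is an admissible path $x_{2t-1}x_{2t-2}^*\cdots x_2^*x_1$, $t\ge1$, with $s(x_1)=s(e_1)$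 such that $|X|\ge2$ for some $X\in C_{r(x_{2t-1})}$ with $X\neq X_{x_{2t-1}}$. $(E,C)$ satisfies *condition (L)* if every cycle has an entry. **The algebra $L^{\rm ab}_K(E,C)$.** Let $K$ be a field with involution. $L_K(E,C)$ is the universal $*$-algebra over $K$ generated by $E^0\cup E^1$ subject to $vv'=\delta_{v,v'}v$, $v=v^*$, $r(e)e=es(e)=e$, $e^*f=\delta_{e,f}s(e)$ for $e,f\in X\in C_v$, and $v=\sum_{e\in X}ee^*$ for $X\in C_v$, $v\in E^{0,0}$. Let $U$ be the multiplicative semigroup generated by $E^1\cup(E^1)^*$. Then $L^{\rm ab}_K(E,C)=L_K(E,C)/J$, where $J$ is the ideal generated by all commutators $[uu^*,u'u'^*]$, $u,u'\in U$. **The space and the crossed product.** Let $\mathbb F$ be the free group on $E^1$. $\Omega=\Omega(E,C)$ is the space, with the topology induced from $2^{\mathbb F}$, of all convex subsets $\xi\subseteq\mathbb F$ (with respect to word length) with $1\in\xi$ such that for every $g\in\xi$ one of the following holds for $\xi_g=\{x\in E^1\cup(E^1)^{-1}: gx\in\xi\}$: $\xi_g=\{e^{-1}: s(e)=w\}$ for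 some $w\in E^{0,1}$; or, for some $v\in E^{0,0}$, $\xi_g$ consists of exactly one element of each $X\in C_v$. $\mathbb F$ acts partially on $\Omega$ by $\theta_g:\Omega_{g^{-1}}\to\Omega_g$, $\xi\mapsto g\xi$, where $\Omega_g=\{\xi\in\Omega: g\in\xi\}$. Let $C_K(\Omega)$ be the $*$-algebra of continuous functions from $\Omega$ to $K$ with the discrete topology, $e(g)$ the characteristic function of $\Omega_g$, $D_g=e(g)C_K(\Omega)$, and $\alpha_g: D_{g^{-1}}\to D_g$, $\alpha_g(f)=f\circ\theta_{g^{-1}}$. $C_K(\Omega)\rtimes_\alpha\mathbb F$ consists of the finite formal sums $\sum_g a_g\delta_g$ with $a_g\in D_g$, with $(a\delta_g)(b\delta_h)=\alpha_g(\alpha_{g^{-1}}(a)b)\delta_{gh}$ and $(a\delta_g)^*=\alpha_{g^{-1}}(a^*)\delta_{g^{-1}}$. **Theorem.** Suppose that $(E,C)$ satisfies condition (L). Then, identifying $$L^{\rm ab}_K(E,C)\cong C_K(\Omega(E,C))\rtimes_\alpha\mathbb F$$ by the $*$-algebra isomorphism that maps each $x\in E^1$ to $e(x)\delta_x$ (such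 an isomorphism exists), the $*$-algebra $L^{\rm ab}_K(E,C)$ has property (SP), in the following sense. 1. For every nonzero $a\in L^{\rm ab}_K(E,C)$ there are a nonzero projection $h\in C_K(\Omega(E,C))$, a nonzero $\lambda\in K$ and $g\in\mathbb F$ such that $$h\,a\,(e(g)\delta_g)\,h=\lambda h\delta_1 ,$$ where $h$ is identified with $h\delta_1$ and $1$ is the identity of $\mathbb F$. 2. Every nonzero two-sided ideal of $L^{\rm ab}_K(E,C)$ contains a nonzero projection of $C_K(\Omega(E,C))$. 3. Every nonzero left ideal and every nonzero right ideal of $L^{\rm ab}_K(E,C)$ contains a nonzero idempotent. -/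

import Mathlib

/-! ### Separated graphs -/

/-- A bipartite separated graph `(E, C)` with vertex set `E⁰ = V₀ ⊔ V₁` (where `V₀ = E^{0,0}` and
`V₁ = E^{0,1}`) and edge set `E = E¹`: every edge goes from a vertex of `V₁` to a vertex of `V₀`,
`C v` is a partition of `r⁻¹(v)` into nonempty subsets for each `v : V₀`, every `v : V₀` receives
an edge and every `w : V₁` emits an edge. (Vertices in `V₁` are sources, so `C_w = ∅` for them.) -/
structure BipartiteSeparatedGraph (V₀ V₁ E : Type*) where
  /-- the range map -/
  r : E → V₀
  /-- the source map -/
  s : E → V₁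
  /-- the partition `C_v` of `r⁻¹(v)` -/
  C : V₀ → Set (Set E)
  nonempty_of_mem : ∀ v, ∀ X ∈ C v, X.Nonempty
  range_of_mem : ∀ v, ∀ X ∈ C v, ∀ e ∈ X, r e = v
  existsUnique_mem : ∀ e, ∃! X, X ∈ C (r e) ∧ e ∈ X
  r_surjective : Function.Surjective r
  s_surjective : Function.Surjective s

namespace BipartiteSeparatedGraph

variable {V₀ V₁ E : Type*} (Γ : BipartiteSeparatedGraph V₀ V₁ E)

/-- The edges `e` and `f` belong to the same set of the partition: `X_e = X_f`. -/
def SameClass (e f : E) : Prop := ∃ v, ∃ X ∈ Γ.C v, e ∈ X ∧ f ∈ X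

/-- The sequence of edges `e 1, …, e n` gives an admissible path of length `n` in the double of the
graph, starting with an edge of the graph:
`e₁`, `e₂* e₁`, `e₃ e₂* e₁`, `e₄* e₃ e₂* e₁`, …
(the value `e 0` is not used). Paths are read from right to left. -/
def IsAdmissible (n : ℕ) (e : ℕ → E) : Prop :=
  (∀ i, 2 * i + 2 ≤ n →
    Γ.r (e (2 * i + 1)) = Γ.r (e (2 * i + 2)) ∧ ¬ Γ.SameClass (e (2 * i + 1)) (e (2 * i + 2))) ∧
  (∀ i, 2 * i + 3 ≤ n →
    Γ.s (e (2 * i + 2)) = Γ.s (e (2 * i + 3)) ∧ e (2 * i + 2) ≠ e (2 * i + 3))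

/-- `e_{2r}* e_{2r-1} ⋯ e₂* e₁` is a closed path: a nontrivial admissible path with
`s(e₁) = s(e_{2r})`. -/
def IsClosedPath (r : ℕ) (e : ℕ → E) : Prop :=
  1 ≤ r ∧ Γ.IsAdmissible (2 * r) e ∧ Γ.s (e 1) = Γ.s (e (2 * r))

/-- `e_{2r}* e_{2r-1} ⋯ e₂* e₁` is a cycle: a closed path with `e₁ ≠ e_{2r}` and
`s(e_{2i-1}) ≠ s(e_{2j})` for `1 ≤ i ≤ j < r`. -/
def IsCycle (r : ℕ) (e : ℕ → E) : Prop :=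
  Γ.IsClosedPath r e ∧ e 1 ≠ e (2 * r) ∧
    ∀ i j, 1 ≤ i → i ≤ j → j < r → Γ.s (e (2 * i - 1)) ≠ Γ.s (e (2 * j))

/-- `x_{2t-1} x_{2t-2}* ⋯ x₂* x₁` is an entry of a closed path with edges `e 1, e 2, …`. -/
def IsEntry (e : ℕ → E) (t : ℕ) (x : ℕ → E) : Prop :=
  1 ≤ t ∧ Γ.IsAdmissible (2 * t - 1) x ∧ Γ.s (x 1) = Γ.s (e 1) ∧
    ∃ X ∈ Γ.C (Γ.r (x (2 * t - 1))), x (2 * t - 1) ∉ X ∧ X.Nontrivial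

/-- Condition (L): every cycle has an entry. -/
def ConditionL : Prop :=
  ∀ (r : ℕ) (e : ℕ → E), Γ.IsCycle r e → ∃ (t : ℕ) (x : ℕ → E), Γ.IsEntry e t x

end BipartiteSeparatedGraph

/-! ### The free `*`-algebra on the vertices and edges -/

/-- The letters: vertices `v`, `w`, edges `e` and ghost edges `e*`. -/
inductive PathLetter (V₀ V₁ E : Type*)
  | vertex₀ (v : V₀)
  | vertex₁ (w : V₁)
  | edge (e : E)
  | ghost (e : E)

/-- The involution on letters: vertices are self-adjoint, and `e ↔ e*`. -/
def PathLetter.bar {V₀ V₁ E : Type*} : PathLetter V₀ V₁ E → PathLetter V₀ V₁ E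
  | vertex₀ v => vertex₀ v
  | vertex₁ w => vertex₁ w
  | edge e => ghost e
  | ghost e => edge e

/-- The free unital `K`-algebra on the letters, i.e. the monoid algebra of the free monoid. -/
abbrev FreePathAlgebra (V₀ V₁ E K : Type*) [Field K] : Type _ :=
  MonoidAlgebra K (FreeMonoid (PathLetter V₀ V₁ E))

namespace FreePathAlgebra

variable {V₀ V₁ E K : Type*} [Field K]

/-- A letter as an element of the free algebra. -/
noncomputable def letter (x : PathLetter V₀ V₁ E) : FreePathAlgebra V₀ V₁ E K :=
  MonoidAlgebra.of K _ (FreeMonoid.of x)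

/-- The involution of the free algebra as a ring homomorphism to the opposite ring: scalars go to
their conjugates, a letter `x` goes to `x.bar`, and products are reversed. -/
noncomputable def starHom [StarRing K] :
    FreePathAlgebra V₀ V₁ E K →+* (FreePathAlgebra V₀ V₁ E K)ᵐᵒᵖ :=
  MonoidAlgebra.liftNCRingHom
    ((algebraMap K (FreePathAlgebra V₀ V₁ E K)ᵐᵒᵖ).comp (starRingEnd K))
    (FreeMonoid.lift fun x => MulOpposite.op (letter x.bar))
    (fun c _ => Algebra.commute_algebraMap_left (starRingEnd K c) _)

theorem ringHom_ext {S : Type*} [Semiring S] {f g : FreePathAlgebra V₀ V₁ E K →+* S}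
    (h₁ : ∀ c : K, f (algebraMap K _ c) = g (algebraMap K _ c))
    (h₂ : ∀ x, f (letter x) = g (letter x)) : f = g :=
  MonoidAlgebra.ringHom_ext' (RingHom.ext fun c => h₁ c) (FreeMonoid.hom_eq h₂)

theorem starHom_algebraMap [StarRing K] (c : K) :
    starHom (algebraMap K (FreePathAlgebra V₀ V₁ E K) c) =
      MulOpposite.op (algebraMap K _ (star c)) := by
  refine (MonoidAlgebra.liftNCRingHom_single _ _ _ _ _).trans ?_
  simp [starRingEnd_apply, MulOpposite.algebraMap_apply]

theorem starHom_letter [StarRing K] (x : PathLetter V₀ V₁ E) :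
    starHom (letter x : FreePathAlgebra V₀ V₁ E K) = MulOpposite.op (letter x.bar) := by
  refine (MonoidAlgebra.liftNCRingHom_single _ _ _ _ _).trans ?_
  rw [map_one, one_mul, FreeMonoid.lift_eval_of]

theorem starHom_starHom [StarRing K] (a : FreePathAlgebra V₀ V₁ E K) :
    (starHom (starHom a).unop).unop = a := by
  let τ : FreePathAlgebra V₀ V₁ E K →+* FreePathAlgebra V₀ V₁ E K :=
    { toFun := fun a => (starHom (starHom a).unop).unop
      map_one' := by simp
      map_mul' := by simp
      map_zero' := by simp
      map_add' := by simp }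
  have h : τ = RingHom.id _ := by
    refine ringHom_ext (fun c => ?_) (fun x => ?_)
    · change (starHom (starHom _).unop).unop = _
      rw [starHom_algebraMap, MulOpposite.unop_op, starHom_algebraMap, MulOpposite.unop_op,
        star_star, RingHom.id_apply]
    · change (starHom (starHom _).unop).unop = _
      rw [starHom_letter, MulOpposite.unop_op, starHom_letter, MulOpposite.unop_op,
        RingHom.id_apply]
      cases x <;> rfl
  exact DFunLike.congr_fun h a

noncomputable instance [StarRing K] : StarRing (FreePathAlgebra V₀ V₁ E K) where
  star a := (starHom a).unop
  star_involutive := starHom_starHom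
  star_mul a b := by simp
  star_add a b := by simp

theorem star_algebraMap [StarRing K] (c : K) :
    star (algebraMap K (FreePathAlgebra V₀ V₁ E K) c) = algebraMap K _ (star c) :=
  congrArg MulOpposite.unop (starHom_algebraMap c)

theorem star_letter [StarRing K] (x : PathLetter V₀ V₁ E) :
    star (letter x : FreePathAlgebra V₀ V₁ E K) = letter x.bar :=
  congrArg MulOpposite.unop (starHom_letter x)

end FreePathAlgebra

/-! ### The Leavitt path algebra and its abelianized version -/

namespace BipartiteSeparatedGraph

section Algebras

variable {V₀ V₁ E : Type*} [Fintype V₀] [Fintype V₁] [Fintype E]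
  (Γ : BipartiteSeparatedGraph V₀ V₁ E) (K : Type*) [Field K]

open PathLetter FreePathAlgebra

open scoped Classical in
/-- The defining relations of the Leavitt path algebra of a finite bipartite separated graph
(relations `(V)`, `(E)`, `(SCK1)`, `(SCK2)`), together with `∑ v = 1`. The relations `v = v*` are
built into the involution on letters. -/
inductive LeavittRel : FreePathAlgebra V₀ V₁ E K → FreePathAlgebra V₀ V₁ E K → Prop
  | vertex₀_mul_self (v : V₀) :
      LeavittRel (letter (vertex₀ v) * letter (vertex₀ v)) (letter (vertex₀ v))
  | vertex₁_mul_self (w : V₁) :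
      LeavittRel (letter (vertex₁ w) * letter (vertex₁ w)) (letter (vertex₁ w))
  | vertex₀_mul_of_ne (v v' : V₀) (h : v ≠ v') :
      LeavittRel (letter (vertex₀ v) * letter (vertex₀ v')) 0
  | vertex₁_mul_of_ne (w w' : V₁) (h : w ≠ w') :
      LeavittRel (letter (vertex₁ w) * letter (vertex₁ w')) 0
  | vertex₀_mul_vertex₁ (v : V₀) (w : V₁) :
      LeavittRel (letter (vertex₀ v) * letter (vertex₁ w)) 0
  | vertex₁_mul_vertex₀ (v : V₀) (w : V₁) :
      LeavittRel (letter (vertex₁ w) * letter (vertex₀ v)) 0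
  | range_mul_edge (e : E) :
      LeavittRel (letter (vertex₀ (Γ.r e)) * letter (edge e)) (letter (edge e))
  | edge_mul_source (e : E) :
      LeavittRel (letter (edge e) * letter (vertex₁ (Γ.s e))) (letter (edge e))
  | ghost_mul_edge_self (e : E) :
      LeavittRel (letter (ghost e) * letter (edge e)) (letter (vertex₁ (Γ.s e)))
  | ghost_mul_edge_of_ne (e f : E) (h : Γ.SameClass e f) (hne : e ≠ f) :
      LeavittRel (letter (ghost e) * letter (edge f)) 0
  | vertex_eq_sum (v : V₀) (X : Set E) (hX : X ∈ Γ.C v) :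
      LeavittRel (letter (vertex₀ v)) (∑ e with e ∈ X, letter (edge e) * letter (ghost e))
  | sum_vertices :
      LeavittRel (∑ v, letter (vertex₀ v) + ∑ w, letter (vertex₁ w)) 1

variable [StarRing K]

/-- The defining relations together with their adjoints. -/
def LeavittStarRel (a b : FreePathAlgebra V₀ V₁ E K) : Prop :=
  Γ.LeavittRel K a b ∨ Γ.LeavittRel K (star a) (star b)

/-- The Leavitt path algebra `L_K(E, C)` of a finite bipartite separated graph: the universal
`*`-algebra over the field with involution `K` on the vertices and edges subject to the relations
`LeavittRel`. (As the graph is finite, the sum of all vertices is its unit.) -/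
def LeavittPathAlgebra : Type _ := RingQuot (Γ.LeavittStarRel K)

noncomputable instance : Ring (Γ.LeavittPathAlgebra K) :=
  inferInstanceAs (Ring (RingQuot (Γ.LeavittStarRel K)))

noncomputable instance : Algebra K (Γ.LeavittPathAlgebra K) :=
  inferInstanceAs (Algebra K (RingQuot (Γ.LeavittStarRel K)))

noncomputable instance : StarRing (Γ.LeavittPathAlgebra K) :=
  RingQuot.starRing (Γ.LeavittStarRel K) fun a b h => by
    unfold LeavittStarRel at h ⊢
    rw [star_star, star_star]
    exact h.symm

/-- The quotient map onto the Leavitt path algebra. -/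
noncomputable def leavittMk : FreePathAlgebra V₀ V₁ E K →ₐ[K] Γ.LeavittPathAlgebra K :=
  RingQuot.mkAlgHom K (Γ.LeavittStarRel K)

theorem star_leavittMk (a : FreePathAlgebra V₀ V₁ E K) :
    star (Γ.leavittMk K a) = Γ.leavittMk K (star a) := by
  simp only [leavittMk, RingQuot.mkAlgHom_def, RingQuot.mkRingHom_def]
  rfl

instance : StarModule K (Γ.LeavittPathAlgebra K) where
  star_smul c a := by
    rw [Algebra.smul_def, star_mul, ← (Γ.leavittMk K).commutes c, star_leavittMk,
      star_algebraMap, AlgHom.commutes, Algebra.smul_def, Algebra.commutes]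

/-- The edge `e` as an element of the Leavitt path algebra. -/
noncomputable def leavittEdge (e : E) : Γ.LeavittPathAlgebra K :=
  Γ.leavittMk K (letter (edge e))

/-- The multiplicative subsemigroup `U` of `L_K(E, C)` generated by the edges and their adjoints. -/
noncomputable def edgeSemigroup : Subsemigroup (Γ.LeavittPathAlgebra K) :=
  Subsemigroup.closure
    (Set.range (Γ.leavittEdge K) ∪ Set.range fun e => star (Γ.leavittEdge K e))

/-- The relations `e(u) e(u') = e(u') e(u)` for `u, u' ∈ U`, where `e(u) = u u*`. -/
def CommutatorRel (a b : Γ.LeavittPathAlgebra K) : Prop :=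
  ∃ u ∈ Γ.edgeSemigroup K, ∃ u' ∈ Γ.edgeSemigroup K,
    a = (u * star u) * (u' * star u') ∧ b = (u' * star u') * (u * star u)

/-- The abelianized Leavitt path algebra `L^ab_K(E, C) = L_K(E, C) / J`, where `J` is the ideal
generated by the commutators `[e(u), e(u')]` for `u, u' ∈ U`. -/
def LAb : Type _ := RingQuot (Γ.CommutatorRel K)

noncomputable instance : Ring (Γ.LAb K) := inferInstanceAs (Ring (RingQuot (Γ.CommutatorRel K)))

noncomputable instance : Algebra K (Γ.LAb K) :=
  inferInstanceAs (Algebra K (RingQuot (Γ.CommutatorRel K)))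

noncomputable instance : StarRing (Γ.LAb K) :=
  RingQuot.starRing (Γ.CommutatorRel K) fun a b h => by
    obtain ⟨u, hu, u', hu', rfl, rfl⟩ := h
    exact ⟨u', hu', u, hu, by simp [star_mul], by simp [star_mul]⟩

/-- The quotient map from the Leavitt path algebra onto `L^ab_K(E, C)`. -/
noncomputable def lAbMk : Γ.LeavittPathAlgebra K →ₐ[K] Γ.LAb K :=
  RingQuot.mkAlgHom K (Γ.CommutatorRel K)

theorem star_lAbMk (a : Γ.LeavittPathAlgebra K) :
    star (Γ.lAbMk K a) = Γ.lAbMk K (star a) := by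
  simp only [lAbMk, RingQuot.mkAlgHom_def, RingQuot.mkRingHom_def]
  rfl

instance : StarModule K (Γ.LAb K) where
  star_smul c a := by
    rw [Algebra.smul_def, star_mul, ← (Γ.lAbMk K).commutes c, star_lAbMk,
      ← (Γ.leavittMk K).commutes c, star_leavittMk, star_algebraMap, AlgHom.commutes,
      AlgHom.commutes, Algebra.smul_def, Algebra.commutes]

/-- The edge `e` as an element of `L^ab_K(E, C)`. -/
noncomputable def lAbEdge (e : E) : Γ.LAb K := Γ.lAbMk K (Γ.leavittEdge K e)

end Algebras

end BipartiteSeparatedGraph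

/-! ### Partial actions and algebraic crossed products -/

/-- For a space `X`, the algebra `C_K(X)` of continuous functions to the discrete field `K` is
`LocallyConstant X K`. It is a `*`-algebra under the pointwise involution. -/
instance LocallyConstant.instStarRingOfField {X K : Type*} [TopologicalSpace X] [Field K]
    [StarRing K] : StarRing (LocallyConstant X K) where
  star f := f.map star
  star_involutive f := by ext x; simp
  star_mul f g := by ext x; simp [mul_comm]
  star_add f g := by ext x; simp

theorem LocallyConstant.star_apply {X K : Type*} [TopologicalSpace X] [Field K] [StarRing K]
    (f : LocallyConstant X K) (x : X) : star f x = star (f x) := rfl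

/-- A partial action `θ` of a discrete group `G` on a topological space `X` with clopen domains:
`θ g` restricts to a homeomorphism from `dom g⁻¹` onto `dom g` (its values off `dom g⁻¹` are
irrelevant), `θ 1` is the identity of `X`, and `θ (g * h)` extends `θ g ∘ θ h`. -/
structure TopPartialAction (G X : Type*) [Group G] [TopologicalSpace X] where
  /-- the domain `U_g`, which is the range of `θ g` -/
  dom : G → Set X
  /-- the partial homeomorphism `θ_g : U_{g⁻¹} → U_g` -/
  θ : G → X → X
  isClopen_dom : ∀ g, IsClopen (dom g)
  mapsTo : ∀ g, Set.MapsTo (θ g) (dom g⁻¹) (dom g)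
  continuousOn : ∀ g, ContinuousOn (θ g) (dom g⁻¹)
  dom_one : dom 1 = Set.univ
  θ_one : ∀ x, θ 1 x = x
  comp : ∀ g h x, x ∈ dom h⁻¹ → θ h x ∈ dom g⁻¹ →
    x ∈ dom (g * h)⁻¹ ∧ θ g (θ h x) = θ (g * h) x

namespace TopPartialAction

variable {G X : Type*} [Group G] [TopologicalSpace X] (P : TopPartialAction G X)

theorem inv_apply {g : G} {x : X} (hx : x ∈ P.dom g⁻¹) : P.θ g⁻¹ (P.θ g x) = x := by
  have h := (P.comp g⁻¹ g x hx (by simpa using P.mapsTo g hx)).2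
  rw [h, inv_mul_cancel, P.θ_one]

theorem inv_apply' {g : G} {x : X} (hx : x ∈ P.dom g) : P.θ g (P.θ g⁻¹ x) = x := by
  have := P.inv_apply (g := g⁻¹) (x := x) (by simpa using hx)
  simpa using this

theorem mapsTo_inv {g : G} {x : X} (hx : x ∈ P.dom g) : P.θ g⁻¹ x ∈ P.dom g⁻¹ :=
  P.mapsTo g⁻¹ (by simpa using hx)

variable {K : Type*} [Field K]

open scoped Classical in
/-- The induced map `α_g` on functions: `α_g f` is `f ∘ θ_{g⁻¹}` on `U_g` and zero elsewhere.
It restricts to the isomorphism `α_g : D_{g⁻¹} → D_g` of the induced partial action. -/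
noncomputable def α (g : G) (f : LocallyConstant X K) : LocallyConstant X K where
  toFun x := if x ∈ P.dom g then f (P.θ g⁻¹ x) else 0
  isLocallyConstant := by
    rw [IsLocallyConstant.iff_exists_open]
    intro x
    by_cases hx : x ∈ P.dom g
    · have hc : ContinuousOn (P.θ g⁻¹) (P.dom g) := by simpa using P.continuousOn g⁻¹
      refine ⟨P.dom g ∩ P.θ g⁻¹ ⁻¹' (f ⁻¹' {f (P.θ g⁻¹ x)}),
        hc.isOpen_inter_preimage (P.isClopen_dom g).isOpen (f.isLocallyConstant _),
        ⟨hx, rfl⟩, ?_⟩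
      rintro y ⟨hy, hy'⟩
      rw [if_pos hy, if_pos hx]
      exact hy'
    · exact ⟨(P.dom g)ᶜ, (P.isClopen_dom g).compl.isOpen, hx, fun y hy => by
        rw [if_neg hx, if_neg hy]⟩

theorem α_apply_of_mem {g : G} {x : X} (hx : x ∈ P.dom g) (f : LocallyConstant X K) :
    P.α g f x = f (P.θ g⁻¹ x) := if_pos hx

theorem α_apply_of_notMem {g : G} {x : X} (hx : x ∉ P.dom g) (f : LocallyConstant X K) :
    P.α g f x = 0 := if_neg hx

variable (K) in
/-- The ideal `D_g` of `C_K(X)` of the functions vanishing outside `U_g`. -/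
def D (g : G) : Ideal (LocallyConstant X K) where
  carrier := {f | ∀ x ∉ P.dom g, f x = 0}
  zero_mem' _ _ := rfl
  add_mem' hf hg x hx := by simp [hf x hx, hg x hx]
  smul_mem' c f hf x hx := by simp [hf x hx]

variable (K) in
/-- The characteristic function `e(g)` of `U_g`. -/
noncomputable def e (g : G) : P.D K g :=
  ⟨LocallyConstant.charFn K (P.isClopen_dom g), fun x hx => by
    rw [LocallyConstant.coe_charFn, Set.indicator_of_notMem hx]⟩

theorem α_mem (g : G) (f : LocallyConstant X K) : P.α g f ∈ P.D K g :=
  fun _ hx => P.α_apply_of_notMem hx f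

theorem α_add (g : G) (f f' : LocallyConstant X K) : P.α g (f + f') = P.α g f + P.α g f' := by
  ext x
  by_cases hx : x ∈ P.dom g <;> simp [α, hx]

theorem α_mul (g : G) (f f' : LocallyConstant X K) : P.α g (f * f') = P.α g f * P.α g f' := by
  ext x
  by_cases hx : x ∈ P.dom g <;> simp [α, hx]

theorem α_zero (g : G) : P.α g (0 : LocallyConstant X K) = 0 := by
  ext x
  simp [α]

theorem α_one (f : LocallyConstant X K) : P.α 1 f = f := by
  ext x
  simp [α, P.dom_one, P.θ_one]

/-- On `D_g` one has `α_g (α_{g⁻¹}(a) b) = a α_g(b)`. -/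
theorem α_α_inv_mul {g : G} {a : LocallyConstant X K} (ha : a ∈ P.D K g)
    (b : LocallyConstant X K) : P.α g (P.α g⁻¹ a * b) = a * P.α g b := by
  ext x
  by_cases hx : x ∈ P.dom g
  · have h := P.mapsTo_inv hx
    rw [P.α_apply_of_mem hx, LocallyConstant.mul_apply, LocallyConstant.mul_apply,
      P.α_apply_of_mem hx, P.α_apply_of_mem h, inv_inv, P.inv_apply' hx]
  · rw [P.α_apply_of_notMem hx, LocallyConstant.mul_apply, ha x hx, zero_mul]

/-- `α_g (b α_h(c)) = α_g(b) α_{gh}(c)` for `b ∈ D_h`. -/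
theorem α_mul_α {g h : G} {b : LocallyConstant X K} (hb : b ∈ P.D K h)
    (c : LocallyConstant X K) : P.α g (b * P.α h c) = P.α g b * P.α (g * h) c := by
  ext x
  by_cases hx : x ∈ P.dom g
  · rw [P.α_apply_of_mem hx, LocallyConstant.mul_apply, LocallyConstant.mul_apply,
      P.α_apply_of_mem hx]
    by_cases hy : P.θ g⁻¹ x ∈ P.dom h
    · obtain ⟨h₁, h₂⟩ := P.comp h⁻¹ g⁻¹ x (by simpa using hx) (by simpa using hy)
      have h₃ : x ∈ P.dom (g * h) := by simpa using h₁
      rw [P.α_apply_of_mem hy, P.α_apply_of_mem h₃, h₂, mul_inv_rev]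
    · rw [hb _ hy, zero_mul, zero_mul]
  · rw [P.α_apply_of_notMem hx, LocallyConstant.mul_apply, P.α_apply_of_notMem hx, zero_mul]

theorem mul_mem_D_mul {g h : G} {a b : LocallyConstant X K} (ha : a ∈ P.D K g)
    (hb : b ∈ P.D K h) : P.α g (P.α g⁻¹ a * b) ∈ P.D K (g * h) := by
  intro x hx
  rw [P.α_α_inv_mul ha, LocallyConstant.mul_apply]
  by_cases hxg : x ∈ P.dom g
  · have hy : P.θ g⁻¹ x ∉ P.dom h := fun hy => hx (by
      simpa using (P.comp h⁻¹ g⁻¹ x (by simpa using hxg) (by simpa using hy)).1)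
    rw [P.α_apply_of_mem hxg, hb _ hy, mul_zero]
  · rw [ha x hxg, zero_mul]

/-- `α_h (α_g(f)) = α_{hg}(f)` for `f ∈ D_{g⁻¹}`. -/
theorem α_α {g h : G} {f : LocallyConstant X K} (hf : f ∈ P.D K g⁻¹) :
    P.α h (P.α g f) = P.α (h * g) f := by
  ext x
  by_cases hx : x ∈ P.dom h
  · rw [P.α_apply_of_mem hx]
    by_cases hy : P.θ h⁻¹ x ∈ P.dom g
    · obtain ⟨h₁, h₂⟩ := P.comp g⁻¹ h⁻¹ x (by simpa using hx) (by simpa using hy)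
      have h₃ : x ∈ P.dom (h * g) := by simpa using h₁
      rw [P.α_apply_of_mem hy, P.α_apply_of_mem h₃, h₂, mul_inv_rev]
    · rw [P.α_apply_of_notMem hy]
      by_cases hz : x ∈ P.dom (h * g)
      · rw [P.α_apply_of_mem hz]
        refine (hf _ fun hw => hy ?_).symm
        obtain ⟨-, h₂⟩ := P.comp g (h * g)⁻¹ x (by simpa using hz) hw
        rw [mul_inv_rev, mul_inv_cancel_left] at h₂
        rw [← h₂]
        exact P.mapsTo g (by simpa using hw)
      · rw [P.α_apply_of_notMem hz]
  · rw [P.α_apply_of_notMem hx]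
    by_cases hz : x ∈ P.dom (h * g)
    · rw [P.α_apply_of_mem hz]
      refine (hf _ fun hw => hx ?_).symm
      obtain ⟨h₁, -⟩ := P.comp g (h * g)⁻¹ x (by simpa using hz) hw
      simpa using h₁
    · rw [P.α_apply_of_notMem hz]

theorem α_star [StarRing K] (g : G) (f : LocallyConstant X K) : P.α g (star f) = star (P.α g f) := by
  ext x
  by_cases hx : x ∈ P.dom g
  · simp [P.α_apply_of_mem hx, LocallyConstant.star_apply]
  · simp [P.α_apply_of_notMem hx, LocallyConstant.star_apply]

variable (K) in
/-- The family of ideals `D_g`, indexed by the group written additively (so that the API for graded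
rings applies). -/
abbrev component (i : Additive G) : Type _ := P.D K i.toMul

noncomputable instance : GradedMonoid.GOne (P.component K) where
  one := ⟨1, fun x hx => absurd (by simp [P.dom_one]) hx⟩

noncomputable instance : GradedMonoid.GMul (P.component K) where
  mul {i _} a b := ⟨P.α i.toMul (P.α i.toMul⁻¹ a.1 * b.1), P.mul_mem_D_mul a.2 b.2⟩

noncomputable instance : GradedMonoid.GMonoid (P.component K) where
  one_mul := fun ⟨i, a⟩ => Sigma.subtype_ext (zero_add i) (by
    change P.α 1 (P.α 1⁻¹ 1 * a.1) = a.1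
    rw [inv_one, P.α_one, P.α_one, one_mul])
  mul_one := fun ⟨i, a⟩ => Sigma.subtype_ext (add_zero i) (by
    change P.α i.toMul (P.α i.toMul⁻¹ a.1 * 1) = a.1
    rw [P.α_α_inv_mul a.2]
    ext x
    by_cases hx : x ∈ P.dom i.toMul
    · simp [P.α_apply_of_mem hx]
    · simp [a.2 x hx])
  mul_assoc := fun ⟨i, a⟩ ⟨j, b⟩ ⟨k, c⟩ => Sigma.subtype_ext (add_assoc i j k) (by
    change P.α (i.toMul * j.toMul) (P.α (i.toMul * j.toMul)⁻¹
        (P.α i.toMul (P.α i.toMul⁻¹ a.1 * b.1)) * c.1) =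
      P.α i.toMul (P.α i.toMul⁻¹ a.1 * P.α j.toMul (P.α j.toMul⁻¹ b.1 * c.1))
    rw [P.α_α_inv_mul (P.mul_mem_D_mul a.2 b.2), P.α_α_inv_mul a.2, P.α_α_inv_mul a.2,
      P.α_α_inv_mul b.2, P.α_mul_α b.2, mul_assoc])

noncomputable instance : DirectSum.GRing (P.component K) where
  mul_zero {i _} a := Subtype.ext (by
    change P.α i.toMul (P.α i.toMul⁻¹ a.1 * 0) = 0
    rw [mul_zero, α_zero])
  zero_mul {i _} b := Subtype.ext (by
    change P.α i.toMul (P.α i.toMul⁻¹ 0 * b.1) = 0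
    rw [α_zero, zero_mul, α_zero])
  mul_add {i _} a b c := Subtype.ext (by
    change P.α i.toMul (P.α i.toMul⁻¹ a.1 * (b.1 + c.1)) = P.α i.toMul (P.α i.toMul⁻¹ a.1 * b.1) +
      P.α i.toMul (P.α i.toMul⁻¹ a.1 * c.1)
    rw [mul_add, α_add])
  add_mul {i _} a b c := Subtype.ext (by
    change P.α i.toMul (P.α i.toMul⁻¹ (a.1 + b.1) * c.1) =
      P.α i.toMul (P.α i.toMul⁻¹ a.1 * c.1) + P.α i.toMul (P.α i.toMul⁻¹ b.1 * c.1)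
    rw [α_add, add_mul, α_add])
  natCast n := ⟨n, fun x hx => absurd (by simp [P.dom_one]) hx⟩
  natCast_zero := Subtype.ext Nat.cast_zero
  natCast_succ n := Subtype.ext (Nat.cast_succ n)
  intCast n := ⟨n, fun x hx => absurd (by simp [P.dom_one]) hx⟩
  intCast_ofNat n := Subtype.ext (Int.cast_natCast n)
  intCast_negSucc_ofNat n := Subtype.ext (Int.cast_negSucc n)

noncomputable instance : DirectSum.GAlgebra K (P.component K) where
  toFun :=
    { toFun := fun c => ⟨algebraMap K _ c, fun x hx => absurd (by simp [P.dom_one]) hx⟩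
      map_zero' := Subtype.ext (map_zero _)
      map_add' := fun a b => Subtype.ext (map_add _ a b) }
  map_one := Subtype.ext (map_one _)
  map_mul c d := Sigma.subtype_ext (zero_add 0).symm (by
    change algebraMap K _ (c * d) = P.α 1 (P.α 1⁻¹ (algebraMap K _ c) * algebraMap K _ d)
    rw [inv_one, P.α_one, P.α_one, map_mul])
  commutes := fun c ⟨i, a⟩ => Sigma.subtype_ext ((zero_add i).trans (add_zero i).symm) (by
    change P.α 1 (P.α 1⁻¹ (algebraMap K _ c) * a.1) =
      P.α i.toMul (P.α i.toMul⁻¹ a.1 * algebraMap K _ c)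
    rw [inv_one, P.α_one, P.α_one, P.α_α_inv_mul a.2]
    ext x
    by_cases hx : x ∈ P.dom i.toMul
    · simp [P.α_apply_of_mem hx, mul_comm]
    · simp [a.2 x hx])
  smul_def := fun c ⟨i, a⟩ => Sigma.subtype_ext (zero_add i).symm (by
    change c • a.1 = P.α 1 (P.α 1⁻¹ (algebraMap K _ c) * a.1)
    rw [inv_one, P.α_one, P.α_one, Algebra.smul_def])

variable [DecidableEq G]

variable (K) in
/-- The algebraic crossed product `C_K(X) ⋊_α G`: finite formal sums `∑ a_g δ_g` with `a_g ∈ D_g`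
and product `(a_g δ_g) (b_h δ_h) = α_g (α_{g⁻¹}(a_g) b_h) δ_{gh}`. -/
def CrossedProduct : Type _ := DirectSum (Additive G) (P.component K)

noncomputable instance : Ring (P.CrossedProduct K) :=
  inferInstanceAs (Ring (DirectSum (Additive G) (P.component K)))

noncomputable instance : Algebra K (P.CrossedProduct K) :=
  inferInstanceAs (Algebra K (DirectSum (Additive G) (P.component K)))

/-- The element `a δ_g` of the crossed product, for `a ∈ D_g`. -/
noncomputable def single (g : G) : P.D K g →+ P.CrossedProduct K :=
  DirectSum.of (P.component K) (Additive.ofMul g)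

theorem single_mul_single {g h : G} (a : P.D K g) (b : P.D K h) :
    P.single g a * P.single h b =
      P.single (g * h) ⟨P.α g (P.α g⁻¹ a.1 * b.1), P.mul_mem_D_mul a.2 b.2⟩ :=
  DirectSum.of_mul_of _ _

/-- The element `f δ_1` of the crossed product, for `f ∈ C_K(X)`. -/
noncomputable def ofFun (f : LocallyConstant X K) : P.CrossedProduct K :=
  P.single 1 ⟨f, fun x hx => absurd (by simp [P.dom_one]) hx⟩

theorem single_congr {g h : G} (hgh : g = h) {a : P.D K g} {b : P.D K h} (hab : a.1 = b.1) :
    P.single g a = P.single h b := by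
  subst hgh
  rw [Subtype.ext hab]

theorem smul_single (c : K) {g : G} (a : P.D K g) : c • P.single g a = P.single g (c • a) := by
  refine (Algebra.smul_def c (P.single g a)).trans ?_
  refine (DirectSum.of_mul_of (A := P.component K) _ _).trans ?_
  refine P.single_congr (one_mul g) ?_
  change P.α 1 (P.α 1⁻¹ (algebraMap K _ c) * a.1) = c • a.1
  rw [inv_one, P.α_one, P.α_one, Algebra.smul_def]

theorem induction_on {motive : P.CrossedProduct K → Prop} (a : P.CrossedProduct K)
    (zero : motive 0) (single : ∀ g (a : P.D K g), motive (P.single g a))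
    (add : ∀ a b, motive a → motive b → motive (a + b)) : motive a :=
  DirectSum.induction_on a zero (fun i a => single i.toMul a) add

variable [StarRing K]

/-- The involution of the crossed product: `(a δ_g)* = α_{g⁻¹}(a*) δ_{g⁻¹}`. -/
noncomputable def starHom : P.CrossedProduct K →+ P.CrossedProduct K :=
  DirectSum.toAddMonoid fun i => (P.single i.toMul⁻¹).comp
    { toFun := fun a => ⟨P.α i.toMul⁻¹ (star a.1), P.α_mem _ _⟩
      map_zero' := Subtype.ext (by simp [α_zero])
      map_add' := fun a b => Subtype.ext (by simp [α_add]) }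

theorem starHom_single {g : G} (a : P.D K g) :
    P.starHom (P.single g a) = P.single g⁻¹ ⟨P.α g⁻¹ (star a.1), P.α_mem _ _⟩ :=
  DirectSum.toAddMonoid_of _ _ _

theorem starHom_starHom (a : P.CrossedProduct K) : P.starHom (P.starHom a) = a := by
  induction a using induction_on with
  | zero => rw [map_zero, map_zero]
  | add a b ha hb => rw [map_add, map_add, ha, hb]
  | single g a =>
    rw [starHom_single, starHom_single]
    refine P.single_congr (inv_inv _) ?_
    change P.α g⁻¹⁻¹ (star (P.α g⁻¹ (star a.1))) = a.1
    have h := P.α_α (g := g⁻¹) (h := g) (f := a.1) (by rw [inv_inv]; exact a.2)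
    rw [← α_star, star_star, inv_inv, h, mul_inv_cancel, α_one]

theorem starHom_mul (a b : P.CrossedProduct K) :
    P.starHom (a * b) = P.starHom b * P.starHom a := by
  induction a using induction_on with
  | zero => rw [zero_mul, map_zero, mul_zero]
  | add a a' ha ha' => rw [add_mul, map_add, map_add, mul_add, ha, ha']
  | single g a =>
    induction b using induction_on with
    | zero => rw [mul_zero, map_zero, zero_mul]
    | add b b' hb hb' => rw [mul_add, map_add, map_add, add_mul, hb, hb']
    | single h b =>
      rw [single_mul_single, starHom_single, starHom_single, starHom_single, single_mul_single]
      refine P.single_congr (mul_inv_rev g h) ?_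
      change P.α (g * h)⁻¹ (star (P.α g (P.α g⁻¹ a.1 * b.1))) =
        P.α h⁻¹ (P.α h⁻¹⁻¹ (P.α h⁻¹ (star b.1)) * P.α g⁻¹ (star a.1))
      have ha : star a.1 ∈ P.D K g := fun x hx => by
        rw [LocallyConstant.star_apply, a.2 x hx, star_zero]
      have h₁ := P.α_mul_α (g := g⁻¹) ha (star b.1)
      rw [inv_mul_cancel, P.α_one] at h₁
      rw [P.α_α_inv_mul a.2, P.α_α_inv_mul (P.α_mem _ _), star_mul, ← α_star, mul_inv_rev,
        ← P.α_mul, mul_comm (star b.1), ← h₁, mul_comm (P.α g (star b.1)),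
        P.α_α (by rw [inv_inv]; exact Ideal.mul_mem_right _ _ ha)]

noncomputable instance : StarRing (P.CrossedProduct K) where
  star := P.starHom
  star_involutive := P.starHom_starHom
  star_mul := P.starHom_mul
  star_add := map_add _

theorem star_single {g : G} (a : P.D K g) :
    star (P.single g a) = P.single g⁻¹ ⟨P.α g⁻¹ (star a.1), P.α_mem _ _⟩ :=
  P.starHom_single a

instance : StarModule K (P.CrossedProduct K) where
  star_smul c a := by
    induction a using induction_on with
    | zero => rw [smul_zero, star_zero, smul_zero]
    | add a b ha hb => rw [smul_add, star_add, ha, hb, star_add, smul_add]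
    | single g a =>
      rw [smul_single, star_single, star_single, smul_single]
      refine P.single_congr rfl ?_
      ext x
      change P.α g⁻¹ (star (c • a.1)) x = star c • P.α g⁻¹ (star a.1) x
      by_cases hx : x ∈ P.dom g⁻¹
      · simp [P.α_apply_of_mem hx, LocallyConstant.star_apply]
      · simp [P.α_apply_of_notMem hx]

end TopPartialAction

/-! ### The universal space `Ω(E, C)` and its partial action of the free group -/

namespace BipartiteSeparatedGraph

section Omega

variable {V₀ V₁ E : Type*} (Γ : BipartiteSeparatedGraph V₀ V₁ E)

/-- The local configuration at `g` of the subset `ξ` of the free group on the edges (given by its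
indicator function) is that of a vertex `w : V₁`: among the elements at distance one from `g`, the
set `ξ` contains exactly the `g e⁻¹` with `s(e) = w`. -/
def IsLocalConfig₁ (ξ : FreeGroup E → Bool) (g : FreeGroup E) (w : V₁) : Prop :=
  ∀ e : E, ξ (g * FreeGroup.of e) = false ∧ (ξ (g * (FreeGroup.of e)⁻¹) = true ↔ Γ.s e = w)

/-- The local configuration at `g` of the subset `ξ` of the free group on the edges is that of a
vertex `v : V₀`: among the elements at distance one from `g`, the set `ξ` contains `g e` for
exactly one `e` in each `X ∈ C_v`, and nothing more. -/
def IsLocalConfig₀ (ξ : FreeGroup E → Bool) (g : FreeGroup E) (v : V₀) : Prop :=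
  (∀ e : E, ξ (g * (FreeGroup.of e)⁻¹) = false) ∧
  (∀ e : E, ξ (g * FreeGroup.of e) = true → Γ.r e = v) ∧
  ∀ X ∈ Γ.C v, ∃! e, e ∈ X ∧ ξ (g * FreeGroup.of e) = true

variable [DecidableEq E]

/-- The configurations: subsets `ξ` of the free group on the edges which contain `1`, are convex,
and have at each of their points the local configuration of some vertex. -/
structure IsConfiguration (ξ : FreeGroup E → Bool) : Prop where
  one_mem : ξ 1 = true
  convex : ∀ g h k : FreeGroup E, ξ g = true → ξ h = true →
    (g⁻¹ * h).norm = (g⁻¹ * k).norm + (k⁻¹ * h).norm → ξ k = true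
  isLocalConfig : ∀ g, ξ g = true →
    (∃ w, Γ.IsLocalConfig₁ ξ g w) ∨ ∃ v, Γ.IsLocalConfig₀ ξ g v

/-- The space `Ω(E, C)` of configurations, with the topology induced by the product topology of
`2^𝔽`, where `𝔽` is the free group on the edges. -/
abbrev Omega : Type _ := {ξ : FreeGroup E → Bool // Γ.IsConfiguration ξ}

/-- A translate `g ξ = {g h : h ∈ ξ}` of a configuration `ξ` with `g⁻¹ ∈ ξ` is a configuration. -/
theorem IsConfiguration.translate {ξ : FreeGroup E → Bool} (hξ : Γ.IsConfiguration ξ)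
    {g : FreeGroup E} (hg : ξ g⁻¹ = true) : Γ.IsConfiguration fun h => ξ (g⁻¹ * h) where
  one_mem := by simpa using hg
  convex a b c ha hb h := hξ.convex _ _ _ ha hb (by
    have key : ∀ x y : FreeGroup E, (g⁻¹ * x)⁻¹ * (g⁻¹ * y) = x⁻¹ * y := fun x y => by group
    rw [key, key, key, h])
  isLocalConfig a ha := by
    rcases hξ.isLocalConfig _ ha with ⟨w, hw⟩ | ⟨v, hv⟩
    · exact Or.inl ⟨w, by simpa only [IsLocalConfig₁, mul_assoc] using hw⟩
    · exact Or.inr ⟨v, by simpa only [IsLocalConfig₀, mul_assoc] using hv⟩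

/-- The canonical partial action of the free group on the edges on `Ω(E, C)`: the domains are
`Ω_g = {ξ : g ∈ ξ}`, and `θ_g : Ω_{g⁻¹} → Ω_g` is `ξ ↦ g ξ`. -/
def partialAction : TopPartialAction (FreeGroup E) Γ.Omega where
  dom g := {ξ | ξ.1 g = true}
  θ g ξ := if h : ξ.1 g⁻¹ = true then ⟨fun k => ξ.1 (g⁻¹ * k), ξ.2.translate Γ h⟩ else ξ
  isClopen_dom g :=
    (isClopen_discrete {true}).preimage ((continuous_apply g).comp continuous_subtype_val)
  mapsTo g ξ hξ := by
    have h : ξ.1 g⁻¹ = true := hξ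
    simp [h, ξ.2.one_mem]
  continuousOn g := by
    rw [continuousOn_iff_continuous_domRestrict]
    have : Continuous fun ξ : {ξ : Γ.Omega | ξ.1 g⁻¹ = true} =>
        (⟨fun k => ξ.1.1 (g⁻¹ * k), ξ.1.2.translate Γ ξ.2⟩ : Γ.Omega) :=
      Continuous.subtype_mk (continuous_pi fun k =>
        (continuous_apply (g⁻¹ * k)).comp (g := fun p : FreeGroup E → Bool => p (g⁻¹ * k))
          (f := fun ξ : {ξ : Γ.Omega | ξ.1 g⁻¹ = true} => ξ.1.1)
          (continuous_subtype_val.comp continuous_subtype_val)) _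
    convert this using 2 with ξ
    exact dif_pos ξ.2
  dom_one := Set.eq_univ_of_forall fun ξ => ξ.2.one_mem
  θ_one ξ := by simp [ξ.2.one_mem]
  comp g h ξ hξ hθ := by
    have h₁ : ξ.1 h⁻¹ = true := hξ
    simp only [Set.mem_ofPred_eq, dif_pos h₁] at hθ
    have h₂ : ξ.1 (g * h)⁻¹ = true := by rw [mul_inv_rev]; exact hθ
    refine ⟨h₂, ?_⟩
    rw [dif_pos h₁, dif_pos hθ, dif_pos h₂]
    simp [mul_assoc]

end Omega

end BipartiteSeparatedGraph

/-! The isomorphism. The elements `δ_x` of the crossed product satisfy all defining relations, and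
elements `a δ_g` have their `x x*` in the commutative algebra `C_K(Ω)`, so there is a
`*`-homomorphism `lAbHom` on `L^ab`. No inverse is written down; bijectivity is proved instead. In
`L^ab` the edges form a tame family: range projections of words commute, so replacing a word by its
reduced form costs only a projection. Hence `L^ab` is the sum of the spaces `D u_g`, where `u_g` is
the value of the reduced word of `g` and the diagonal `D` is generated by the commuting idempotents
`u_g u_g*`. Characters of such an algebra separate its points. A character `χ` of `D` yields the set
of all `g` with `χ(u_g u_g*) = 1`, and this set is a configuration (`isConfiguration_of_char`):
translating `χ` by `u_g` reduces the local condition at `g` to the one at the root, where it is read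
off the relations between vertices and edges. Thus a diagonal element with image zero is killed by
every character and vanishes; comparing coefficients of `δ_g` extends this to `L^ab`
(`lAbHom_injective`). Surjectivity holds because the functions `e(g)` generate `C_K(Ω)`, by
compactness (`adjoin_e_eq_top`).

Property (SP). Multiply `a` by some `δ_g` so that the coefficient at the identity is nonzero. On a
clopen set `W` this coefficient is a nonzero constant, and if `W` is disjoint from its translates by
the finitely many other group elements in the support, compressing by the characteristic function of
`W` leaves a multiple of that function (`exists_corner_eq_smul`). The ideal statements follow by
algebra. Such a `W` exists because the action is topologically free.

Topological freeness (`not_isLocallyPeriodic`). Suppose that all configurations near `ξ` are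
invariant under `g ≠ 1`. Move the root to a point of minimal displacement; then `g` is cyclically
reduced. Its word, read from a root in `V₁`, is a closed path, and condition (L) provides an entry
at some vertex on it (`IsClosedPath.exists_entry`), which may be taken as the root. Beyond an entry
a configuration can be continued in two ways, so one branch at the root can be replaced by a
different one (`glue`). Far away along the axis of `g`, in a direction avoiding this branch, nothing
has changed. Seen from there the new configuration is near `ξ`, hence invariant, yet it differs from
its own translate (`IsMinimalPeriodic.not_isEntry`). -/

namespace FreeGroup

/-! ### Reduced words, first letters and geodesics in a free group. -/

variable {α : Type*}

/-- The formal inverse of a letter. -/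
def letterInv (x : α × Bool) : α × Bool := (x.1, !x.2)

@[simp] theorem letterInv_letterInv (x : α × Bool) : letterInv (letterInv x) = x := by
  simp [letterInv]

theorem letterInv_ne (x : α × Bool) : letterInv x ≠ x := by
  intro h
  have := congrArg Prod.snd h
  simp [letterInv] at this

/-- `IsReduced` is a chain condition for the relation negated here; its failure at two consecutive
letters means that they cancel. -/
theorem not_rel_iff_eq_letterInv {x y : α × Bool} :
    ¬ (x.1 = y.1 → x.2 = y.2) ↔ y = letterInv x := by
  obtain ⟨a, b⟩ := x
  obtain ⟨c, d⟩ := y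
  cases b <;> cases d <;> simp [letterInv, eq_comm]

theorem rel_iff_ne_letterInv {x y : α × Bool} :
    (x.1 = y.1 → x.2 = y.2) ↔ y ≠ letterInv x := by
  rw [Ne, ← not_rel_iff_eq_letterInv, not_not]

theorem mk_letterInv (x : α × Bool) : mk [letterInv x] = (mk [x])⁻¹ := by
  simp [inv_mk, invRev, letterInv]

theorem mk_append (L M : List (α × Bool)) : mk (L ++ M) = mk L * mk M := mul_mk.symm

theorem mk_cons (x : α × Bool) (L : List (α × Bool)) : mk (x :: L) = mk [x] * mk L := by
  rw [mul_mk, List.singleton_append]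

theorem isReduced_append {L M : List (α × Bool)} :
    IsReduced (L ++ M) ↔ IsReduced L ∧ IsReduced M ∧
      ∀ x ∈ L.getLast?, ∀ y ∈ M.head?, y ≠ letterInv x := by
  simp only [IsReduced, List.isChain_append, rel_iff_ne_letterInv]

theorem head?_invRev (L : List (α × Bool)) : (invRev L).head? = L.getLast?.map letterInv := by
  simp only [invRev, List.head?_reverse, List.getLast?_map]
  rfl

theorem getLast?_invRev (L : List (α × Bool)) : (invRev L).getLast? = L.head?.map letterInv := by
  simp only [invRev, List.getLast?_reverse, List.head?_map]
  rfl

theorem invRev_singleton (x : α × Bool) : invRev [x] = [letterInv x] := rfl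

variable [DecidableEq α]

theorem IsReduced.toWord_mk {L : List (α × Bool)} (h : IsReduced L) : (mk L).toWord = L := by
  rw [FreeGroup.toWord_mk, h.reduce_eq]

theorem norm_mk {L : List (α × Bool)} (h : IsReduced L) : (mk L).norm = L.length := by
  rw [norm, h.toWord_mk]

theorem toWord_mul_of_isReduced {g h : FreeGroup α} (H : IsReduced (g.toWord ++ h.toWord)) :
    (g * h).toWord = g.toWord ++ h.toWord := by
  rw [toWord_mul, H.reduce_eq]

/-- A reduced word followed by one letter can cancel only at the junction. So either the letter
prolongs the word or it removes the last letter. -/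
theorem toWord_mul_letter (g : FreeGroup α) (x : α × Bool) :
    (g * mk [x]).toWord = g.toWord ++ [x] ∨ g.toWord = (g * mk [x]).toWord ++ [letterInv x] := by
  by_cases h : IsReduced (g.toWord ++ [x])
  · left
    rw [← h.toWord_mk, mk_append, mk_toWord]
  · right
    rw [isReduced_append] at h
    push Not at h
    obtain ⟨y, hy, z, hz, hzy⟩ := h isReduced_toWord IsReduced.singleton
    obtain rfl : x = z := by simpa using hz
    subst hzy
    obtain ⟨L, hL⟩ := List.getLast?_eq_some_iff.1 hy
    have hg : g = mk L * mk [y] := by rw [← mk_append, ← hL, mk_toWord]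
    have hr : IsReduced L := (isReduced_append.1 (hL ▸ isReduced_toWord)).1
    rw [letterInv_letterInv, mk_letterInv, hg, mul_inv_cancel_right, hr.toWord_mk, ← hg, hL]

theorem toWord_letter_mul (x : α × Bool) (g : FreeGroup α) :
    (mk [x] * g).toWord = x :: g.toWord ∨ g.toWord = letterInv x :: (mk [x] * g).toWord := by
  have h := toWord_mul_letter g⁻¹ (letterInv x)
  have e : g⁻¹ * mk [letterInv x] = (mk [x] * g)⁻¹ := by rw [mul_inv_rev, mk_letterInv]
  rw [e, toWord_inv, toWord_inv, letterInv_letterInv] at h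
  refine h.imp (fun h => ?_) (fun h => ?_)
  · have := congrArg invRev h
    simpa [invRev_invRev, invRev_append, invRev_singleton] using this
  · have := congrArg invRev h
    simpa [invRev_invRev, invRev_append, invRev_singleton] using this

theorem toWord_inv_mul_of_head {g h : FreeGroup α}
    (H : ∀ x ∈ g.toWord.head?, x ∉ h.toWord.head?) :
    (g⁻¹ * h).toWord = invRev g.toWord ++ h.toWord := by
  rw [← toWord_inv]
  refine toWord_mul_of_isReduced (isReduced_append.2 ⟨isReduced_toWord, isReduced_toWord, ?_⟩)
  intro x hx y hy hxy
  rw [toWord_inv, getLast?_invRev] at hx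
  obtain ⟨z, hz, rfl⟩ := Option.mem_map.1 hx
  rw [letterInv_letterInv] at hxy
  subst hxy
  exact H _ hz hy

theorem norm_inv_mul_of_head {g h : FreeGroup α}
    (H : ∀ x ∈ g.toWord.head?, x ∉ h.toWord.head?) : (g⁻¹ * h).norm = g.norm + h.norm := by
  rw [norm, toWord_inv_mul_of_head H, List.length_append, invRev_length, norm, norm]

/-- A common first letter would cancel in `g⁻¹ h` and make it shorter by at least two. -/
theorem head_of_norm_inv_mul {g h : FreeGroup α} (H : (g⁻¹ * h).norm = g.norm + h.norm) :
    ∀ x ∈ g.toWord.head?, x ∉ h.toWord.head? := by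
  intro x hg hh
  obtain ⟨L, hL⟩ := List.head?_eq_some_iff.1 hg
  obtain ⟨M, hM⟩ := List.head?_eq_some_iff.1 hh
  have e : g⁻¹ * h = (mk L)⁻¹ * mk M := by
    rw [← mk_toWord (x := g), ← mk_toWord (x := h), hL, hM, mk_cons x L, mk_cons x M]
    group
  have h₁ : (g⁻¹ * h).norm ≤ L.length + M.length := by
    rw [e]
    refine (norm_mul_le _ _).trans ?_
    rw [norm_inv_eq]
    exact add_le_add norm_mk_le norm_mk_le
  rw [H, norm, norm, hL, hM, List.length_cons, List.length_cons] at h₁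
  omega

theorem toWord_mul_of_norm {g h : FreeGroup α} (H : (g * h).norm = g.norm + h.norm) :
    (g * h).toWord = g.toWord ++ h.toWord := by
  have h₁ := toWord_inv_mul_of_head (g := g⁻¹) (h := h)
    (head_of_norm_inv_mul (by rw [inv_inv, H, norm_inv_eq]))
  rwa [inv_inv, toWord_inv, invRev_invRev] at h₁

/-- A point on a geodesic from `g` to `h` lies on the geodesic from `1` to `g` or on the geodesic
from `1` to `h`. -/
theorem norm_eq_or_of_geodesic {g h k : FreeGroup α}
    (H : (g⁻¹ * h).norm = (g⁻¹ * k).norm + (k⁻¹ * h).norm) :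
    g.norm = k.norm + (k⁻¹ * g).norm ∨ h.norm = k.norm + (k⁻¹ * h).norm := by
  have H' : ((k⁻¹ * g)⁻¹ * (k⁻¹ * h)).norm = (k⁻¹ * g).norm + (k⁻¹ * h).norm := by
    have e₁ : (k⁻¹ * g)⁻¹ * (k⁻¹ * h) = g⁻¹ * h := by group
    have e₂ : (k⁻¹ * g).norm = (g⁻¹ * k).norm := by
      rw [← norm_inv_eq]
      congr 1
      group
    rw [e₁, e₂, H]
  have hd := head_of_norm_inv_mul H'
  -- Seen from `k`, the points `g` and `h` lie behind different first letters, so the direction from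
  -- `k` to `1` can coincide with that of at most one of them. For the other one, `k` lies between
  -- it and `1`.
  by_cases hg : ∀ x ∈ k⁻¹.toWord.head?, x ∉ (k⁻¹ * g).toWord.head?
  · left
    have := norm_inv_mul_of_head hg
    rwa [inv_inv, mul_inv_cancel_left, norm_inv_eq] at this
  · right
    push Not at hg
    obtain ⟨x, hx, hxg⟩ := hg
    have := norm_inv_mul_of_head (g := k⁻¹) (h := k⁻¹ * h) (fun y hy hyh => by
      obtain rfl : x = y := by
        rw [Option.mem_def] at hx hy
        exact Option.some_injective _ (hx.symm.trans hy)
      exact hd _ hxg hyh)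
    rwa [inv_inv, mul_inv_cancel_left, norm_inv_eq] at this

/-- A set of group elements (given by its indicator function) is prefix closed. -/
def PrefixClosed (ξ : FreeGroup α → Bool) : Prop :=
  ∀ g x, (g * mk [x]).toWord = g.toWord ++ [x] → ξ (g * mk [x]) = true → ξ g = true

theorem PrefixClosed.of_append {ξ : FreeGroup α → Bool} (hξ : PrefixClosed ξ)
    {L M : List (α × Bool)} (h : IsReduced (L ++ M)) (hm : ξ (mk (L ++ M)) = true) :
    ξ (mk L) = true := by
  induction M using List.reverseRecOn with
  | nil => simpa using hm
  | append_singleton M x ih =>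
    rw [← List.append_assoc] at h hm
    have h' := (isReduced_append.1 h).1
    refine ih h' (hξ (mk (L ++ M)) x ?_ ?_)
    · rw [← mk_append, h.toWord_mk, h'.toWord_mk]
    · rwa [← mk_append]

theorem PrefixClosed.of_norm {ξ : FreeGroup α → Bool} (hξ : PrefixClosed ξ)
    {g k : FreeGroup α} (h : g.norm = k.norm + (k⁻¹ * g).norm) (hg : ξ g = true) :
    ξ k = true := by
  have e : k * (k⁻¹ * g) = g := by group
  have hw := toWord_mul_of_norm (g := k) (h := k⁻¹ * g) (by rw [e, h])
  rw [e] at hw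
  have := hξ.of_append (L := k.toWord) (M := (k⁻¹ * g).toWord) (hw ▸ isReduced_toWord)
    (by rwa [← hw, mk_toWord])
  rwa [mk_toWord] at this

/-- The Cayley graph is a tree, so a geodesic between two points is covered by the geodesics from
`1` to them. Convexity thus only has to be tested on prefixes. -/
theorem PrefixClosed.convex {ξ : FreeGroup α → Bool} (hξ : PrefixClosed ξ) (g h k : FreeGroup α)
    (hg : ξ g = true) (hh : ξ h = true)
    (H : (g⁻¹ * h).norm = (g⁻¹ * k).norm + (k⁻¹ * h).norm) : ξ k = true :=
  (norm_eq_or_of_geodesic H).elim (fun h => hξ.of_norm h hg) fun h => hξ.of_norm h hh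

theorem prefixClosed_of_convex {ξ : FreeGroup α → Bool} (h₁ : ξ 1 = true)
    (hξ : ∀ g h k : FreeGroup α, ξ g = true → ξ h = true →
      (g⁻¹ * h).norm = (g⁻¹ * k).norm + (k⁻¹ * h).norm → ξ k = true) : PrefixClosed ξ := by
  intro g x hw hx
  refine hξ 1 (g * mk [x]) g h₁ hx ?_
  rw [inv_one, one_mul, one_mul, inv_mul_cancel_left, norm, hw, List.length_append,
    norm_mk IsReduced.singleton, norm]

/-- A neighbour of `g ≠ 1` different from `1` has the same first letter as `g`. -/
theorem head?_mul_letter {g : FreeGroup α} {x : α × Bool} (hg : g ≠ 1) (hgx : g * mk [x] ≠ 1) :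
    (g * mk [x]).toWord.head? = g.toWord.head? := by
  rcases toWord_mul_letter g x with h | h <;> rw [h]
  · have : g.toWord ≠ [] := by rwa [Ne, toWord_eq_nil_iff]
    rw [List.head?_append_of_ne_nil _ this]
  · have : (g * mk [x]).toWord ≠ [] := by rwa [Ne, toWord_eq_nil_iff]
    rw [List.head?_append_of_ne_nil _ this]

/-- The letters of `h` are too few to bring `g` back to `1`, and a walk that avoids `1` cannot
change its first letter. -/
theorem head?_mul_of_norm_lt {g h : FreeGroup α} (H : h.norm < g.norm) :
    (g * h).toWord.head? = g.toWord.head? := by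
  suffices ∀ (L : List (α × Bool)) (g : FreeGroup α), L.length < g.norm →
      (g * mk L).toWord.head? = g.toWord.head? by
    simpa only [mk_toWord] using this h.toWord g H
  intro L
  induction L using List.reverseRecOn with
  | nil => simp [← one_eq_mk]
  | append_singleton L x ih =>
    intro g hg
    rw [List.length_append, List.length_singleton] at hg
    rw [mk_append, ← mul_assoc]
    have key : ∀ M : List (α × Bool), M.length < g.norm → g * mk M ≠ 1 := by
      intro M hM h1
      rw [mul_eq_one_iff_eq_inv] at h1
      have : g.norm ≤ M.length := by
        rw [h1, norm_inv_eq]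
        exact norm_mk_le
      omega
    have h₂ := key (L ++ [x]) (by simpa using hg)
    rw [mk_append, ← mul_assoc] at h₂
    rw [head?_mul_letter (key L (by omega)) h₂, ih g (by omega)]

/-! ### Cyclically reduced elements and their powers. -/

theorem toWord_pow_of_isCyclicallyReduced {g : FreeGroup α} (hg : IsCyclicallyReduced g.toWord)
    (n : ℕ) : (g ^ n).toWord = (List.replicate n g.toWord).flatten := by
  rw [FreeGroup.toWord_pow, (hg.flatten_replicate n).isReduced.reduce_eq]

theorem norm_pow_of_isCyclicallyReduced {g : FreeGroup α} (hg : IsCyclicallyReduced g.toWord)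
    (n : ℕ) : (g ^ n).norm = n * g.norm := by
  rw [norm, toWord_pow_of_isCyclicallyReduced hg, List.length_flatten, norm]
  simp

theorem head?_pow_of_isCyclicallyReduced {g : FreeGroup α} (hg : IsCyclicallyReduced g.toWord)
    {n : ℕ} (hn : n ≠ 0) : (g ^ n).toWord.head? = g.toWord.head? := by
  rw [toWord_pow_of_isCyclicallyReduced hg, List.head?_flatten_replicate hn]

theorem isCyclicallyReduced_inv {g : FreeGroup α} (hg : IsCyclicallyReduced g.toWord) :
    IsCyclicallyReduced g⁻¹.toWord := by
  refine ⟨isReduced_toWord, ?_⟩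
  rw [toWord_inv, head?_invRev, getLast?_invRev]
  intro a ha b hb
  obtain ⟨x, hx, rfl⟩ := Option.mem_map.1 ha
  obtain ⟨y, hy, rfl⟩ := Option.mem_map.1 hb
  intro h
  have := hg.2 y hy x hx h.symm
  simp [letterInv, this]

/-- If no prefix of the reduced word of `g` conjugates `g` to a shorter element, then `g` is
cyclically reduced. -/
theorem isCyclicallyReduced_of_norm_le {g : FreeGroup α}
    (h : ∀ L M, g.toWord = L ++ M → g.norm ≤ ((mk L)⁻¹ * g * mk L).norm) :
    IsCyclicallyReduced g.toWord := by
  refine ⟨isReduced_toWord, ?_⟩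
  intro a ha b hb
  rw [rel_iff_ne_letterInv]
  intro hab
  obtain ⟨L, hL⟩ := List.getLast?_eq_some_iff.1 ha
  rcases L with - | ⟨c, L⟩
  · rw [hL] at hb
    have : a = b := by simpa using hb
    exact letterInv_ne a (hab.symm.trans this.symm)
  -- The last letter is the inverse of the first letter `c`. Conjugating by the prefix `[c]` removes
  -- both and lowers the norm by two.
  · have hc : c = b := by simpa [hL] using hb
    subst hc
    have h₁ := h [c] (L ++ [a]) (by simp [hL])
    have h₂ : (mk [c])⁻¹ * g * mk [c] = mk L := by
      have hg : g = mk [c] * mk L * (mk [c])⁻¹ := by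
        rw [← mk_letterInv, hab, letterInv_letterInv, ← mk_append, ← mk_append, ← hab,
          List.singleton_append, ← hL, mk_toWord]
      rw [hg]
      group
    rw [h₂] at h₁
    have h₃ : g.norm = L.length + 2 := by rw [norm, hL]; simp
    have := norm_mk_le (L₁ := L)
    omega

end FreeGroup

/-! ### Tame families of partial isometries -/

section Tame

open FreeGroup hiding map_mul map_one

variable {R E : Type*} [Ring R] [StarRing R]

/-- The value of a letter: `t x` for a generator and its adjoint for the inverse. -/
def letterVal (t : E → R) (x : E × Bool) : R := if x.2 then t x.1 else star (t x.1)

/-- The value of a word in the elements `t x` and their adjoints. -/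
def wordVal (t : E → R) (L : List (E × Bool)) : R := (L.map (letterVal t)).prod

/-- The range projection `u u*` of the value `u` of a word. -/
def rangeProj (t : E → R) (L : List (E × Bool)) : R := wordVal t L * star (wordVal t L)

/-- A family of partial isometries is tame if the range projections of all words commute. -/
structure IsTame (t : E → R) : Prop where
  partialIsometry : ∀ x, t x * star (t x) * t x = t x
  commute : ∀ L M, Commute (rangeProj t L) (rangeProj t M)

variable {t : E → R}

theorem star_letterVal (x : E × Bool) : star (letterVal t x) = letterVal t (letterInv x) := by
  obtain ⟨e, b⟩ := x
  cases b <;> simp [letterVal, letterInv]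

theorem wordVal_nil : wordVal t [] = 1 := rfl

theorem wordVal_singleton (x : E × Bool) : wordVal t [x] = letterVal t x := by simp [wordVal]

theorem wordVal_cons (x : E × Bool) (L : List (E × Bool)) :
    wordVal t (x :: L) = letterVal t x * wordVal t L := by simp [wordVal]

theorem wordVal_append (L M : List (E × Bool)) :
    wordVal t (L ++ M) = wordVal t L * wordVal t M := by simp [wordVal]

theorem star_rangeProj (L : List (E × Bool)) : star (rangeProj t L) = rangeProj t L := by
  rw [rangeProj, star_mul, star_star]

theorem rangeProj_nil : rangeProj t [] = 1 := by simp [rangeProj, wordVal_nil]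

theorem rangeProj_append (L M : List (E × Bool)) :
    rangeProj t (L ++ M) = wordVal t L * rangeProj t M * star (wordVal t L) := by
  simp only [rangeProj, wordVal_append, star_mul, mul_assoc]

theorem wordVal_append_star (L : List (E × Bool)) :
    wordVal t (invRev L) = star (wordVal t L) := by
  induction L with
  | nil => simp [wordVal_nil]
  | cons x L ih =>
    rw [invRev_cons, wordVal_append, ih, invRev_singleton, wordVal_singleton, ← star_letterVal,
      ← star_mul, wordVal_cons]

namespace IsTame

variable (ht : IsTame t)
include ht

theorem letterVal_mul (x : E × Bool) :
    letterVal t x * star (letterVal t x) * letterVal t x = letterVal t x := by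
  obtain ⟨e, b⟩ := x
  cases b
  · have := congrArg star (ht.partialIsometry e)
    simpa [letterVal, mul_assoc] using this
  · simpa [letterVal] using ht.partialIsometry e

/-- Products of partial isometries need not be partial isometries. Here they are, because `u u*`
commutes with `x* x`, the range projection of the inverse letter. -/
theorem rangeProj_mul_wordVal (L : List (E × Bool)) :
    rangeProj t L * wordVal t L = wordVal t L := by
  induction L with
  | nil => simp [rangeProj_nil]
  | cons x L ih =>
    have hc := (ht.commute L [letterInv x]).eq
    rw [rangeProj, rangeProj, wordVal_singleton, ← star_letterVal, star_star] at hc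
    calc rangeProj t (x :: L) * wordVal t (x :: L)
        = letterVal t x * (wordVal t L * star (wordVal t L) *
            (star (letterVal t x) * letterVal t x)) * wordVal t L := by
          simp only [rangeProj, wordVal_cons, star_mul, mul_assoc]
      _ = (letterVal t x * star (letterVal t x) * letterVal t x) *
            (rangeProj t L * wordVal t L) := by
          rw [hc]
          simp only [rangeProj, mul_assoc]
      _ = wordVal t (x :: L) := by rw [ih, ht.letterVal_mul, wordVal_cons]

theorem isIdempotentElem_rangeProj (L : List (E × Bool)) :
    IsIdempotentElem (rangeProj t L) := by
  rw [IsIdempotentElem]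
  nth_rewrite 2 [rangeProj]
  rw [← mul_assoc, ht.rangeProj_mul_wordVal, rangeProj]

/-- With `u` the value of `L`, the projection of `M` commutes with `u* u`, and `u u* u = u`. This
covariance lets words be moved past the diagonal. -/
theorem wordVal_mul_rangeProj (L M : List (E × Bool)) :
    wordVal t L * rangeProj t M = rangeProj t (L ++ M) * wordVal t L := by
  have hc := (ht.commute M (invRev L)).eq
  rw [rangeProj.eq_def t (invRev L), wordVal_append_star, star_star] at hc
  rw [rangeProj_append, mul_assoc, mul_assoc, hc]
  nth_rewrite 1 [← ht.rangeProj_mul_wordVal L]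
  simp only [rangeProj, mul_assoc]

theorem rangeProj_mul_rangeProj_append (L M : List (E × Bool)) :
    rangeProj t L * rangeProj t (L ++ M) = rangeProj t (L ++ M) := by
  rw [rangeProj_append, ← mul_assoc, ← mul_assoc, ht.rangeProj_mul_wordVal]

theorem rangeProj_append_mul_rangeProj (L M : List (E × Bool)) :
    rangeProj t (L ++ M) * rangeProj t L = rangeProj t (L ++ M) := by
  rw [(ht.commute _ _).eq, ht.rangeProj_mul_rangeProj_append]

variable [DecidableEq E]

/-- If `x` prolongs the word, the projection acts as identity on the product; if `x` cancels, it is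
the factor `x x*` left by the cancellation. -/
theorem letterVal_mul_wordVal_toWord (x : E × Bool) (g : FreeGroup E) :
    letterVal t x * wordVal t g.toWord = rangeProj t [x] * wordVal t (FreeGroup.mk [x] * g).toWord := by
  rcases toWord_letter_mul x g with h | h
  · rw [h, wordVal_cons, ← mul_assoc, ← wordVal_singleton, ht.rangeProj_mul_wordVal]
  · nth_rewrite 1 [h]
    rw [wordVal_cons, ← star_letterVal, ← mul_assoc, rangeProj, wordVal_singleton]

/-- Free reduction changes the value of a word only by a diagonal factor. This is why reduced words
suffice to span the algebra over the diagonal. -/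
theorem wordVal_eq_rangeProj_mul (L : List (E × Bool)) :
    wordVal t L = rangeProj t L * wordVal t (FreeGroup.mk L).toWord := by
  induction L with
  | nil => simp [rangeProj_nil, ← one_eq_mk]
  | cons x L ih =>
    have h₁ := ht.rangeProj_append_mul_rangeProj [x] L
    rw [List.singleton_append] at h₁
    rw [wordVal_cons, ih, ← mul_assoc, ← wordVal_singleton, ht.wordVal_mul_rangeProj, mul_assoc,
      wordVal_singleton, ht.letterVal_mul_wordVal_toWord, ← mul_assoc, List.singleton_append, h₁,
      ← mk_cons]

/-- Reduction can only enlarge the range projection: substituting the reduced form into `u u*`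
exhibits `p_L` as `p_L p p_L`, with `p` the projection of the reduced word. -/
theorem rangeProj_toWord_mk (L : List (E × Bool)) :
    rangeProj t L * rangeProj t (FreeGroup.mk L).toWord = rangeProj t L := by
  have h : rangeProj t L = rangeProj t L * rangeProj t (FreeGroup.mk L).toWord * rangeProj t L := by
    nth_rewrite 1 [rangeProj]
    rw [ht.wordVal_eq_rangeProj_mul L, star_mul, star_rangeProj]
    nth_rewrite 4 [rangeProj]
    simp only [mul_assoc]
  rw [mul_assoc, (ht.commute (FreeGroup.mk L).toWord L).eq, ← mul_assoc,
    (ht.isIdempotentElem_rangeProj L).eq] at h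
  exact h.symm

/-- Used inductively: it puts all range projections in the algebra generated by those of reduced
words, and it lets a character be evaluated one letter at a time. -/
theorem rangeProj_append_singleton (L : List (E × Bool)) (x : E × Bool) :
    rangeProj t (L ++ [x]) = rangeProj t L * rangeProj t (FreeGroup.mk (L ++ [x])).toWord := by
  have h₁ : rangeProj t (L ++ [x]) = rangeProj t L * rangeProj t ((FreeGroup.mk L).toWord ++ [x]) := by
    rw [rangeProj_append, ht.wordVal_eq_rangeProj_mul L, star_mul, star_rangeProj]
    have : rangeProj t L * wordVal t (FreeGroup.mk L).toWord * rangeProj t [x] *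
        (star (wordVal t (FreeGroup.mk L).toWord) * rangeProj t L) =
        rangeProj t L * rangeProj t ((FreeGroup.mk L).toWord ++ [x]) * rangeProj t L := by
      rw [rangeProj_append]
      simp only [mul_assoc]
    rw [this, mul_assoc, (ht.commute ((FreeGroup.mk L).toWord ++ [x]) L).eq, ← mul_assoc,
      (ht.isIdempotentElem_rangeProj L).eq]
  rw [mk_append]
  rcases toWord_mul_letter (FreeGroup.mk L) x with h | h
  · rw [h₁, h]
  -- When `x` cancels the last letter, appending it to the reduced word does not change the range
  -- projection, and this projection lies below that of the shortened word.
  · have h₂ : rangeProj t ((FreeGroup.mk L).toWord ++ [x]) = rangeProj t (FreeGroup.mk L).toWord := by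
      rw [rangeProj_append, h, wordVal_append, wordVal_singleton, star_mul, star_letterVal,
        letterInv_letterInv]
      have := ht.letterVal_mul (letterInv x)
      rw [star_letterVal, letterInv_letterInv] at this
      rw [rangeProj.eq_def t (_ ++ _), wordVal_append, wordVal_singleton, star_mul, star_letterVal,
        letterInv_letterInv, rangeProj, wordVal_singleton, star_letterVal]
      calc _ = wordVal t (FreeGroup.mk L * FreeGroup.mk [x]).toWord *
            (letterVal t (letterInv x) * letterVal t x * letterVal t (letterInv x)) *
            letterVal t x * star (wordVal t (FreeGroup.mk L * FreeGroup.mk [x]).toWord) := by simp only [mul_assoc]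
        _ = _ := by rw [this]; simp only [mul_assoc]
    rw [h₁, h₂, ht.rangeProj_toWord_mk]
    have h₃ := ht.rangeProj_mul_rangeProj_append (FreeGroup.mk L * FreeGroup.mk [x]).toWord [letterInv x]
    rw [← h] at h₃
    rw [← ht.rangeProj_toWord_mk L, mul_assoc, (ht.commute (FreeGroup.mk L).toWord _).eq, h₃]

end IsTame

variable (K : Type*) [Field K] [Algebra K R] [DecidableEq E]

/-- The algebra generated by the range projections of reduced words. -/
def diagonal (t : E → R) : Subalgebra K R :=
  Algebra.adjoin K (Set.range fun g : FreeGroup E => rangeProj t g.toWord)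

namespace IsTame

variable (ht : IsTame t)
include ht

theorem rangeProj_mem (L : List (E × Bool)) : rangeProj t L ∈ diagonal K t := by
  induction L using List.reverseRecOn with
  | nil => rw [rangeProj_nil]; exact one_mem _
  | append_singleton L x ih =>
    rw [ht.rangeProj_append_singleton]
    exact mul_mem ih (Algebra.subset_adjoin ⟨_, rfl⟩)

theorem exists_wordVal_mul (L : List (E × Bool)) {a : R} (ha : a ∈ diagonal K t) :
    ∃ b ∈ diagonal K t, wordVal t L * a = b * wordVal t L := by
  induction ha using Algebra.adjoin_induction with
  | mem a ha =>
    obtain ⟨g, rfl⟩ := ha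
    exact ⟨_, ht.rangeProj_mem K _, ht.wordVal_mul_rangeProj _ _⟩
  | algebraMap c => exact ⟨_, Subalgebra.algebraMap_mem _ c, (Algebra.commutes _ _).symm⟩
  | add a b _ _ ha hb =>
    obtain ⟨a', ha', h₁⟩ := ha
    obtain ⟨b', hb', h₂⟩ := hb
    exact ⟨a' + b', add_mem ha' hb', by rw [mul_add, add_mul, h₁, h₂]⟩
  | mul a b _ _ ha hb =>
    obtain ⟨a', ha', h₁⟩ := ha
    obtain ⟨b', hb', h₂⟩ := hb
    exact ⟨a' * b', mul_mem ha' hb', by rw [← mul_assoc, h₁, mul_assoc, h₂, mul_assoc]⟩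

theorem conj_mem (L : List (E × Bool)) {a : R} (ha : a ∈ diagonal K t) :
    wordVal t L * a * star (wordVal t L) ∈ diagonal K t := by
  obtain ⟨b, hb, h⟩ := ht.exists_wordVal_mul K L ha
  rw [h, mul_assoc]
  exact mul_mem hb (ht.rangeProj_mem K L)

/-- Every element of the `*`-algebra generated by a tame family is a finite sum of elements
`a u_g` with `a` in the diagonal. -/
theorem mem_iSup_of_mem_adjoin {z : R} (hz : z ∈ Algebra.adjoin K (Set.range (letterVal t))) :
    z ∈ ⨆ g : FreeGroup E, (Subalgebra.toSubmodule (diagonal K t)).map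
      (LinearMap.mulRight K (wordVal t g.toWord)) := by
  set S := ⨆ g : FreeGroup E, (Subalgebra.toSubmodule (diagonal K t)).map
      (LinearMap.mulRight K (wordVal t g.toWord)) with hS
  have hmem : ∀ (g : FreeGroup E) (a : R), a ∈ diagonal K t → a * wordVal t g.toWord ∈ S :=
    fun g a ha => Submodule.mem_iSup_of_mem g ⟨a, ha, rfl⟩
  -- Membership itself does not pass to products. Stability of `S` under left multiplication does,
  -- and it is applied at the end to the unit, which lies in the summand of `g = 1`.
  suffices h : ∀ s ∈ S, z * s ∈ S by
    have := h (1 * wordVal t (1 : FreeGroup E).toWord) (hmem 1 1 (one_mem _))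
    simpa [wordVal_nil] using this
  induction hz using Algebra.adjoin_induction with
  | mem a ha =>
    obtain ⟨x, rfl⟩ := ha
    intro s hs
    induction hs using Submodule.iSup_induction' with
    | zero => rw [mul_zero]; exact zero_mem _
    | add a b _ _ ha hb => rw [mul_add]; exact add_mem ha hb
    | mem g s hs =>
      obtain ⟨a, ha, rfl⟩ := hs
      obtain ⟨b, hb, h⟩ := ht.exists_wordVal_mul K [x] ha
      rw [wordVal_singleton] at h
      rw [LinearMap.mulRight_apply, ← mul_assoc, h, mul_assoc, ht.letterVal_mul_wordVal_toWord,
        ← mul_assoc]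
      exact hmem _ _ (mul_mem hb (ht.rangeProj_mem K _))
  | algebraMap c =>
    intro s hs
    rw [← Algebra.smul_def]
    exact S.smul_mem c hs
  | add a b _ _ ha hb => intro s hs; rw [add_mul]; exact add_mem (ha s hs) (hb s hs)
  | mul a b _ _ ha hb => intro s hs; rw [mul_assoc]; exact ha _ (hb s hs)

variable {K}

/-- The translate of a character of the diagonal by a word. -/
def translateChar (χ : diagonal K t →ₐ[K] K) (L : List (E × Bool))
    (hL : χ ⟨rangeProj t L, ht.rangeProj_mem K L⟩ = 1) : diagonal K t →ₐ[K] K where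
  toFun a := χ ⟨_, ht.conj_mem K L a.2⟩
  map_one' := by
    rw [← hL]
    congr 1
    ext
    change wordVal t L * 1 * _ = _
    rw [mul_one]
    rfl
  map_mul' a b := by
    -- With `u` the value of `L`: move `a` to the left of `u`, then write `u = u u* u` to create the
    -- middle factor `u* u` of `(u a u*)(u b u*)`.
    obtain ⟨a', ha', h⟩ := ht.exists_wordVal_mul K L a.2
    rw [← map_mul]
    congr 1
    ext
    change wordVal t L * (a.1 * b.1) * _ =
      wordVal t L * a.1 * star (wordVal t L) * (wordVal t L * b.1 * star (wordVal t L))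
    rw [← mul_assoc, h]
    nth_rewrite 1 [← ht.rangeProj_mul_wordVal L]
    simp only [rangeProj, mul_assoc]
  map_zero' := by
    rw [← map_zero χ]
    congr 1
    ext
    change wordVal t L * 0 * _ = 0
    simp
  map_add' a b := by
    rw [← map_add]
    congr 1
    ext
    change wordVal t L * (a.1 + b.1) * _ =
      wordVal t L * a.1 * star (wordVal t L) + wordVal t L * b.1 * star (wordVal t L)
    rw [mul_add, add_mul]
  commutes' c := by
    have : (⟨_, ht.conj_mem K L (algebraMap K (diagonal K t) c).2⟩ : diagonal K t) =
        algebraMap K _ c * ⟨rangeProj t L, ht.rangeProj_mem K L⟩ := by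
      ext
      change wordVal t L * algebraMap K R c * _ = algebraMap K R c * (_ * _)
      rw [← Algebra.commutes, mul_assoc]
    rw [this, map_mul, hL, mul_one]
    exact AlgHom.commutes χ c

theorem translateChar_apply (χ : diagonal K t →ₐ[K] K) (L : List (E × Bool))
    (hL : χ ⟨rangeProj t L, ht.rangeProj_mem K L⟩ = 1) (a : diagonal K t) :
    ht.translateChar χ L hL a = χ ⟨_, ht.conj_mem K L a.2⟩ := rfl

theorem translateChar_rangeProj (χ : diagonal K t →ₐ[K] K) (L M : List (E × Bool))
    (hL : χ ⟨rangeProj t L, ht.rangeProj_mem K L⟩ = 1) :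
    ht.translateChar χ L hL ⟨rangeProj t M, ht.rangeProj_mem K M⟩ =
      χ ⟨rangeProj t (L ++ M), ht.rangeProj_mem K _⟩ := by
  rw [translateChar_apply]
  congr 1
  ext
  exact (rangeProj_append L M).symm

end IsTame

end Tame

/-! ### Characters of algebras generated by commuting idempotents -/

section Characters

variable {K : Type*} [Field K]

/-- Modulo a maximal ideal every generator is `0` or `1`, so the residue field is `K`. For the value
at `a` to be nonzero, the ideal is chosen to contain the annihilator of `a`: if `a` became zero,
then `a p = 0` for some `p` outside the ideal, although `p` annihilates `a`. -/
theorem exists_algHom_apply_ne_zero_of_adjoin_eq_top {A : Type*} [CommRing A] [Algebra K A]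
    {S : Set A} (hS : ∀ a ∈ S, IsIdempotentElem a) (htop : Algebra.adjoin K S = ⊤) (a : A)
    (ha : a ≠ 0) : ∃ χ : A →ₐ[K] K, χ a ≠ 0 := by
  let ann : Ideal A := LinearMap.ker (LinearMap.mulRight A a)
  have hann : ∀ b, b ∈ ann ↔ b * a = 0 := fun b => Iff.rfl
  have hne : ann ≠ ⊤ := by
    rw [Ne, Ideal.eq_top_iff_one, hann, one_mul]
    exact ha
  obtain ⟨m, hm, hle⟩ := Ideal.exists_le_maximal ann hne
  have hp := hm.isPrime
  -- Stronger than congruence to a scalar modulo `m`: the equality holds in `A` after multiplication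
  -- by an element outside `m`. For an idempotent `b`, take `p = b` or `p = 1 - b`.
  have key : ∀ b : A, ∃ c : K, ∃ p : A, p ∉ m ∧ b * p = algebraMap K A c * p := by
    intro b
    have hb : b ∈ Algebra.adjoin K S := htop ▸ Algebra.mem_top
    induction hb using Algebra.adjoin_induction with
    | mem b hb =>
      have hi : b * b = b := hS b hb
      by_cases h : b ∈ m
      · refine ⟨0, 1 - b, fun h' => ?_, ?_⟩
        · exact hm.ne_top ((Ideal.eq_top_iff_one m).2 (by simpa using add_mem h' h))
        · rw [mul_sub, mul_one, hi, sub_self, map_zero, zero_mul]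
      · exact ⟨1, _, h, by rw [hi, map_one, one_mul]⟩
    | algebraMap c => exact ⟨c, 1, fun h => hm.ne_top ((Ideal.eq_top_iff_one m).2 h), rfl⟩
    | add x y hx hy h₁ h₂ =>
      obtain ⟨c, p, hp', h₁⟩ := h₁
      obtain ⟨d, q, hq', h₂⟩ := h₂
      refine ⟨c + d, p * q, hp.mul_notMem hp' hq', ?_⟩
      rw [map_add]
      linear_combination q * h₁ + p * h₂
    | mul x y hx hy h₁ h₂ =>
      obtain ⟨c, p, hp', h₁⟩ := h₁
      obtain ⟨d, q, hq', h₂⟩ := h₂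
      refine ⟨c * d, p * q, hp.mul_notMem hp' hq', ?_⟩
      rw [map_mul]
      linear_combination (y * q) * h₁ + algebraMap K A c * p * h₂
  have hmk : ∀ {p : A}, p ∉ m → Ideal.Quotient.mk m p ≠ 0 := fun hp' => by
    rwa [Ne, Ideal.Quotient.eq_zero_iff_mem]
  have hsurj : Function.Surjective (algebraMap K (A ⧸ m)) := by
    intro z
    obtain ⟨b, rfl⟩ := Ideal.Quotient.mk_surjective z
    obtain ⟨c, p, hp', h⟩ := key b
    have h' := congrArg (Ideal.Quotient.mk m) h
    rw [map_mul, map_mul] at h'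
    exact ⟨c, (mul_right_cancel₀ (hmk hp') h').symm⟩
  let ψ : K ≃ₐ[K] A ⧸ m := AlgEquiv.ofBijective (Algebra.ofId K (A ⧸ m))
    ⟨(algebraMap K (A ⧸ m)).injective, hsurj⟩
  refine ⟨ψ.symm.toAlgHom.comp (Ideal.Quotient.mkₐ K m), fun h => ?_⟩
  obtain ⟨c, p, hp', hcp⟩ := key a
  have hma : Ideal.Quotient.mk m a = 0 := by
    have h' : ψ.symm (Ideal.Quotient.mk m a) = 0 := h
    exact (map_eq_zero_iff _ ψ.symm.injective).1 h'
  have h₁ := congrArg (Ideal.Quotient.mk m) hcp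
  rw [map_mul, map_mul, hma, zero_mul] at h₁
  have hc0 : c = 0 := by
    have h₃ : algebraMap K (A ⧸ m) c = 0 := (mul_eq_zero.1 h₁.symm).resolve_right (hmk hp')
    exact (map_eq_zero_iff _ (algebraMap K (A ⧸ m)).injective).1 h₃
  rw [hc0, map_zero, zero_mul] at hcp
  exact hp' (hle ((hann p).2 (by rw [mul_comm, hcp])))

theorem exists_algHom_apply_ne_zero_of_mem_adjoin_idempotents {R : Type*} [Ring R] [Algebra K R]
    {S : Set R} (hS : ∀ a ∈ S, IsIdempotentElem a) (hc : ∀ a ∈ S, ∀ b ∈ S, a * b = b * a)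
    (a : Algebra.adjoin K S) (ha : a ≠ 0) : ∃ χ : Algebra.adjoin K S →ₐ[K] K, χ a ≠ 0 := by
  let _ : CommRing (Algebra.adjoin K S) :=
    { (inferInstance : Ring (Algebra.adjoin K S)) with
      mul_comm := fun x y => (Algebra.isMulCommutative_adjoin K hc).is_comm.comm x y }
  refine exists_algHom_apply_ne_zero_of_adjoin_eq_top (S := ((↑) : Algebra.adjoin K S → R) ⁻¹' S)
    (fun x hx => Subtype.ext (hS x.1 hx)) ?_ a ha
  exact Algebra.adjoin_adjoin_coe_preimage

end Characters

/-! ### Computations in crossed products -/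

theorem LocallyConstant.charFn_of_mem {X K : Type*} [TopologicalSpace X] [Field K] {U : Set X}
    (hU : IsClopen U) {x : X} (hx : x ∈ U) : LocallyConstant.charFn K hU x = 1 :=
  (LocallyConstant.charFn_eq_one K x hU).2 hx

theorem LocallyConstant.charFn_of_notMem {X K : Type*} [TopologicalSpace X] [Field K] {U : Set X}
    (hU : IsClopen U) {x : X} (hx : x ∉ U) : LocallyConstant.charFn K hU x = 0 :=
  (LocallyConstant.charFn_eq_zero K x hU).2 hx

theorem LocallyConstant.isStarProjection_charFn {X K : Type*} [TopologicalSpace X] [Field K]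
    [StarRing K] {U : Set X} (hU : IsClopen U) :
    IsStarProjection (LocallyConstant.charFn K hU) := by
  constructor
  · ext x
    by_cases hx : x ∈ U
    · simp [LocallyConstant.charFn_of_mem hU hx]
    · simp [LocallyConstant.charFn_of_notMem hU hx]
  · ext x
    rw [LocallyConstant.star_apply]
    by_cases hx : x ∈ U
    · simp [LocallyConstant.charFn_of_mem hU hx]
    · simp [LocallyConstant.charFn_of_notMem hU hx]

namespace TopPartialAction

variable {G X : Type*} [Group G] [TopologicalSpace X] (P : TopPartialAction G X)
variable {K : Type*} [Field K]

theorem mem_dom_one (x : X) : x ∈ P.dom 1 := by simp [P.dom_one]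

theorem e_apply_of_mem {g : G} {x : X} (hx : x ∈ P.dom g) : (P.e K g).1 x = 1 :=
  LocallyConstant.charFn_of_mem (P.isClopen_dom g) hx

theorem e_apply_of_notMem {g : G} {x : X} (hx : x ∉ P.dom g) : (P.e K g).1 x = 0 :=
  LocallyConstant.charFn_of_notMem (P.isClopen_dom g) hx

theorem mem_dom_mul_iff {g h : G} {x : X} (hx : x ∈ P.dom g) :
    P.θ g⁻¹ x ∈ P.dom h ↔ x ∈ P.dom (g * h) := by
  constructor
  · intro hy
    simpa using (P.comp h⁻¹ g⁻¹ x (by simpa using hx) (by simpa using hy)).1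
  · intro hz
    have hy := P.mapsTo_inv hx
    have h₁ := (P.comp (g * h)⁻¹ g (P.θ g⁻¹ x) hy (by rw [P.inv_apply' hx, inv_inv]; exact hz)).1
    simpa using h₁

variable [DecidableEq G]

theorem one_eq_ofFun : (1 : P.CrossedProduct K) = P.ofFun 1 := rfl

theorem ofFun_add (f f' : LocallyConstant X K) : P.ofFun (f + f') = P.ofFun f + P.ofFun f' := by
  rw [ofFun, ofFun, ofFun, ← map_add]
  rfl

theorem ofFun_zero : P.ofFun (0 : LocallyConstant X K) = 0 := by
  rw [ofFun, ← map_zero (P.single (K := K) 1)]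
  rfl

theorem ofFun_smul (c : K) (f : LocallyConstant X K) : P.ofFun (c • f) = c • P.ofFun f := by
  rw [ofFun, ofFun, smul_single]
  rfl

theorem ofFun_mul_single (f : LocallyConstant X K) {g : G} (a : P.D K g) :
    P.ofFun f * P.single g a = P.single g ⟨f * a.1, Ideal.mul_mem_left _ _ a.2⟩ := by
  rw [ofFun, single_mul_single]
  refine P.single_congr (one_mul g) ?_
  change P.α 1 (P.α 1⁻¹ f * a.1) = f * a.1
  rw [inv_one, P.α_one, P.α_one]

theorem single_mul_ofFun {g : G} (a : P.D K g) (f : LocallyConstant X K) :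
    P.single g a * P.ofFun f = P.single g ⟨a.1 * P.α g f, Ideal.mul_mem_right _ _ a.2⟩ := by
  rw [ofFun, single_mul_single]
  exact P.single_congr (mul_one g) (P.α_α_inv_mul a.2 f)

theorem ofFun_mul (f f' : LocallyConstant X K) : P.ofFun (f * f') = P.ofFun f * P.ofFun f' := by
  rw [ofFun, ofFun.eq_def P f', ofFun_mul_single]

variable (K) in
/-- The inclusion `f ↦ f δ_1` of `C_K(X)` into the crossed product. -/
noncomputable def ofFunHom : LocallyConstant X K →ₐ[K] P.CrossedProduct K :=
  AlgHom.ofLinearMap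
    { toFun := P.ofFun
      map_add' := P.ofFun_add
      map_smul' := P.ofFun_smul } P.one_eq_ofFun.symm P.ofFun_mul

theorem ofFunHom_apply (f : LocallyConstant X K) : P.ofFunHom K f = P.ofFun f := rfl

theorem star_ofFun [StarRing K] (f : LocallyConstant X K) :
    star (P.ofFun f) = P.ofFun (star f) := by
  rw [ofFun, star_single]
  refine P.single_congr inv_one ?_
  change P.α 1⁻¹ (star f) = star f
  rw [inv_one, P.α_one]

/-- The coefficient of `δ_g`. -/
noncomputable def coeff (g : G) : P.CrossedProduct K →+ LocallyConstant X K :=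
  (Submodule.subtype (P.D K g)).toAddMonoidHom.comp
    (DFinsupp.evalAddMonoidHom (β := P.component K) (Additive.ofMul g))

theorem coeff_single_self {g : G} (a : P.D K g) : P.coeff g (P.single g a) = a.1 :=
  congrArg Subtype.val (DirectSum.of_eq_same (β := P.component K) (Additive.ofMul g) a)

theorem coeff_single_of_ne {g h : G} (hgh : h ≠ g) (a : P.D K h) :
    P.coeff g (P.single h a) = 0 :=
  congrArg Subtype.val (DirectSum.of_eq_of_ne (β := P.component K) (Additive.ofMul h)
    (Additive.ofMul g) a hgh.symm)

theorem ext_coeff {a b : P.CrossedProduct K} (h : ∀ g, P.coeff g a = P.coeff g b) : a = b :=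
  DFinsupp.ext fun i => Subtype.ext (h i.toMul)

theorem ofFun_injective : Function.Injective (P.ofFun (K := K)) := fun f f' h => by
  have := congrArg (P.coeff 1) h
  rwa [ofFun, ofFun, coeff_single_self, coeff_single_self] at this

variable (K) in
/-- The canonical partial isometry `e(g) δ_g`. -/
noncomputable def δ (g : G) : P.CrossedProduct K := P.single g (P.e K g)

theorem single_eq_ofFun_mul_δ {g : G} (a : P.D K g) :
    P.single g a = P.ofFun a.1 * P.δ K g := by
  rw [δ, ofFun_mul_single]
  refine P.single_congr rfl ?_
  ext x
  by_cases hx : x ∈ P.dom g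
  · simp [P.e_apply_of_mem hx]
  · simp [a.2 x hx]

theorem δ_one : P.δ K 1 = 1 := by
  refine P.single_congr rfl ?_
  ext x
  exact P.e_apply_of_mem (P.mem_dom_one x)

/-- The `δ_g` form a partial representation: they multiply as in the group up to the projection
`e(g)`, since on the domain of `g` the point `θ_{g⁻¹} x` lies in the domain of `h` exactly when `x`
lies in that of `g h`. -/
theorem δ_mul_δ (g h : G) : P.δ K g * P.δ K h = P.ofFun (P.e K g).1 * P.δ K (g * h) := by
  rw [δ, δ, δ, single_mul_single, ofFun_mul_single]
  refine P.single_congr rfl ?_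
  change P.α g (P.α g⁻¹ (P.e K g).1 * (P.e K h).1) = (P.e K g).1 * (P.e K (g * h)).1
  rw [P.α_α_inv_mul (P.e K g).2]
  ext x
  rw [LocallyConstant.mul_apply, LocallyConstant.mul_apply]
  by_cases hx : x ∈ P.dom g
  · rw [P.α_apply_of_mem hx]
    congr 1
    by_cases h : x ∈ P.dom (g * h)
    · rw [P.e_apply_of_mem h, P.e_apply_of_mem ((P.mem_dom_mul_iff hx).2 h)]
    · rw [P.e_apply_of_notMem h, P.e_apply_of_notMem (mt (P.mem_dom_mul_iff hx).1 h)]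
  · rw [P.e_apply_of_notMem hx, zero_mul, zero_mul]

theorem star_δ [StarRing K] (g : G) : star (P.δ K g) = P.δ K g⁻¹ := by
  rw [δ, star_single]
  refine P.single_congr rfl ?_
  ext x
  change P.α g⁻¹ (star (P.e K g).1) x = _
  by_cases hx : x ∈ P.dom g⁻¹
  · rw [P.α_apply_of_mem hx, P.e_apply_of_mem hx, LocallyConstant.star_apply, P.e_apply_of_mem,
      star_one]
    simpa using P.mapsTo_inv hx
  · rw [P.α_apply_of_notMem hx, P.e_apply_of_notMem hx]

theorem δ_mul_star_δ [StarRing K] (g : G) :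
    P.δ K g * star (P.δ K g) = P.ofFun (P.e K g).1 := by
  rw [star_δ, δ_mul_δ, mul_inv_cancel, δ_one, mul_one]

theorem star_δ_mul_δ [StarRing K] (g : G) :
    star (P.δ K g) * P.δ K g = P.ofFun (P.e K g⁻¹).1 := by
  rw [star_δ, δ_mul_δ, inv_mul_cancel, δ_one, mul_one]

/-- Such products lie in the commutative algebra `C_K(X)`; this is what makes the commutators
defining `L^ab` vanish in the crossed product. -/
theorem single_mul_star_single [StarRing K] {g : G} (a : P.D K g) :
    P.single g a * star (P.single g a) = P.ofFun (a.1 * star a.1) := by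
  rw [single_eq_ofFun_mul_δ, star_mul, mul_assoc, ← mul_assoc (P.δ K g), δ_mul_star_δ, star_ofFun,
    ← ofFun_mul, ← ofFun_mul]
  congr 1
  ext x
  by_cases hx : x ∈ P.dom g
  · simp [P.e_apply_of_mem hx]
  · simp [a.2 x hx]

end TopPartialAction

/-! ### Local configurations -/

namespace BipartiteSeparatedGraph

open FreeGroup

variable {V₀ V₁ E : Type*} (Γ : BipartiteSeparatedGraph V₀ V₁ E)

theorem exists_mem_C (e : E) : ∃ X ∈ Γ.C (Γ.r e), e ∈ X := by
  obtain ⟨X, hX, -⟩ := Γ.existsUnique_mem e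
  exact ⟨X, hX⟩

variable {Γ}

theorem eq_of_mem_C {v v' : V₀} {X X' : Set E} (hX : X ∈ Γ.C v) (hX' : X' ∈ Γ.C v') {e : E}
    (he : e ∈ X) (he' : e ∈ X') : X = X' := by
  obtain ⟨Y, -, hY⟩ := Γ.existsUnique_mem e
  obtain rfl := Γ.range_of_mem v X hX e he
  obtain rfl := Γ.range_of_mem v' X' hX' e he'
  rw [hY X ⟨hX, he⟩, hY X' ⟨hX', he'⟩]

theorem sameClass_iff {v : V₀} {X : Set E} (hX : X ∈ Γ.C v) {e f : E} (he : e ∈ X) :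
    Γ.SameClass e f ↔ f ∈ X := by
  constructor
  · rintro ⟨w, Y, hY, heY, hfY⟩
    rwa [eq_of_mem_C hX hY he heY]
  · intro hf
    exact ⟨v, X, hX, he, hf⟩

theorem SameClass.symm {e f : E} (h : Γ.SameClass e f) : Γ.SameClass f e := by
  obtain ⟨v, X, hX, he, hf⟩ := h
  exact ⟨v, X, hX, hf, he⟩

theorem sameClass_refl (e : E) : Γ.SameClass e e := by
  obtain ⟨X, hX, he⟩ := Γ.exists_mem_C e
  exact ⟨_, X, hX, he, he⟩

variable {ξ : FreeGroup E → Bool} {g : FreeGroup E}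

/-- As `w` emits an edge, its local configuration is not empty and reveals `w`. For vertices of `V₀`
the surjectivity of `r` plays the same role. -/
theorem IsLocalConfig₁.unique {w w' : V₁} (h : Γ.IsLocalConfig₁ ξ g w)
    (h' : Γ.IsLocalConfig₁ ξ g w') : w = w' := by
  obtain ⟨e, rfl⟩ := Γ.s_surjective w
  exact ((h' e).2.1 ((h e).2.2 rfl))

theorem IsLocalConfig₀.exists_edge {v : V₀} (h : Γ.IsLocalConfig₀ ξ g v) :
    ∃ e, Γ.r e = v ∧ ξ (g * of e) = true := by
  obtain ⟨e, rfl⟩ := Γ.r_surjective v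
  obtain ⟨X, hX, he⟩ := Γ.exists_mem_C e
  obtain ⟨f, ⟨hf, hf'⟩, -⟩ := h.2.2 X hX
  exact ⟨f, h.2.1 f hf', hf'⟩

theorem IsLocalConfig₀.unique {v v' : V₀} (h : Γ.IsLocalConfig₀ ξ g v)
    (h' : Γ.IsLocalConfig₀ ξ g v') : v = v' := by
  obtain ⟨e, he, hξ⟩ := h.exists_edge
  rw [← he, h'.2.1 e hξ]

theorem IsLocalConfig₁.not_isLocalConfig₀ {w : V₁} {v : V₀} (h : Γ.IsLocalConfig₁ ξ g w) :
    ¬ Γ.IsLocalConfig₀ ξ g v := fun h' => by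
  obtain ⟨e, -, hξ⟩ := h'.exists_edge
  rw [(h e).1] at hξ
  exact Bool.false_ne_true hξ

theorem IsLocalConfig₀.eq_of_sameClass {v : V₀} (h : Γ.IsLocalConfig₀ ξ g v) {e f : E}
    (hef : Γ.SameClass e f) (he : ξ (g * of e) = true) (hf : ξ (g * of f) = true) : e = f := by
  obtain ⟨w, X, hX, heX, hfX⟩ := hef
  obtain rfl : w = v := by rw [← Γ.range_of_mem w X hX e heX, h.2.1 e he]
  exact (h.2.2 X hX).unique ⟨heX, he⟩ ⟨hfX, hf⟩

/-- The restriction of the indicator function to the neighbours of `g`. -/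
def neighbours (g : FreeGroup E) (ξ : FreeGroup E → Bool) : E × Bool → Bool :=
  fun x => ξ (g * FreeGroup.mk [x])

theorem continuous_neighbours (g : FreeGroup E) : Continuous (neighbours (E := E) g) :=
  continuous_pi fun _ => continuous_apply _

variable (Γ)

/-- The condition concerns the finitely many neighbours of `g` only, and the functions on them form
a discrete space. -/
theorem isClopen_isLocalConfig₁ [Finite E] (g : FreeGroup E) (w : V₁) :
    IsClopen {ξ : FreeGroup E → Bool | Γ.IsLocalConfig₁ ξ g w} :=
  (isClopen_discrete {η : E × Bool → Bool |
    ∀ e, η (e, true) = false ∧ (η (e, false) = true ↔ Γ.s e = w)}).preimage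
    (continuous_neighbours g)

theorem isClopen_isLocalConfig₀ [Finite E] (g : FreeGroup E) (v : V₀) :
    IsClopen {ξ : FreeGroup E → Bool | Γ.IsLocalConfig₀ ξ g v} :=
  (isClopen_discrete {η : E × Bool → Bool |
    (∀ e, η (e, false) = false) ∧ (∀ e, η (e, true) = true → Γ.r e = v) ∧
      ∀ X ∈ Γ.C v, ∃! e, e ∈ X ∧ η (e, true) = true}).preimage (continuous_neighbours g)

variable {Γ} [DecidableEq E]

theorem IsConfiguration.isLocalConfig₁ (hξ : Γ.IsConfiguration ξ) (hg : ξ g = true) {e : E}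
    (he : ξ (g * (of e)⁻¹) = true) : Γ.IsLocalConfig₁ ξ g (Γ.s e) := by
  rcases hξ.isLocalConfig g hg with ⟨w, hw⟩ | ⟨v, hv⟩
  · rwa [(hw e).2.1 he]
  · rw [hv.1 e] at he
    exact absurd he Bool.false_ne_true

theorem IsConfiguration.isLocalConfig₀ (hξ : Γ.IsConfiguration ξ) (hg : ξ g = true) {e : E}
    (he : ξ (g * of e) = true) : Γ.IsLocalConfig₀ ξ g (Γ.r e) := by
  rcases hξ.isLocalConfig g hg with ⟨w, hw⟩ | ⟨v, hv⟩
  · rw [(hw e).1] at he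
    exact absurd he Bool.false_ne_true
  · rwa [hv.2.1 e he]

theorem IsConfiguration.prefixClosed (hξ : Γ.IsConfiguration ξ) : PrefixClosed ξ :=
  prefixClosed_of_convex hξ.one_mem hξ.convex

variable (Γ)

variable [Finite E]

/-- Each condition involves finitely many coordinates. The existential quantifiers over vertices do
no harm, since the condition at `g` is the preimage of a subset of the discrete space of functions
on the neighbours. -/
theorem isClosed_isConfiguration : IsClosed {ξ : FreeGroup E → Bool | Γ.IsConfiguration ξ} := by
  have hcl : ∀ g : FreeGroup E, IsClopen {ξ : FreeGroup E → Bool | ξ g = true} := fun g =>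
    (isClopen_discrete {true}).preimage (continuous_apply g)
  have h : {ξ : FreeGroup E → Bool | Γ.IsConfiguration ξ} =
      {ξ | ξ 1 = true} ∩
      ((⋂ (g : FreeGroup E), ⋂ (h : FreeGroup E), ⋂ (k : FreeGroup E),
        ⋂ (_ : (g⁻¹ * h).norm = (g⁻¹ * k).norm + (k⁻¹ * h).norm),
          {ξ | ξ g = true}ᶜ ∪ ({ξ | ξ h = true}ᶜ ∪ {ξ | ξ k = true})) ∩
      ⋂ (g : FreeGroup E), {ξ | ξ g = true}ᶜ ∪ neighbours g ⁻¹' {η : E × Bool → Bool |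
        (∃ w, ∀ e, η (e, true) = false ∧ (η (e, false) = true ↔ Γ.s e = w)) ∨
        ∃ v, (∀ e, η (e, false) = false) ∧ (∀ e, η (e, true) = true → Γ.r e = v) ∧
          ∀ X ∈ Γ.C v, ∃! e, e ∈ X ∧ η (e, true) = true}) := by
    ext ξ
    simp only [Set.mem_inter_iff, Set.mem_iInter, Set.mem_union, Set.mem_compl_iff]
    constructor
    · intro h
      refine ⟨h.one_mem, fun a b c hn => ?_, fun a => ?_⟩
      · by_cases ha : ξ a = true
        · by_cases hb : ξ b = true
          · exact Or.inr (Or.inr (h.convex a b c ha hb hn))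
          · exact Or.inr (Or.inl hb)
        · exact Or.inl ha
      · by_cases ha : ξ a = true
        · exact Or.inr (h.isLocalConfig a ha)
        · exact Or.inl ha
    · rintro ⟨h₁, h₂, h₃⟩
      refine ⟨h₁, fun a b c ha hb hn => ?_, fun a ha => ?_⟩
      · exact ((h₂ a b c hn).resolve_left (not_not.2 ha)).resolve_left (not_not.2 hb)
      · exact (h₃ a).resolve_left (not_not.2 ha)
  rw [h]
  refine (hcl 1).isClosed.inter (IsClosed.inter ?_ ?_)
  · exact isClosed_iInter fun g => isClosed_iInter fun h => isClosed_iInter fun k =>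
      isClosed_iInter fun _ => (hcl g).compl.isClosed.union
        ((hcl h).compl.isClosed.union (hcl k).isClosed)
  · exact isClosed_iInter fun g => (hcl g).compl.isClosed.union
      ((isClosed_discrete _).preimage (continuous_neighbours g))

instance : CompactSpace Γ.Omega :=
  isCompact_iff_compactSpace.1 Γ.isClosed_isConfiguration.isCompact

end BipartiteSeparatedGraph

/-! ### The homomorphism from the abelianized Leavitt path algebra to the crossed product -/

namespace BipartiteSeparatedGraph

open FreeGroup hiding map_mul map_one map_inv
open PathLetter FreePathAlgebra

section Surjective

variable {V₀ V₁ E : Type*} [Fintype V₀] [Fintype V₁] [Fintype E]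
  (Γ : BipartiteSeparatedGraph V₀ V₁ E) (K : Type*) [Field K] [StarRing K]

theorem leavittMk_surjective : Function.Surjective (Γ.leavittMk K) :=
  RingQuot.mkAlgHom_surjective K _

theorem lAbMk_surjective : Function.Surjective (Γ.lAbMk K) :=
  RingQuot.mkAlgHom_surjective K _

end Surjective

variable {V₀ V₁ E : Type*} [DecidableEq E]
  (Γ : BipartiteSeparatedGraph V₀ V₁ E) (K : Type*) [Field K]

theorem mem_dom {g : FreeGroup E} {ξ : Γ.Omega} : ξ ∈ Γ.partialAction.dom g ↔ ξ.1 g = true :=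
  Iff.rfl

theorem θ_apply {g : FreeGroup E} {ξ : Γ.Omega} (h : ξ.1 g⁻¹ = true) (k : FreeGroup E) :
    (Γ.partialAction.θ g ξ).1 k = ξ.1 (g⁻¹ * k) := by
  change (if h : ξ.1 g⁻¹ = true then (⟨fun k => ξ.1 (g⁻¹ * k), ξ.2.translate Γ h⟩ : Γ.Omega)
    else ξ).1 k = _
  rw [dif_pos h]

variable {Γ} in
theorem IsConfiguration.root₀ {ξ : FreeGroup E → Bool} (hξ : Γ.IsConfiguration ξ) {e : E}
    (he : ξ (of e) = true) : Γ.IsLocalConfig₀ ξ 1 (Γ.r e) :=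
  hξ.isLocalConfig₀ hξ.one_mem (by rwa [one_mul])

variable {Γ} in
theorem IsConfiguration.root₁ {ξ : FreeGroup E → Bool} (hξ : Γ.IsConfiguration ξ) {e : E}
    (he : ξ (of e)⁻¹ = true) : Γ.IsLocalConfig₁ ξ 1 (Γ.s e) :=
  hξ.isLocalConfig₁ hξ.one_mem (by rwa [one_mul])

variable [Finite E]

theorem isClopen_type₀ (v : V₀) : IsClopen {ξ : Γ.Omega | Γ.IsLocalConfig₀ ξ.1 1 v} :=
  (Γ.isClopen_isLocalConfig₀ 1 v).preimage continuous_subtype_val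

theorem isClopen_type₁ (w : V₁) : IsClopen {ξ : Γ.Omega | Γ.IsLocalConfig₁ ξ.1 1 w} :=
  (Γ.isClopen_isLocalConfig₁ 1 w).preimage continuous_subtype_val

/-- The characteristic function of the configurations whose root has type `v`. -/
noncomputable def typeFun₀ (v : V₀) : LocallyConstant Γ.Omega K :=
  LocallyConstant.charFn K (Γ.isClopen_type₀ v)

/-- The characteristic function of the configurations whose root has type `w`. -/
noncomputable def typeFun₁ (w : V₁) : LocallyConstant Γ.Omega K :=
  LocallyConstant.charFn K (Γ.isClopen_type₁ w)

variable {Γ} {K}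

theorem typeFun₀_of {v : V₀} {ξ : Γ.Omega} (h : Γ.IsLocalConfig₀ ξ.1 1 v) :
    Γ.typeFun₀ K v ξ = 1 := LocallyConstant.charFn_of_mem (Γ.isClopen_type₀ v) h

theorem typeFun₀_of_not {v : V₀} {ξ : Γ.Omega} (h : ¬ Γ.IsLocalConfig₀ ξ.1 1 v) :
    Γ.typeFun₀ K v ξ = 0 := LocallyConstant.charFn_of_notMem (Γ.isClopen_type₀ v) h

theorem typeFun₁_of {w : V₁} {ξ : Γ.Omega} (h : Γ.IsLocalConfig₁ ξ.1 1 w) :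
    Γ.typeFun₁ K w ξ = 1 := LocallyConstant.charFn_of_mem (Γ.isClopen_type₁ w) h

theorem typeFun₁_of_not {w : V₁} {ξ : Γ.Omega} (h : ¬ Γ.IsLocalConfig₁ ξ.1 1 w) :
    Γ.typeFun₁ K w ξ = 0 := LocallyConstant.charFn_of_notMem (Γ.isClopen_type₁ w) h

/-- A root of type `w` is joined to all `e⁻¹` with `s(e) = w` at once, so the domain of `e⁻¹`
depends on the source of `e` only. -/
theorem e_inv_eq_typeFun₁ (e : E) : (Γ.partialAction.e K (of e)⁻¹).1 = Γ.typeFun₁ K (Γ.s e) := by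
  ext ξ
  by_cases h : ξ.1 (of e)⁻¹ = true
  · rw [Γ.partialAction.e_apply_of_mem h, typeFun₁_of (ξ.2.root₁ h)]
  · rw [Γ.partialAction.e_apply_of_notMem h, typeFun₁_of_not]
    intro h'
    exact h (by simpa using (h' e).2.2 rfl)

theorem typeFun₀_mul_e (e : E) : Γ.typeFun₀ K (Γ.r e) * (Γ.partialAction.e K (of e)).1 =
    (Γ.partialAction.e K (of e)).1 := by
  ext ξ
  rw [LocallyConstant.mul_apply]
  by_cases h : ξ.1 (of e) = true
  · rw [Γ.partialAction.e_apply_of_mem h, typeFun₀_of (ξ.2.root₀ h), one_mul]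
  · rw [Γ.partialAction.e_apply_of_notMem h, mul_zero]

variable (Γ K) [StarRing K]

/-- The images of the letters in the crossed product. -/
noncomputable def letterImage : PathLetter V₀ V₁ E → Γ.partialAction.CrossedProduct K
  | vertex₀ v => Γ.partialAction.ofFun (Γ.typeFun₀ K v)
  | vertex₁ w => Γ.partialAction.ofFun (Γ.typeFun₁ K w)
  | edge e => Γ.partialAction.δ K (of e)
  | ghost e => star (Γ.partialAction.δ K (of e))

theorem star_letterImage (x : PathLetter V₀ V₁ E) :
    star (Γ.letterImage K x) = Γ.letterImage K x.bar := by
  cases x with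
  | vertex₀ v =>
    refine (Γ.partialAction.star_ofFun _).trans (congrArg _ ?_)
    exact (LocallyConstant.isStarProjection_charFn (Γ.isClopen_type₀ v)).isSelfAdjoint
  | vertex₁ w =>
    refine (Γ.partialAction.star_ofFun _).trans (congrArg _ ?_)
    exact (LocallyConstant.isStarProjection_charFn (Γ.isClopen_type₁ w)).isSelfAdjoint
  | edge e => rfl
  | ghost e => exact star_star _

/-- The homomorphism from the free algebra on the letters to the crossed product. -/
noncomputable def freeHom :
    FreePathAlgebra V₀ V₁ E K →ₐ[K] Γ.partialAction.CrossedProduct K :=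
  MonoidAlgebra.lift K _ _ (FreeMonoid.lift (Γ.letterImage K))

theorem freeHom_letter (x : PathLetter V₀ V₁ E) :
    Γ.freeHom K (letter x) = Γ.letterImage K x := by
  rw [freeHom, letter, MonoidAlgebra.lift_of, FreeMonoid.lift_eval_of]

theorem freeHom_star (a : FreePathAlgebra V₀ V₁ E K) :
    Γ.freeHom K (star a) = star (Γ.freeHom K a) := by
  induction a using MonoidAlgebra.induction_on with
  | of m =>
    induction m using FreeMonoid.recOn with
    | one => rw [map_one, star_one, map_one, star_one]
    | of_mul x m ih =>
      have h : MonoidAlgebra.of K _ (FreeMonoid.of x * m) =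
          (letter x : FreePathAlgebra V₀ V₁ E K) * MonoidAlgebra.of K _ m := map_mul _ _ _
      rw [h, star_mul, map_mul, map_mul, star_mul, ih, star_letter, freeHom_letter, freeHom_letter,
        star_letterImage]
  | add a b ha hb => rw [star_add, map_add, map_add, star_add, ha, hb]
  | smul c a ha =>
    rw [Algebra.smul_def, star_mul, map_mul, map_mul, star_mul, ha, star_algebraMap,
      AlgHom.commutes, AlgHom.commutes, Algebra.algebraMap_eq_smul_one,
      Algebra.algebraMap_eq_smul_one, star_smul, star_one]

variable [Fintype V₀] [Fintype V₁] [Fintype E]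

theorem freeHom_leavittRel {a b : FreePathAlgebra V₀ V₁ E K} (h : Γ.LeavittRel K a b) :
    Γ.freeHom K a = Γ.freeHom K b := by
  have hf : ∀ {f f' : LocallyConstant Γ.Omega K}, f = f' →
    Γ.partialAction.ofFun f = Γ.partialAction.ofFun f' := fun h => congrArg _ h
  cases h with
  | vertex₀_mul_self v =>
    rw [map_mul, freeHom_letter]
    refine (Γ.partialAction.ofFun_mul _ _).symm.trans (hf ?_)
    exact (LocallyConstant.isStarProjection_charFn (Γ.isClopen_type₀ v)).isIdempotentElem
  | vertex₁_mul_self w =>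
    rw [map_mul, freeHom_letter]
    refine (Γ.partialAction.ofFun_mul _ _).symm.trans (hf ?_)
    exact (LocallyConstant.isStarProjection_charFn (Γ.isClopen_type₁ w)).isIdempotentElem
  | vertex₀_mul_of_ne v v' hv =>
    rw [map_mul, freeHom_letter, freeHom_letter, map_zero]
    refine (Γ.partialAction.ofFun_mul _ _).symm.trans ?_
    rw [← Γ.partialAction.ofFun_zero]
    refine hf ?_
    ext ξ
    rw [LocallyConstant.mul_apply]
    by_cases h : Γ.IsLocalConfig₀ ξ.1 1 v
    · rw [typeFun₀_of_not fun h' => hv (h.unique h'), mul_zero]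
      rfl
    · rw [typeFun₀_of_not h, zero_mul]
      rfl
  | vertex₁_mul_of_ne v v' hv =>
    rw [map_mul, freeHom_letter, freeHom_letter, map_zero]
    refine (Γ.partialAction.ofFun_mul _ _).symm.trans ?_
    rw [← Γ.partialAction.ofFun_zero]
    refine hf ?_
    ext ξ
    rw [LocallyConstant.mul_apply]
    by_cases h : Γ.IsLocalConfig₁ ξ.1 1 v
    · rw [typeFun₁_of_not fun h' => hv (h.unique h'), mul_zero]
      rfl
    · rw [typeFun₁_of_not h, zero_mul]
      rfl
  | vertex₀_mul_vertex₁ v w =>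
    rw [map_mul, freeHom_letter, freeHom_letter, map_zero]
    refine (Γ.partialAction.ofFun_mul _ _).symm.trans ?_
    rw [← Γ.partialAction.ofFun_zero]
    refine hf ?_
    ext ξ
    rw [LocallyConstant.mul_apply]
    by_cases h : Γ.IsLocalConfig₁ ξ.1 1 w
    · rw [typeFun₀_of_not h.not_isLocalConfig₀, zero_mul]
      rfl
    · rw [typeFun₁_of_not h, mul_zero]
      rfl
  | vertex₁_mul_vertex₀ v w =>
    rw [map_mul, freeHom_letter, freeHom_letter, map_zero]
    refine (Γ.partialAction.ofFun_mul _ _).symm.trans ?_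
    rw [← Γ.partialAction.ofFun_zero]
    refine hf ?_
    ext ξ
    rw [LocallyConstant.mul_apply]
    by_cases h : Γ.IsLocalConfig₁ ξ.1 1 w
    · rw [typeFun₀_of_not h.not_isLocalConfig₀, mul_zero]
      rfl
    · rw [typeFun₁_of_not h, zero_mul]
      rfl
  | range_mul_edge e =>
    rw [map_mul, freeHom_letter, freeHom_letter]
    refine (Γ.partialAction.ofFun_mul_single _ _).trans ?_
    exact Γ.partialAction.single_congr rfl (typeFun₀_mul_e e)
  | edge_mul_source e =>
    rw [map_mul, freeHom_letter, freeHom_letter]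
    change Γ.partialAction.δ K (of e) * Γ.partialAction.ofFun _ = Γ.partialAction.δ K (of e)
    -- The source vertex acts as `δ_e* δ_e`, which reduces the relation to `δ_e` being a partial
    -- isometry.
    rw [← e_inv_eq_typeFun₁, ← Γ.partialAction.star_δ_mul_δ, ← mul_assoc,
      Γ.partialAction.δ_mul_star_δ, TopPartialAction.δ, Γ.partialAction.ofFun_mul_single]
    refine Γ.partialAction.single_congr rfl ?_
    exact (LocallyConstant.isStarProjection_charFn
      (Γ.partialAction.isClopen_dom (of e))).isIdempotentElem
  | ghost_mul_edge_self e =>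
    rw [map_mul, freeHom_letter, freeHom_letter, freeHom_letter]
    refine (Γ.partialAction.star_δ_mul_δ _).trans (hf (e_inv_eq_typeFun₁ e))
  | ghost_mul_edge_of_ne e f hef hne =>
    rw [map_mul, freeHom_letter, freeHom_letter, map_zero]
    change star (Γ.partialAction.δ K (of e)) * Γ.partialAction.δ K (of f) = 0
    rw [TopPartialAction.star_δ, TopPartialAction.δ_mul_δ, TopPartialAction.δ,
      TopPartialAction.ofFun_mul_single, ← map_zero (Γ.partialAction.single (K := K) ((of e)⁻¹ * of f))]
    refine congrArg _ (Subtype.ext ?_)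
    ext ξ
    change (Γ.partialAction.e K (of e)⁻¹).1 ξ * (Γ.partialAction.e K ((of e)⁻¹ * of f)).1 ξ = 0
    by_cases h : ξ.1 (of e)⁻¹ = true
    · by_cases h' : ξ.1 ((of e)⁻¹ * of f) = true
      -- At the point `e⁻¹` the configuration would continue along both `e` (back to `1`) and `f`,
      -- two edges of one class.
      · have h₁ : ξ.1 ((of e)⁻¹ * of e) = true := by
          rw [inv_mul_cancel]
          exact ξ.2.one_mem
        exact absurd ((ξ.2.isLocalConfig₀ h h₁).eq_of_sameClass hef h₁ h') hne
      · rw [Γ.partialAction.e_apply_of_notMem h', mul_zero]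
    · rw [Γ.partialAction.e_apply_of_notMem h, zero_mul]
  | vertex_eq_sum v X hX =>
    rw [map_sum, freeHom_letter]
    simp only [map_mul, freeHom_letter]
    classical
    change Γ.partialAction.ofFun _ = ∑ e with e ∈ X,
      Γ.partialAction.δ K (of e) * star (Γ.partialAction.δ K (of e))
    simp only [TopPartialAction.δ_mul_star_δ, ← TopPartialAction.ofFunHom_apply]
    rw [← map_sum]
    refine congrArg _ ?_
    ext ξ
    have hs : (∑ e with e ∈ X, (Γ.partialAction.e K (of e)).1) ξ =
        ∑ e with e ∈ X, (Γ.partialAction.e K (of e)).1 ξ :=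
      map_sum (LocallyConstant.evalAddMonoidHom ξ) _ _
    rw [hs]
    -- At a root of type `v` exactly one summand equals one, by the choice of a single edge in `X`.
    -- At any other root all summands vanish.
    by_cases h : Γ.IsLocalConfig₀ ξ.1 1 v
    · obtain ⟨f, ⟨hf, hf'⟩, huniq⟩ := h.2.2 X hX
      rw [typeFun₀_of h, Finset.sum_eq_single_of_mem f (by simpa using hf),
        Γ.partialAction.e_apply_of_mem]
      · rwa [one_mul] at hf'
      · intro e he hne
        refine Γ.partialAction.e_apply_of_notMem fun h' => hne (huniq e ⟨by simpa using he, ?_⟩)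
        rwa [one_mul]
    · rw [typeFun₀_of_not h]
      symm
      refine Finset.sum_eq_zero fun e he => Γ.partialAction.e_apply_of_notMem fun h' => h ?_
      rw [← Γ.range_of_mem v X hX e (by simpa using he)]
      exact ξ.2.root₀ h'
  | sum_vertices =>
    rw [map_add, map_sum, map_sum, map_one]
    simp only [freeHom_letter]
    change ∑ v, Γ.partialAction.ofFun (Γ.typeFun₀ K v) +
      ∑ w, Γ.partialAction.ofFun (Γ.typeFun₁ K w) = 1
    simp only [← TopPartialAction.ofFunHom_apply]
    rw [← map_sum, ← map_sum, ← map_add, ← map_one (Γ.partialAction.ofFunHom K)]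
    refine congrArg _ ?_
    ext ξ
    have hs₀ : (∑ v, Γ.typeFun₀ K v) ξ = ∑ v, Γ.typeFun₀ K v ξ :=
      map_sum (LocallyConstant.evalAddMonoidHom ξ) _ _
    have hs₁ : (∑ w, Γ.typeFun₁ K w) ξ = ∑ w, Γ.typeFun₁ K w ξ :=
      map_sum (LocallyConstant.evalAddMonoidHom ξ) _ _
    rw [LocallyConstant.add_apply, hs₀, hs₁, LocallyConstant.one_apply]
    rcases ξ.2.isLocalConfig 1 ξ.2.one_mem with ⟨w, hw⟩ | ⟨v, hv⟩
    · rw [Finset.sum_eq_zero fun v _ => typeFun₀_of_not hw.not_isLocalConfig₀,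
        Finset.sum_eq_single_of_mem w (Finset.mem_univ _), typeFun₁_of hw, zero_add]
      exact fun w' _ hne => typeFun₁_of_not fun h => hne (h.unique hw)
    · rw [Finset.sum_eq_zero (s := Finset.univ) (f := fun w => Γ.typeFun₁ K w ξ)
          fun w _ => typeFun₁_of_not fun h => h.not_isLocalConfig₀ hv,
        Finset.sum_eq_single_of_mem v (Finset.mem_univ _), typeFun₀_of hv, add_zero]
      exact fun w' _ hne => typeFun₀_of_not fun h => hne (h.unique hv)

/-- The homomorphism from the Leavitt path algebra to the crossed product. -/
noncomputable def leavittHom :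
    Γ.LeavittPathAlgebra K →ₐ[K] Γ.partialAction.CrossedProduct K :=
  RingQuot.liftAlgHom K ⟨Γ.freeHom K, fun a b h => by
    rcases h with h | h
    · exact Γ.freeHom_leavittRel K h
    · have := Γ.freeHom_leavittRel K h
      rw [freeHom_star, freeHom_star] at this
      exact star_injective this⟩

theorem leavittHom_mk (a : FreePathAlgebra V₀ V₁ E K) :
    Γ.leavittHom K (Γ.leavittMk K a) = Γ.freeHom K a :=
  RingQuot.liftAlgHom_mkAlgHom_apply K _ _ a

theorem leavittHom_star (a : Γ.LeavittPathAlgebra K) :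
    Γ.leavittHom K (star a) = star (Γ.leavittHom K a) := by
  obtain ⟨a, rfl⟩ := Γ.leavittMk_surjective K a
  rw [star_leavittMk, leavittHom_mk, leavittHom_mk, freeHom_star]

theorem leavittHom_edge (e : E) :
    Γ.leavittHom K (Γ.leavittEdge K e) = Γ.partialAction.δ K (of e) :=
  (Γ.leavittHom_mk K _).trans (Γ.freeHom_letter K _)

theorem exists_leavittHom_eq_single {u : Γ.LeavittPathAlgebra K} (hu : u ∈ Γ.edgeSemigroup K) :
    ∃ (g : FreeGroup E) (a : Γ.partialAction.D K g),
      Γ.leavittHom K u = Γ.partialAction.single g a := by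
  induction hu using Subsemigroup.closure_induction with
  | mem u hu =>
    rcases hu with ⟨e, rfl⟩ | ⟨e, rfl⟩
    · exact ⟨_, _, Γ.leavittHom_edge K e⟩
    · refine ⟨(of e)⁻¹, Γ.partialAction.e K (of e)⁻¹, ?_⟩
      change Γ.leavittHom K (star (Γ.leavittEdge K e)) = _
      rw [leavittHom_star, leavittHom_edge, TopPartialAction.star_δ]
      rfl
  | mul u v _ _ hu hv =>
    obtain ⟨g, a, hu⟩ := hu
    obtain ⟨h, b, hv⟩ := hv
    exact ⟨_, _, by rw [map_mul, hu, hv, TopPartialAction.single_mul_single]⟩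

/-- The homomorphism from the abelianized Leavitt path algebra to the crossed product. -/
noncomputable def lAbHom : Γ.LAb K →ₐ[K] Γ.partialAction.CrossedProduct K :=
  RingQuot.liftAlgHom K ⟨Γ.leavittHom K, fun a b h => by
    obtain ⟨u, hu, u', hu', rfl, rfl⟩ := h
    obtain ⟨g, a, hu⟩ := Γ.exists_leavittHom_eq_single K hu
    obtain ⟨g', a', hu'⟩ := Γ.exists_leavittHom_eq_single K hu'
    simp only [map_mul, leavittHom_star, hu, hu', TopPartialAction.single_mul_star_single,
      ← TopPartialAction.ofFun_mul]
    rw [mul_comm]⟩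

theorem lAbHom_mk (a : Γ.LeavittPathAlgebra K) :
    Γ.lAbHom K (Γ.lAbMk K a) = Γ.leavittHom K a :=
  RingQuot.liftAlgHom_mkAlgHom_apply K _ _ a

theorem lAbHom_star (a : Γ.LAb K) : Γ.lAbHom K (star a) = star (Γ.lAbHom K a) := by
  obtain ⟨a, rfl⟩ := Γ.lAbMk_surjective K a
  rw [star_lAbMk, lAbHom_mk, lAbHom_mk, leavittHom_star]

theorem lAbHom_edge (e : E) : Γ.lAbHom K (Γ.lAbEdge K e) = Γ.partialAction.δ K (of e) :=
  (Γ.lAbHom_mk K _).trans (Γ.leavittHom_edge K e)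

end BipartiteSeparatedGraph

/-! ### The isomorphism -/

namespace BipartiteSeparatedGraph

open FreeGroup hiding map_mul map_one map_inv
open PathLetter FreePathAlgebra

section Generation

variable {V₀ V₁ E : Type*} [DecidableEq E]

theorem exists_finset_of_mem_isOpen {Γ : BipartiteSeparatedGraph V₀ V₁ E} {U : Set Γ.Omega}
    (hU : IsOpen U) {ξ : Γ.Omega} (hξ : ξ ∈ U) :
    ∃ F : Finset (FreeGroup E), ∀ η : Γ.Omega, (∀ g ∈ F, η.1 g = ξ.1 g) → η ∈ U := by
  obtain ⟨V, hV, rfl⟩ := isOpen_induced_iff.1 hU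
  obtain ⟨F, u, hu, huV⟩ := isOpen_pi_iff.1 hV ξ.1 hξ
  refine ⟨F, fun η hη => huV fun g hg => ?_⟩
  rw [hη g hg]
  exact (hu g hg).2

variable [Finite E] (Γ : BipartiteSeparatedGraph V₀ V₁ E) (K : Type*) [Field K]

/-- The functions on the configuration space are generated by the characteristic functions of the
domains of the partial action. -/
theorem adjoin_e_eq_top :
    Algebra.adjoin K (Set.range fun g : FreeGroup E => (Γ.partialAction.e K g).1) = ⊤ := by
  classical
  set A := Algebra.adjoin K (Set.range fun g : FreeGroup E => (Γ.partialAction.e K g).1) with hA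
  -- The sets whose characteristic function lies in `A` form a Boolean algebra containing the sets
  -- `Ω_g`, hence all cylinders and, by compactness, all clopen sets.
  let Good : Set Γ.Omega → Prop := fun U => ∃ f ∈ A, ∀ x, f x = if x ∈ U then 1 else 0
  have hcompl : ∀ U, Good U → Good Uᶜ := by
    rintro U ⟨f, hf, h⟩
    refine ⟨1 - f, sub_mem (one_mem _) hf, fun x => ?_⟩
    rw [LocallyConstant.sub_apply, LocallyConstant.one_apply, h]
    by_cases hx : x ∈ U <;> simp [hx]
  have hinter : ∀ U V, Good U → Good V → Good (U ∩ V) := by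
    rintro U V ⟨f, hf, h⟩ ⟨f', hf', h'⟩
    refine ⟨f * f', mul_mem hf hf', fun x => ?_⟩
    rw [LocallyConstant.mul_apply, h, h']
    by_cases hx : x ∈ U <;> by_cases hx' : x ∈ V <;> simp [hx, hx']
  have hunion : ∀ U V, Good U → Good V → Good (U ∪ V) := by
    intro U V hU hV
    have := hcompl _ (hinter _ _ (hcompl U hU) (hcompl V hV))
    rwa [Set.compl_inter, compl_compl, compl_compl] at this
  have huniv : Good Set.univ := ⟨1, one_mem _, fun x => by simp⟩
  have hdom : ∀ g, Good {ξ | ξ.1 g = true} := by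
    intro g
    refine ⟨_, Algebra.subset_adjoin ⟨g, rfl⟩, fun ξ => ?_⟩
    by_cases h : ξ.1 g = true
    · rw [if_pos (show ξ ∈ {ξ : Γ.Omega | ξ.1 g = true} from h)]
      exact Γ.partialAction.e_apply_of_mem h
    · rw [if_neg (show ξ ∉ {ξ : Γ.Omega | ξ.1 g = true} from h)]
      exact Γ.partialAction.e_apply_of_notMem h
  have hcyl : ∀ (ξ : Γ.Omega) (F : Finset (FreeGroup E)), Good {η | ∀ g ∈ F, η.1 g = ξ.1 g} := by
    intro ξ F
    induction F using Finset.induction_on with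
    | empty => simpa using huniv
    | insert g F _ ih =>
      have h : {η : Γ.Omega | ∀ k ∈ insert g F, η.1 k = ξ.1 k} =
          {η | η.1 g = ξ.1 g} ∩ {η | ∀ k ∈ F, η.1 k = ξ.1 k} := by
        ext η
        exact Finset.forall_mem_insert g F _
      rw [h]
      refine hinter _ _ ?_ ih
      cases hg : ξ.1 g
      · have := hcompl _ (hdom g)
        convert this using 1
        ext η
        change η.1 g = false ↔ ¬ η.1 g = true
        simp
      · exact hdom g
  have hclopen : ∀ U, IsClopen U → Good U := by
    intro U hU
    -- Compactness induction needs a property inherited by subsets. Being good is not, but being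
    -- covered by a good subset of `U` is.
    suffices ∃ W, Good W ∧ U ⊆ W ∧ W ⊆ U by
      obtain ⟨W, hW, h₁, h₂⟩ := this
      rwa [h₁.antisymm h₂]
    refine hU.isClosed.isCompact.induction_on (p := fun s => ∃ W, Good W ∧ s ⊆ W ∧ W ⊆ U)
      ?_ ?_ ?_ ?_
    · refine ⟨∅, ?_, subset_rfl, Set.empty_subset _⟩
      simpa using hcompl _ huniv
    · rintro s s' hs ⟨W, hW, h₁, h₂⟩
      exact ⟨W, hW, hs.trans h₁, h₂⟩
    · rintro s s' ⟨W, hW, h₁, h₂⟩ ⟨W', hW', h₁', h₂'⟩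
      exact ⟨W ∪ W', hunion _ _ hW hW', Set.union_subset_union h₁ h₁', Set.union_subset h₂ h₂'⟩
    · intro ξ hξ
      obtain ⟨F, hF⟩ := exists_finset_of_mem_isOpen hU.isOpen hξ
      refine ⟨{η | ∀ g ∈ F, η.1 g = ξ.1 g}, ?_, _, hcyl ξ F, subset_rfl, hF⟩
      refine mem_nhdsWithin_of_mem_nhds (IsOpen.mem_nhds ?_ fun g _ => rfl)
      have : {η : Γ.Omega | ∀ g ∈ F, η.1 g = ξ.1 g} = ⋂ g ∈ F, {η | η.1 g = ξ.1 g} := by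
        ext η
        simp
      rw [this]
      exact isOpen_biInter_finset fun g _ => (isOpen_discrete {ξ.1 g}).preimage
        (f := fun η : Γ.Omega => η.1 g) ((continuous_apply g).comp continuous_subtype_val)
  rw [eq_top_iff]
  intro f _
  have hfin : (Set.range f).Finite := f.range_finite
  choose! φ hφ hφ' using fun c : K => hclopen (f ⁻¹' {c}) (f.isLocallyConstant.isClopen_fiber c)
  -- A locally constant function on a compact space has finitely many values, so it is a finite
  -- combination of characteristic functions of its clopen fibres.
  have hf : f = ∑ c ∈ hfin.toFinset, c • φ c := by
    ext x
    have hs : (∑ c ∈ hfin.toFinset, c • φ c) x = ∑ c ∈ hfin.toFinset, (c • φ c) x :=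
      map_sum (LocallyConstant.evalAddMonoidHom x) _ _
    rw [hs, Finset.sum_eq_single_of_mem (f x) (by simp)]
    · simp [hφ']
    · intro c _ hc
      simp [hφ', hc.symm]
  rw [hf]
  exact sum_mem fun c _ => A.smul_mem (hφ c) c

end Generation

/-! ### The relations in the abelianized algebra and tameness of its edges. -/

variable {V₀ V₁ E : Type*} [Fintype V₀] [Fintype V₁] [Fintype E]
  (Γ : BipartiteSeparatedGraph V₀ V₁ E) (K : Type*) [Field K] [StarRing K]

/-- The image of a letter in the abelianized Leavitt path algebra. -/
noncomputable def lAbLetter (x : PathLetter V₀ V₁ E) : Γ.LAb K :=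
  Γ.lAbMk K (Γ.leavittMk K (letter x))

theorem lAbLetter_edge (e : E) : Γ.lAbLetter K (edge e) = Γ.lAbEdge K e := rfl

theorem lAbLetter_ghost (e : E) : Γ.lAbLetter K (ghost e) = star (Γ.lAbEdge K e) := by
  rw [lAbEdge, leavittEdge, star_lAbMk, star_leavittMk, star_letter]
  rfl

theorem leavittMk_eq {a b : FreePathAlgebra V₀ V₁ E K} (h : Γ.LeavittRel K a b) :
    Γ.leavittMk K a = Γ.leavittMk K b :=
  RingQuot.mkAlgHom_rel K (Or.inl h)

theorem lAb_eq {a b : FreePathAlgebra V₀ V₁ E K} (h : Γ.LeavittRel K a b) :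
    Γ.lAbMk K (Γ.leavittMk K a) = Γ.lAbMk K (Γ.leavittMk K b) :=
  congrArg _ (Γ.leavittMk_eq K h)

theorem star_lAbEdge_mul (e : E) :
    star (Γ.lAbEdge K e) * Γ.lAbEdge K e = Γ.lAbLetter K (vertex₁ (Γ.s e)) := by
  have := Γ.lAb_eq K (.ghost_mul_edge_self e)
  rwa [map_mul, map_mul, ← lAbLetter, ← lAbLetter, lAbLetter_ghost] at this

theorem lAbEdge_mul_source (e : E) :
    Γ.lAbEdge K e * Γ.lAbLetter K (vertex₁ (Γ.s e)) = Γ.lAbEdge K e := by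
  have := Γ.lAb_eq K (.edge_mul_source e)
  rwa [map_mul, map_mul] at this

theorem range_mul_lAbEdge (e : E) :
    Γ.lAbLetter K (vertex₀ (Γ.r e)) * Γ.lAbEdge K e = Γ.lAbEdge K e := by
  have := Γ.lAb_eq K (.range_mul_edge e)
  rwa [map_mul, map_mul] at this

open scoped Classical in
theorem lAbLetter_vertex₀_eq_sum {v : V₀} {X : Set E} (hX : X ∈ Γ.C v) :
    Γ.lAbLetter K (vertex₀ v) = ∑ e with e ∈ X, Γ.lAbEdge K e * star (Γ.lAbEdge K e) := by
  have := Γ.lAb_eq K (.vertex_eq_sum v X hX)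
  simp only [map_sum, map_mul] at this
  refine this.trans (Finset.sum_congr rfl fun e _ => ?_)
  rw [← lAbLetter_ghost, ← lAbLetter_edge, lAbLetter, lAbLetter]

theorem lAbEdge_mul_star_mul_of_ne {e f : E} (h : Γ.SameClass e f) (hne : e ≠ f) :
    star (Γ.lAbEdge K e) * Γ.lAbEdge K f = 0 := by
  have := Γ.lAb_eq K (.ghost_mul_edge_of_ne e f h hne)
  rwa [map_mul, map_mul, ← lAbLetter, ← lAbLetter, lAbLetter_ghost, map_zero, map_zero] at this

theorem vertex₀_mul_of_ne {v v' : V₀} (h : v ≠ v') :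
    Γ.lAbLetter K (vertex₀ v) * Γ.lAbLetter K (vertex₀ v') = 0 := by
  have := Γ.lAb_eq K (.vertex₀_mul_of_ne v v' h)
  rwa [map_mul, map_mul, map_zero, map_zero] at this

theorem vertex₁_mul_of_ne {w w' : V₁} (h : w ≠ w') :
    Γ.lAbLetter K (vertex₁ w) * Γ.lAbLetter K (vertex₁ w') = 0 := by
  have := Γ.lAb_eq K (.vertex₁_mul_of_ne w w' h)
  rwa [map_mul, map_mul, map_zero, map_zero] at this

theorem vertex₁_mul_vertex₀ (w : V₁) (v : V₀) :
    Γ.lAbLetter K (vertex₁ w) * Γ.lAbLetter K (vertex₀ v) = 0 := by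
  have := Γ.lAb_eq K (.vertex₁_mul_vertex₀ v w)
  rwa [map_mul, map_mul, map_zero, map_zero] at this

theorem vertex₀_mul_self (v : V₀) :
    Γ.lAbLetter K (vertex₀ v) * Γ.lAbLetter K (vertex₀ v) = Γ.lAbLetter K (vertex₀ v) := by
  have := Γ.lAb_eq K (.vertex₀_mul_self v)
  rwa [map_mul, map_mul] at this

theorem sum_lAbLetter :
    ∑ v, Γ.lAbLetter K (vertex₀ v) + ∑ w, Γ.lAbLetter K (vertex₁ w) = 1 := by
  have := Γ.lAb_eq K .sum_vertices
  rwa [map_add, map_add, map_sum, map_sum, map_sum, map_sum, map_one, map_one] at this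

/-- The empty word is left out because its value `1` need not belong to the semigroup `U`. -/
theorem exists_wordVal_eq_lAbMk {L : List (E × Bool)} (hL : L ≠ []) :
    ∃ u ∈ Γ.edgeSemigroup K, wordVal (Γ.lAbEdge K) L = Γ.lAbMk K u := by
  have hletter : ∀ x : E × Bool,
      ∃ u ∈ Γ.edgeSemigroup K, letterVal (Γ.lAbEdge K) x = Γ.lAbMk K u := by
    rintro ⟨e, b⟩
    cases b
    · exact ⟨star (Γ.leavittEdge K e), Subsemigroup.subset_closure (Or.inr ⟨e, rfl⟩),
        Γ.star_lAbMk K _⟩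
    · exact ⟨Γ.leavittEdge K e, Subsemigroup.subset_closure (Or.inl ⟨e, rfl⟩), rfl⟩
  induction L with
  | nil => exact absurd rfl hL
  | cons x L ih =>
    obtain ⟨u, hu, hx⟩ := hletter x
    by_cases hL' : L = []
    · exact ⟨u, hu, by rw [hL', wordVal_singleton, hx]⟩
    · obtain ⟨u', hu', h⟩ := ih hL'
      exact ⟨u * u', mul_mem hu hu', by rw [wordVal_cons, hx, h, map_mul]⟩

theorem isTame_lAbEdge : IsTame (Γ.lAbEdge K) where
  partialIsometry e := by rw [mul_assoc, star_lAbEdge_mul, lAbEdge_mul_source]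
  commute L M := by
    rcases eq_or_ne L [] with rfl | hL
    · rw [rangeProj_nil]
      exact Commute.one_left _
    rcases eq_or_ne M [] with rfl | hM
    · rw [rangeProj_nil]
      exact Commute.one_right _
    obtain ⟨u, hu, h⟩ := Γ.exists_wordVal_eq_lAbMk K hL
    obtain ⟨u', hu', h'⟩ := Γ.exists_wordVal_eq_lAbMk K hM
    have := RingQuot.mkAlgHom_rel K (s := Γ.CommutatorRel K) ⟨u, hu, u', hu', rfl, rfl⟩
    rw [Commute, SemiconjBy, rangeProj, rangeProj, h, h', star_lAbMk, star_lAbMk, ← map_mul,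
      ← map_mul, ← map_mul, ← map_mul]
    exact this

/-- Vertices are redundant as generators: `v` is a sum of elements `e e*`, and `w` equals `e* e` for
any edge with source `w`. -/
theorem adjoin_letterVal_eq_top :
    Algebra.adjoin K (Set.range (letterVal (Γ.lAbEdge K))) = ⊤ := by
  classical
  set A := Algebra.adjoin K (Set.range (letterVal (Γ.lAbEdge K))) with hA
  have hedge : ∀ e, Γ.lAbEdge K e ∈ A := fun e => Algebra.subset_adjoin ⟨(e, true), rfl⟩
  have hghost : ∀ e, star (Γ.lAbEdge K e) ∈ A := fun e =>
    Algebra.subset_adjoin ⟨(e, false), rfl⟩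
  have hletter : ∀ x, Γ.lAbLetter K x ∈ A := by
    intro x
    cases x with
    | vertex₀ v =>
      obtain ⟨e, rfl⟩ := Γ.r_surjective v
      obtain ⟨X, hX, -⟩ := Γ.exists_mem_C e
      rw [lAbLetter_vertex₀_eq_sum Γ K hX]
      exact sum_mem fun e _ => mul_mem (hedge e) (hghost e)
    | vertex₁ w =>
      obtain ⟨e, rfl⟩ := Γ.s_surjective w
      rw [← star_lAbEdge_mul]
      exact mul_mem (hghost e) (hedge e)
    | edge e => exact hedge e
    | ghost e => rw [lAbLetter_ghost]; exact hghost e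
  rw [eq_top_iff]
  rintro z -
  obtain ⟨z, rfl⟩ := Γ.lAbMk_surjective K z
  obtain ⟨z, rfl⟩ := Γ.leavittMk_surjective K z
  induction z using MonoidAlgebra.induction_on with
  | of m =>
    induction m using FreeMonoid.recOn with
    | one => rw [map_one, map_one, map_one]; exact one_mem _
    | of_mul x m ih =>
      rw [map_mul, map_mul, map_mul]
      exact mul_mem (hletter x) ih
  | add a b ha hb => rw [map_add, map_add]; exact add_mem ha hb
  | smul c a ha => rw [map_smul, map_smul]; exact A.smul_mem ha c

/-! ### Characters of the diagonal and the configurations they define. -/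

variable [DecidableEq E]

/-- The range projection of a word as an element of the diagonal. -/
noncomputable def diagProj (L : List (E × Bool)) : diagonal K (Γ.lAbEdge K) :=
  ⟨rangeProj (Γ.lAbEdge K) L, (Γ.isTame_lAbEdge K).rangeProj_mem K L⟩

variable {Γ K}

theorem diagProj_mul_self (L : List (E × Bool)) :
    Γ.diagProj K L * Γ.diagProj K L = Γ.diagProj K L :=
  Subtype.ext ((Γ.isTame_lAbEdge K).isIdempotentElem_rangeProj L)

theorem apply_diagProj (χ : diagonal K (Γ.lAbEdge K) →ₐ[K] K) (L : List (E × Bool)) :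
    χ (Γ.diagProj K L) = 0 ∨ χ (Γ.diagProj K L) = 1 := by
  have := congrArg χ (diagProj_mul_self (Γ := Γ) (K := K) L)
  rw [map_mul] at this
  exact (IsIdempotentElem.iff_eq_zero_or_one (p := χ (Γ.diagProj K L))).1 this

theorem diagProj_nil : Γ.diagProj K [] = 1 := Subtype.ext rangeProj_nil

theorem diagProj_edge (e : E) :
    (Γ.diagProj K [(e, true)]).1 = Γ.lAbEdge K e * star (Γ.lAbEdge K e) := by
  change wordVal (Γ.lAbEdge K) _ * star (wordVal (Γ.lAbEdge K) _) = _
  rw [wordVal_singleton]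
  rfl

theorem diagProj_ghost (e : E) :
    (Γ.diagProj K [(e, false)]).1 = Γ.lAbLetter K (vertex₁ (Γ.s e)) := by
  change wordVal (Γ.lAbEdge K) _ * star (wordVal (Γ.lAbEdge K) _) = _
  rw [wordVal_singleton, ← star_lAbEdge_mul]
  change star _ * star (star _) = _
  rw [star_star]

theorem diagProj_edge_mul_edge {e f : E} (h : Γ.SameClass e f) (hne : e ≠ f) :
    Γ.diagProj K [(e, true)] * Γ.diagProj K [(f, true)] = 0 := by
  refine Subtype.ext ?_
  rw [MulMemClass.coe_mul, diagProj_edge, diagProj_edge, mul_assoc, ← mul_assoc (star _),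
    lAbEdge_mul_star_mul_of_ne Γ K h hne, zero_mul, mul_zero]
  rfl

theorem vertex₀_mul_diagProj_edge (v : V₀) (e : E) : Γ.lAbLetter K (vertex₀ v) *
    (Γ.diagProj K [(e, true)]).1 =
      (Γ.lAbLetter K (vertex₀ v) * Γ.lAbLetter K (vertex₀ (Γ.r e))) *
        (Γ.diagProj K [(e, true)]).1 := by
  rw [diagProj_edge, mul_assoc, ← mul_assoc (Γ.lAbLetter K (vertex₀ (Γ.r e))), range_mul_lAbEdge]

theorem diagProj_ghost_mul_edge (e f : E) :
    Γ.diagProj K [(e, false)] * Γ.diagProj K [(f, true)] = 0 := by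
  refine Subtype.ext ?_
  rw [MulMemClass.coe_mul, diagProj_ghost, diagProj_edge, ← range_mul_lAbEdge, ← mul_assoc,
    ← mul_assoc, vertex₁_mul_vertex₀, zero_mul, zero_mul]
  rfl

theorem vertex₀_mem_diagonal (v : V₀) :
    Γ.lAbLetter K (vertex₀ v) ∈ diagonal K (Γ.lAbEdge K) := by
  classical
  obtain ⟨e, rfl⟩ := Γ.r_surjective v
  obtain ⟨X, hX, -⟩ := Γ.exists_mem_C e
  rw [lAbLetter_vertex₀_eq_sum Γ K hX]
  refine sum_mem fun f _ => ?_
  rw [← diagProj_edge]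
  exact (Γ.diagProj K _).2

theorem vertex₁_mem_diagonal (w : V₁) :
    Γ.lAbLetter K (vertex₁ w) ∈ diagonal K (Γ.lAbEdge K) := by
  obtain ⟨e, rfl⟩ := Γ.s_surjective w
  rw [← diagProj_ghost]
  exact (Γ.diagProj K _).2

/-- The values of a character of the diagonal on the projections of the letters form the local
configuration of a vertex. -/
theorem localConfig_of_char (χ : diagonal K (Γ.lAbEdge K) →ₐ[K] K) :
    (∃ w, ∀ e, χ (Γ.diagProj K [(e, true)]) ≠ 1 ∧
      (χ (Γ.diagProj K [(e, false)]) = 1 ↔ Γ.s e = w)) ∨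
    ∃ v, (∀ e, χ (Γ.diagProj K [(e, false)]) ≠ 1) ∧
      (∀ e, χ (Γ.diagProj K [(e, true)]) = 1 → Γ.r e = v) ∧
      ∀ X ∈ Γ.C v, ∃! e, e ∈ X ∧ χ (Γ.diagProj K [(e, true)]) = 1 := by
  classical
  have hmul : ∀ {a b : diagonal K (Γ.lAbEdge K)}, a * b = 0 → χ a = 1 → χ b ≠ 1 := by
    intro a b hab ha hb
    have := congrArg χ hab
    rw [map_mul, ha, hb, map_zero, one_mul] at this
    exact one_ne_zero this
  -- The projection of the letter `e⁻¹` is the vertex `s(e)`. If `χ` is one on such a vertex, this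
  -- is the type of the root. Otherwise `χ` kills all vertices of `V₁`, and since the vertices sum
  -- to `1` it is nonzero on a vertex of `V₀`.
  by_cases h₁ : ∃ e, χ (Γ.diagProj K [(e, false)]) = 1
  · obtain ⟨e, he⟩ := h₁
    refine Or.inl ⟨Γ.s e, fun f => ⟨hmul (diagProj_ghost_mul_edge e f) he, ?_, ?_⟩⟩
    · intro hf
      by_contra hne
      refine hmul (Subtype.ext ?_) he hf
      rw [MulMemClass.coe_mul, diagProj_ghost, diagProj_ghost,
        vertex₁_mul_of_ne Γ K (Ne.symm hne)]
      rfl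
    · intro hf
      have : Γ.diagProj K [(f, false)] = Γ.diagProj K [(e, false)] :=
        Subtype.ext (by rw [diagProj_ghost, diagProj_ghost, hf])
      rw [this, he]
  · push Not at h₁
    let p₀ : V₀ → diagonal K (Γ.lAbEdge K) := fun v => ⟨_, vertex₀_mem_diagonal v⟩
    let p₁ : V₁ → diagonal K (Γ.lAbEdge K) := fun w => ⟨_, vertex₁_mem_diagonal w⟩
    have hp₁ : ∀ w, χ (p₁ w) = 0 := by
      intro w
      obtain ⟨e, rfl⟩ := Γ.s_surjective w
      have : p₁ (Γ.s e) = Γ.diagProj K [(e, false)] := Subtype.ext (diagProj_ghost e).symm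
      rw [this]
      exact (apply_diagProj χ _).resolve_right (h₁ e)
    have hsum : ∑ v, p₀ v + ∑ w, p₁ w = 1 := by
      refine Subtype.ext ?_
      rw [AddMemClass.coe_add, AddSubmonoidClass.coe_finsetSum, AddSubmonoidClass.coe_finsetSum]
      exact Γ.sum_lAbLetter K
    have hsum' := congrArg χ hsum
    rw [map_add, map_sum, map_sum, Finset.sum_eq_zero (f := fun w => χ (p₁ w)) fun w _ => hp₁ w,
      add_zero, map_one] at hsum'
    obtain ⟨v, -, hv⟩ := Finset.exists_ne_zero_of_sum_ne_zero (hsum'.trans_ne one_ne_zero)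
    have hv₁ : χ (p₀ v) = 1 := by
      have : p₀ v * p₀ v = p₀ v := Subtype.ext (Γ.vertex₀_mul_self K v)
      have := congrArg χ this
      rw [map_mul] at this
      exact ((IsIdempotentElem.iff_eq_zero_or_one (p := χ (p₀ v))).1 this).resolve_left hv
    refine Or.inr ⟨v, h₁, fun e he => ?_, fun X hX => ?_⟩
    · by_contra hne
      refine hmul (a := p₀ v) (Subtype.ext ?_) hv₁ he
      refine (vertex₀_mul_diagProj_edge v e).trans ?_
      rw [vertex₀_mul_of_ne Γ K (Ne.symm hne), zero_mul]
      rfl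
    -- The projections `e e*` for `e ∈ X` are orthogonal with sum `v`, and `χ` takes the values `0`
    -- and `1` on them, so it selects exactly one edge.
    · have hX' : p₀ v = ∑ e with e ∈ X, Γ.diagProj K [(e, true)] := by
        refine Subtype.ext ?_
        rw [AddSubmonoidClass.coe_finsetSum]
        simp only [diagProj_edge]
        exact lAbLetter_vertex₀_eq_sum Γ K hX
      have hX'' := congrArg χ hX'
      rw [hv₁, map_sum] at hX''
      obtain ⟨e, he, hne⟩ :=
        Finset.exists_ne_zero_of_sum_ne_zero (hX''.symm.trans_ne one_ne_zero)
      have he₁ := (apply_diagProj χ _).resolve_left hne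
      refine ⟨e, ⟨by simpa using he, he₁⟩, ?_⟩
      rintro f ⟨hf, hf₁⟩
      by_contra hfe
      exact hmul (diagProj_edge_mul_edge ((sameClass_iff hX hf).2 (by simpa using he)) hfe) hf₁ he₁

/-- Translating a character by `L` produces projections of possibly unreduced words `L x`, whereas
its configuration is defined by reduced words; here the two are compared. -/
theorem apply_diagProj_append (χ : diagonal K (Γ.lAbEdge K) →ₐ[K] K) {L : List (E × Bool)}
    (hL : χ (Γ.diagProj K L) = 1) (x : E × Bool) :
    χ (Γ.diagProj K (L ++ [x])) = χ (Γ.diagProj K (FreeGroup.mk (L ++ [x])).toWord) := by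
  have : Γ.diagProj K (L ++ [x]) =
      Γ.diagProj K L * Γ.diagProj K (FreeGroup.mk (L ++ [x])).toWord :=
    Subtype.ext ((Γ.isTame_lAbEdge K).rangeProj_append_singleton L x)
  rw [this, map_mul, hL, one_mul]

-- Prefix closure holds because the projection of a word lies below that of each prefix. The local
-- condition at `g` is the root condition for the translated character, which is defined because `χ`
-- is one on the projection of `g`.
open scoped Classical in
theorem isConfiguration_of_char (χ : diagonal K (Γ.lAbEdge K) →ₐ[K] K) :
    Γ.IsConfiguration fun g => decide (χ (Γ.diagProj K g.toWord) = 1) where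
  one_mem := by simp [diagProj_nil]
  convex := by
    refine PrefixClosed.convex fun g x hw hx => ?_
    simp only [decide_eq_true_eq] at hx ⊢
    have h : Γ.diagProj K g.toWord * Γ.diagProj K (g.toWord ++ [x]) =
      Γ.diagProj K (g.toWord ++ [x]) :=
        Subtype.ext ((Γ.isTame_lAbEdge K).rangeProj_mul_rangeProj_append _ _)
    have h' := congrArg χ h
    rwa [map_mul, ← hw, hx, mul_one] at h'
  isLocalConfig g hg := by
    have hg' : χ (Γ.diagProj K g.toWord) = 1 := by simpa using hg
    have key : ∀ x : E × Bool,
        (Γ.isTame_lAbEdge K).translateChar χ g.toWord hg' (Γ.diagProj K [x]) =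
          χ (Γ.diagProj K (g * FreeGroup.mk [x]).toWord) := by
      intro x
      refine ((Γ.isTame_lAbEdge K).translateChar_rangeProj χ g.toWord [x] hg').trans ?_
      refine (apply_diagProj_append χ hg' x).trans ?_
      rw [mk_append, mk_toWord]
    have hof : ∀ e : E, FreeGroup.mk [(e, true)] = of e := fun _ => rfl
    have hinv : ∀ e : E, FreeGroup.mk [(e, false)] = (of e)⁻¹ := fun _ => rfl
    have := localConfig_of_char ((Γ.isTame_lAbEdge K).translateChar χ g.toWord hg')
    simp only [key, hof, hinv] at this
    rcases this with ⟨w, hw⟩ | ⟨v, hv⟩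
    · refine Or.inl ⟨w, fun e => ⟨?_, ?_⟩⟩
      · simpa using (hw e).1
      · simpa using (hw e).2
    · refine Or.inr ⟨v, fun e => ?_, fun e => ?_, fun X hX => ?_⟩
      · simpa using hv.1 e
      · simpa using hv.2.1 e
      · simpa using hv.2.2 X hX

theorem lAbHom_letterVal (x : E × Bool) :
    Γ.lAbHom K (letterVal (Γ.lAbEdge K) x) = Γ.partialAction.δ K (FreeGroup.mk [x]) := by
  obtain ⟨e, b⟩ := x
  cases b
  · change Γ.lAbHom K (star (Γ.lAbEdge K e)) = Γ.partialAction.δ K (of e)⁻¹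
    rw [lAbHom_star, lAbHom_edge, TopPartialAction.star_δ]
  · exact Γ.lAbHom_edge K e

/-- The product `δ_x δ_g` carries an extra factor `e(x)`. For a reduced word it is absorbed, since a
configuration containing the word contains its first letter. -/
theorem lAbHom_wordVal {L : List (E × Bool)} (hL : IsReduced L) :
    Γ.lAbHom K (wordVal (Γ.lAbEdge K) L) = Γ.partialAction.δ K (FreeGroup.mk L) := by
  induction L with
  | nil => rw [wordVal_nil, map_one, ← one_eq_mk, TopPartialAction.δ_one]
  | cons x L ih =>
    rw [wordVal_cons, map_mul, lAbHom_letterVal, ih (hL.infix ⟨[x], [], by simp⟩),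
      TopPartialAction.δ_mul_δ, ← mk_cons, TopPartialAction.δ, TopPartialAction.ofFun_mul_single]
    refine Γ.partialAction.single_congr rfl ?_
    ext ξ
    by_cases h : ξ.1 (FreeGroup.mk (x :: L)) = true
    · have h' : ξ.1 (FreeGroup.mk [x]) = true :=
        ξ.2.prefixClosed.of_append (L := [x]) (M := L) hL h
      rw [LocallyConstant.mul_apply, Γ.partialAction.e_apply_of_mem h,
        Γ.partialAction.e_apply_of_mem h', one_mul]
    · rw [LocallyConstant.mul_apply, Γ.partialAction.e_apply_of_notMem h, mul_zero]

theorem lAbHom_rangeProj (g : FreeGroup E) : Γ.lAbHom K (rangeProj (Γ.lAbEdge K) g.toWord) =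
    Γ.partialAction.ofFun (Γ.partialAction.e K g).1 := by
  rw [rangeProj, map_mul, lAbHom_star, lAbHom_wordVal isReduced_toWord, mk_toWord,
    TopPartialAction.δ_mul_star_δ]

-- On the diagonal, the value of a character is the value of the image function at its
-- configuration. So a diagonal element in the kernel of `lAbHom` is killed by all characters.
open scoped Classical in
theorem exists_lAbHom_eq_ofFun {a : Γ.LAb K} (ha : a ∈ diagonal K (Γ.lAbEdge K)) :
    ∃ f : LocallyConstant Γ.Omega K, Γ.lAbHom K a = Γ.partialAction.ofFun f ∧
      ∀ χ : diagonal K (Γ.lAbEdge K) →ₐ[K] K,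
        f ⟨_, isConfiguration_of_char χ⟩ = χ ⟨a, ha⟩ := by
  induction ha using Algebra.adjoin_induction with
  | mem a ha =>
    obtain ⟨g, rfl⟩ := ha
    refine ⟨_, lAbHom_rangeProj g, fun χ => ?_⟩
    change _ = χ (Γ.diagProj K g.toWord)
    rcases apply_diagProj χ g.toWord with h | h
    · rw [h]
      refine Γ.partialAction.e_apply_of_notMem ?_
      rw [mem_dom]
      simp [h]
    · rw [h]
      refine Γ.partialAction.e_apply_of_mem ?_
      rw [mem_dom]
      simp [h]
  | algebraMap c =>
    refine ⟨algebraMap K _ c, ?_, fun χ => (AlgHom.commutes χ c).symm⟩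
    rw [AlgHom.commutes, ← TopPartialAction.ofFunHom_apply, AlgHom.commutes]
  | add a b ha hb h₁ h₂ =>
    obtain ⟨f, hf, hf'⟩ := h₁
    obtain ⟨f', hf₁, hf₁'⟩ := h₂
    refine ⟨f + f', by rw [map_add, hf, hf₁, TopPartialAction.ofFun_add], fun χ => ?_⟩
    rw [LocallyConstant.add_apply, hf' χ, hf₁' χ, ← map_add]
    rfl
  | mul a b ha hb h₁ h₂ =>
    obtain ⟨f, hf, hf'⟩ := h₁
    obtain ⟨f', hf₁, hf₁'⟩ := h₂
    refine ⟨f * f', by rw [map_mul, hf, hf₁, TopPartialAction.ofFun_mul], fun χ => ?_⟩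
    rw [LocallyConstant.mul_apply, hf' χ, hf₁' χ, ← map_mul]
    rfl

theorem eq_zero_of_mem_diagonal {a : Γ.LAb K} (ha : a ∈ diagonal K (Γ.lAbEdge K))
    (h : Γ.lAbHom K a = 0) : a = 0 := by
  by_contra hne
  obtain ⟨χ, hχ⟩ := exists_algHom_apply_ne_zero_of_mem_adjoin_idempotents (K := K)
    (S := Set.range fun g : FreeGroup E => rangeProj (Γ.lAbEdge K) g.toWord)
    (by rintro _ ⟨g, rfl⟩; exact (Γ.isTame_lAbEdge K).isIdempotentElem_rangeProj _)
    (by rintro _ ⟨g, rfl⟩ _ ⟨k, rfl⟩; exact ((Γ.isTame_lAbEdge K).commute _ _).eq)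
    ⟨a, ha⟩ (fun h => hne (congrArg Subtype.val h))
  obtain ⟨f, hf, hf'⟩ := exists_lAbHom_eq_ofFun ha
  have hf0 : f = 0 := Γ.partialAction.ofFun_injective (by
    rw [← hf, h, TopPartialAction.ofFun_zero])
  refine hχ ((hf' χ).symm.trans ?_)
  rw [hf0]
  rfl

/-- In `z = ∑ a_g u_g` the terms have images in different degrees, so each is mapped to zero. Then
`a_g u_g u_g*` is diagonal with image zero, hence zero, and `u_g = u_g u_g* u_g` gives `a_g u_g =
0`. -/
theorem lAbHom_injective : Function.Injective (Γ.lAbHom K) := by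
  rw [injective_iff_map_eq_zero]
  intro z hz
  have ht := Γ.isTame_lAbEdge K
  have hmem := ht.mem_iSup_of_mem_adjoin K (z := z)
    (by rw [adjoin_letterVal_eq_top]; exact Algebra.mem_top)
  obtain ⟨f, hf, rfl⟩ := (Submodule.mem_iSup_iff_exists_finsupp _ _).1 hmem
  have hsingle : ∀ g, ∃ a, Γ.lAbHom K (f g) = Γ.partialAction.single g a := by
    intro g
    obtain ⟨a, ha, h⟩ := hf g
    obtain ⟨φ, hφ, -⟩ := exists_lAbHom_eq_ofFun ha
    refine ⟨⟨φ * (Γ.partialAction.e K g).1, Ideal.mul_mem_left _ _ (Γ.partialAction.e K g).2⟩, ?_⟩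
    rw [← h, LinearMap.mulRight_apply, map_mul, hφ, lAbHom_wordVal isReduced_toWord, mk_toWord,
      TopPartialAction.δ, TopPartialAction.ofFun_mul_single]
  choose b hb using hsingle
  have hzero : ∀ g, Γ.lAbHom K (f g) = 0 := by
    intro g
    have hc := congrArg (Γ.partialAction.coeff g) hz
    rw [Finsupp.sum, map_sum, map_sum, map_zero] at hc
    by_cases hg : g ∈ f.support
    · rw [Finset.sum_eq_single_of_mem g hg, hb, TopPartialAction.coeff_single_self] at hc
      · rw [hb, show b g = 0 from Subtype.ext hc, map_zero]
      · intro k _ hk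
        rw [hb, TopPartialAction.coeff_single_of_ne _ hk]
    · rw [Finsupp.notMem_support_iff.1 hg, map_zero]
  refine Finset.sum_eq_zero fun g _ => ?_
  obtain ⟨a, ha, h⟩ := hf g
  rw [LinearMap.mulRight_apply] at h
  have h₁ : a * rangeProj (Γ.lAbEdge K) g.toWord = 0 := by
    refine eq_zero_of_mem_diagonal (mul_mem ha (ht.rangeProj_mem K _)) ?_
    rw [rangeProj, ← mul_assoc, h, map_mul, hzero, zero_mul]
  rw [← h, ← ht.rangeProj_mul_wordVal, ← mul_assoc, h₁, zero_mul]

theorem lAbHom_surjective : Function.Surjective (Γ.lAbHom K) := by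
  intro z
  induction z using TopPartialAction.induction_on with
  | zero => exact ⟨0, map_zero _⟩
  | add a b ha hb =>
    obtain ⟨a, rfl⟩ := ha
    obtain ⟨b, rfl⟩ := hb
    exact ⟨a + b, map_add _ _ _⟩
  | single g a =>
    have hle : (⊤ : Subalgebra K (LocallyConstant Γ.Omega K)) ≤
        (Γ.lAbHom K).range.comap (Γ.partialAction.ofFunHom K) := by
      rw [← adjoin_e_eq_top, Algebra.adjoin_le_iff]
      rintro _ ⟨k, rfl⟩
      exact ⟨_, lAbHom_rangeProj k⟩
    obtain ⟨b, hb⟩ := hle (Algebra.mem_top (x := a.1))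
    refine ⟨b * wordVal (Γ.lAbEdge K) g.toWord, ?_⟩
    rw [map_mul, lAbHom_wordVal isReduced_toWord, mk_toWord,
      TopPartialAction.single_eq_ofFun_mul_δ]
    exact congrArg (· * _) hb

variable (Γ K)

/-- The isomorphism `L^ab_K(E, C) ≅ C_K(Ω(E, C)) ⋊ 𝔽`. -/
noncomputable def lAbEquiv : Γ.LAb K ≃⋆ₐ[K] Γ.partialAction.CrossedProduct K :=
  StarAlgEquiv.ofBijective
    (⟨Γ.lAbHom K, Γ.lAbHom_star K⟩ : Γ.LAb K →⋆ₐ[K] Γ.partialAction.CrossedProduct K)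
    ⟨lAbHom_injective, lAbHom_surjective⟩

end BipartiteSeparatedGraph

/-! ### Construction of configurations -/

namespace BipartiteSeparatedGraph

open FreeGroup hiding map_mul map_one map_inv

variable {V₀ V₁ E : Type*} {Γ : BipartiteSeparatedGraph V₀ V₁ E}

variable (Γ) in
/-- The words, written from right to left, of the tree with a root of type `w` which at a vertex
of `V₀` at distance `n` from the root uses the edges selected by `σ n`. -/
inductive InTree (σ : ℕ → E → Prop) (w : V₁) : List (E × Bool) → Prop
  | nil : InTree σ w []
  | root (f : E) (h : Γ.s f = w) : InTree σ w [(f, false)]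
  | up (e e₀ : E) (L : List (E × Bool)) (h : InTree σ w ((e₀, false) :: L))
      (hr : Γ.r e = Γ.r e₀) (hC : ¬ Γ.SameClass e e₀) (hσ : σ (L.length + 1) e) :
      InTree σ w ((e, true) :: (e₀, false) :: L)
  | down (f e : E) (L : List (E × Bool)) (h : InTree σ w ((e, true) :: L))
      (hs : Γ.s f = Γ.s e) (hne : f ≠ e) : InTree σ w ((f, false) :: (e, true) :: L)

variable {σ : ℕ → E → Prop} {w : V₁}

theorem InTree.tail {x : E × Bool} {L : List (E × Bool)} (h : Γ.InTree σ w (x :: L)) :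
    Γ.InTree σ w L := by
  cases h with
  | root => exact .nil
  | up _ _ _ h => exact h
  | down _ _ _ h => exact h

theorem InTree.head?_ne {x : E × Bool} {L : List (E × Bool)} (h : Γ.InTree σ w (x :: L)) :
    L.head? ≠ some (letterInv x) := by
  cases h with
  | root => simp
  | up e e₀ L h hr hC =>
    intro h'
    obtain rfl : e₀ = e := by simpa [letterInv] using h'
    exact hC (sameClass_refl _)
  | down f e L h hs hne =>
    intro h'
    exact hne (by simpa [letterInv, eq_comm] using h')

theorem InTree.isReduced {L : List (E × Bool)} (h : Γ.InTree σ w L) : IsReduced L.reverse := by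
  induction L with
  | nil => exact IsReduced.nil
  | cons x L ih =>
    rw [List.reverse_cons, isReduced_append]
    refine ⟨ih h.tail, IsReduced.singleton, fun y hy z hz hzy => ?_⟩
    obtain rfl : x = z := by simpa using hz
    rw [List.getLast?_reverse] at hy
    subst hzy
    refine h.head?_ne ?_
    rw [letterInv_letterInv]
    exact hy

/-- The reduced word of an admissible path, written from right to left. -/
def pathWord (x : ℕ → E) : ℕ → List (E × Bool)
  | 0 => []
  -- Edges with odd index lead from `V₁` to `V₀` and contribute `e⁻¹`; those with even index lead
  -- back and contribute `e`.
  | n + 1 => (x (n + 1), decide (n % 2 = 1)) :: pathWord x n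

theorem length_pathWord (x : ℕ → E) (n : ℕ) : (pathWord x n).length = n := by
  induction n with
  | zero => rfl
  | succ n ih => rw [pathWord, List.length_cons, ih]

theorem pathWord_congr {x y : ℕ → E} {n : ℕ} (h : ∀ i, 1 ≤ i → i ≤ n → x i = y i) :
    pathWord x n = pathWord y n := by
  induction n with
  | zero => rfl
  | succ n ih =>
    rw [pathWord, pathWord, ih fun i h₁ h₂ => h i h₁ (by omega), h (n + 1) (by omega) le_rfl]

theorem getLast?_pathWord (x : ℕ → E) (n : ℕ) :
    (pathWord x (n + 1)).getLast? = some (x 1, false) := by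
  induction n with
  | zero => rfl
  | succ n ih =>
    rw [pathWord, List.getLast?_cons, ih]
    rfl

theorem IsAdmissible.mono {n m : ℕ} {x : ℕ → E} (h : Γ.IsAdmissible n x) (hm : m ≤ n) :
    Γ.IsAdmissible m x :=
  ⟨fun i hi => h.1 i (hi.trans hm), fun i hi => h.2 i (hi.trans hm)⟩

/-- A point at distance `i` from the root continues with the edge `x (i + 1)`. Requiring each `σ i`
to select this edge therefore forces the whole path into the tree. -/
theorem inTree_pathWord {n : ℕ} {x : ℕ → E} (h : Γ.IsAdmissible n x)
    (hσ : ∀ i, σ i (x (i + 1))) : Γ.InTree σ (Γ.s (x 1)) (pathWord x n) := by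
  induction n with
  | zero => exact .nil
  | succ n ih =>
    have ih := ih (h.mono n.le_succ)
    rcases n with - | n
    · exact .root _ rfl
    · rw [pathWord, pathWord] at *
      rcases Nat.even_or_odd' n with ⟨i, rfl | rfl⟩
      · have e₁ : decide ((2 * i + 1) % 2 = 1) = true := by simp
        have e₂ : decide (2 * i % 2 = 1) = false := by simp
        rw [e₂] at ih
        rw [e₁, e₂]
        obtain ⟨h₁, h₂⟩ := h.1 i le_rfl
        refine .up _ _ _ ih h₁.symm (fun h => h₂ h.symm) ?_
        rw [length_pathWord]
        exact hσ _
      · have e₁ : decide ((2 * i + 1 + 1) % 2 = 1) = false := decide_eq_false (by omega)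
        have e₂ : decide ((2 * i + 1) % 2 = 1) = true := by simp
        rw [e₂] at ih
        rw [e₁, e₂]
        obtain ⟨h₁, h₂⟩ := h.2 i le_rfl
        exact .down _ _ _ ih h₁.symm (Ne.symm h₂)

/-- A choice function on all classes, forced to pick `e` in the class of `e`. As classes are
disjoint, no class receives an edge chosen for another. -/
theorem exists_selection (e : E) :
    ∃ τ : E → Prop, (∀ v, ∀ X ∈ Γ.C v, ∃! f, f ∈ X ∧ τ f) ∧ τ e := by
  have h : ∀ X : {X : Set E // ∃ v, X ∈ Γ.C v}, ∃ f ∈ X.1, e ∈ X.1 → f = e := by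
    rintro ⟨X, v, hX⟩
    by_cases he : e ∈ X
    · exact ⟨e, he, fun _ => rfl⟩
    · obtain ⟨f, hf⟩ := Γ.nonempty_of_mem v X hX
      exact ⟨f, hf, fun h => absurd h he⟩
  choose c hc hce using h
  refine ⟨fun f => ∃ X, c X = f, fun v X hX => ?_, ?_⟩
  · refine ⟨c ⟨X, v, hX⟩, ⟨hc ⟨X, v, hX⟩, _, rfl⟩, ?_⟩
    rintro f ⟨hf, ⟨Y, v', hY⟩, rfl⟩
    congr 2
    exact eq_of_mem_C hY hX (hc ⟨Y, v', hY⟩) hf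
  · obtain ⟨X, hX, he⟩ := Γ.exists_mem_C e
    exact ⟨⟨X, _, hX⟩, hce _ he⟩

theorem IsLocalConfig₁.congr {ξ η : FreeGroup E → Bool} {g : FreeGroup E}
    (h : ∀ x : E × Bool, η (g * FreeGroup.mk [x]) = ξ (g * FreeGroup.mk [x]))
    (hξ : Γ.IsLocalConfig₁ ξ g w) : Γ.IsLocalConfig₁ η g w := fun e => by
  have h₁ : η (g * of e) = ξ (g * of e) := h (e, true)
  have h₂ : η (g * (of e)⁻¹) = ξ (g * (of e)⁻¹) := h (e, false)
  rw [h₁, h₂]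
  exact hξ e

theorem IsLocalConfig₀.congr {v : V₀} {ξ η : FreeGroup E → Bool} {g : FreeGroup E}
    (h : ∀ x : E × Bool, η (g * FreeGroup.mk [x]) = ξ (g * FreeGroup.mk [x]))
    (hξ : Γ.IsLocalConfig₀ ξ g v) : Γ.IsLocalConfig₀ η g v := by
  have h₁ : ∀ e, η (g * of e) = ξ (g * of e) := fun e => h (e, true)
  have h₂ : ∀ e, η (g * (of e)⁻¹) = ξ (g * (of e)⁻¹) := fun e => h (e, false)
  simpa only [IsLocalConfig₀, h₁, h₂] using hξ

variable [DecidableEq E]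

variable (Γ σ w) in
open scoped Classical in
/-- The indicator function of the tree. -/
noncomputable def treeFun (g : FreeGroup E) : Bool := decide (Γ.InTree σ w g.toWord.reverse)

theorem treeFun_eq_true {g : FreeGroup E} :
    Γ.treeFun σ w g = true ↔ Γ.InTree σ w g.toWord.reverse := by simp [treeFun]

/-- The neighbours of a tree point lying in the tree are its parent, reached by cancelling the last
letter, and its children. -/
theorem treeFun_mul_letter {g : FreeGroup E} (hg : Γ.InTree σ w g.toWord.reverse)
    (x : E × Bool) : Γ.treeFun σ w (g * FreeGroup.mk [x]) = true ↔
      g.toWord.reverse.head? = some (letterInv x) ∨ Γ.InTree σ w (x :: g.toWord.reverse) := by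
  rw [treeFun_eq_true]
  rcases toWord_mul_letter g x with h | h
  · rw [h, List.reverse_append, List.reverse_singleton, List.singleton_append]
    refine ⟨Or.inr, fun h' => h'.resolve_left fun hh => ?_⟩
    have hr : IsReduced (g.toWord ++ [x]) := h ▸ isReduced_toWord
    rw [List.head?_reverse] at hh
    exact (isReduced_append.1 hr).2.2 _ hh x rfl (letterInv_letterInv x).symm
  · constructor
    · intro _
      left
      rw [h, List.reverse_append, List.reverse_singleton]
      rfl
    · intro _
      rw [h, List.reverse_append, List.reverse_singleton] at hg
      exact hg.tail

theorem isConfiguration_treeFun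
    (hσ : ∀ n v, ∀ X ∈ Γ.C v, ∃! e, e ∈ X ∧ σ n e) : Γ.IsConfiguration (Γ.treeFun σ w) where
  one_mem := by
    rw [treeFun_eq_true]
    simpa using InTree.nil
  convex := by
    refine PrefixClosed.convex fun g x hw hx => ?_
    rw [treeFun_eq_true, hw, List.reverse_append, List.reverse_singleton] at hx
    exact treeFun_eq_true.2 hx.tail
  isLocalConfig g hg := by
    rw [treeFun_eq_true] at hg
    have key := treeFun_mul_letter hg
    have h₁ : ∀ e : E, of e = FreeGroup.mk [(e, true)] := fun _ => rfl
    have h₂ : ∀ e : E, (FreeGroup.mk [(e, true)])⁻¹ = FreeGroup.mk [(e, false)] := fun _ => rfl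
    simp only [IsLocalConfig₁, IsLocalConfig₀, h₁, h₂, ← Bool.not_eq_true, key]
    generalize g.toWord.reverse = M at hg
    -- The point is the root, or was reached by `e₀⁻¹` and has the type `r(e₀)`, or was reached by
    -- `e₀` and has the type `s(e₀)`.
    rcases M with - | ⟨⟨e₀, b⟩, L⟩
    · refine Or.inl ⟨w, fun e => ⟨?_, ?_⟩⟩
      · rintro (h | h)
        · simp at h
        · cases h
      · constructor
        · rintro (h | h)
          · simp at h
          · cases h
            assumption
        · intro h
          exact Or.inr (.root e h)
    · cases b
      · refine Or.inr ⟨Γ.r e₀, fun e => ?_, fun e => ?_, fun X hX => ?_⟩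
        · rintro (h | h)
          · simp [letterInv] at h
          · cases h
        · rintro (h | h)
          · obtain rfl : e₀ = e := by simpa [letterInv] using h
            rfl
          · cases h
            assumption
        -- In its own class, `e₀` is the required edge and leads back to the parent. In the other
        -- classes `σ` selects the edge.
        · by_cases he₀ : e₀ ∈ X
          · refine ⟨e₀, ⟨he₀, Or.inl rfl⟩, ?_⟩
            rintro e ⟨he, h | h⟩
            · simpa [letterInv, eq_comm] using h
            · cases h with
              | up _ _ _ _ _ hC => exact absurd ((sameClass_iff hX he).2 he₀) hC
          · obtain ⟨e, ⟨he, hse⟩, huniq⟩ := hσ (L.length + 1) _ X hX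
            refine ⟨e, ⟨he, Or.inr (.up e e₀ L hg (Γ.range_of_mem _ X hX e he) ?_ hse)⟩, ?_⟩
            · rw [sameClass_iff hX he]
              exact he₀
            · rintro f ⟨hf, h | h⟩
              · obtain rfl : e₀ = f := by simpa [letterInv] using h
                exact absurd hf he₀
              · cases h with
                | up _ _ _ _ _ _ hσf => exact huniq f ⟨hf, hσf⟩
      · refine Or.inl ⟨Γ.s e₀, fun f => ⟨?_, ?_⟩⟩
        · rintro (h | h)
          · simp [letterInv] at h
          · cases h
        · constructor
          · rintro (h | h)
            · obtain rfl : e₀ = f := by simpa [letterInv] using h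
              rfl
            · cases h
              assumption
          · intro h
            by_cases hf : f = e₀
            · subst hf
              exact Or.inl rfl
            · exact Or.inr (.down f e₀ L hg h hf)

theorem isLocalConfig₁_treeFun : Γ.IsLocalConfig₁ (Γ.treeFun σ w) 1 w := by
  have hg : Γ.InTree σ w (1 : FreeGroup E).toWord.reverse := by simpa using InTree.nil
  have key := treeFun_mul_letter hg
  have h₁ : ∀ e : E, of e = FreeGroup.mk [(e, true)] := fun _ => rfl
  have h₂ : ∀ e : E, (FreeGroup.mk [(e, true)])⁻¹ = FreeGroup.mk [(e, false)] := fun _ => rfl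
  intro e
  rw [h₁, h₂, ← Bool.not_eq_true, key, key, toWord_one, List.reverse_nil]
  refine ⟨?_, ?_, fun h => Or.inr (.root e h)⟩
  · rintro (h | h)
    · simp at h
    · cases h
  · rintro (h | h)
    · simp at h
    · cases h
      assumption

/-- Every admissible path is contained in a configuration. -/
theorem exists_isConfiguration_of_isAdmissible {n : ℕ} {x : ℕ → E} (h : Γ.IsAdmissible n x) :
    ∃ ζ, Γ.IsConfiguration ζ ∧ Γ.IsLocalConfig₁ ζ 1 (Γ.s (x 1)) ∧
      ζ (FreeGroup.mk (pathWord x n).reverse) = true ∧ IsReduced (pathWord x n).reverse := by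
  -- A selection for each distance, because a single one could not contain the edges of a path that
  -- uses two edges of one class.
  choose σ hσ hσx using fun i => Γ.exists_selection (x (i + 1))
  have ht := inTree_pathWord h hσx
  refine ⟨Γ.treeFun σ (Γ.s (x 1)), isConfiguration_treeFun hσ, isLocalConfig₁_treeFun, ?_,
    ht.isReduced⟩
  rw [treeFun_eq_true, ht.isReduced.toWord_mk, List.reverse_reverse]
  exact ht

/-- The entry ends at a vertex with a class `X`, not containing its last edge, that has two edges `y
≠ y'`. Prolonging the entry by `y` or by `y'` gives two configurations, and the second cannot
contain the prolongation `k` by `y`. -/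
theorem IsEntry.exists_split {e x : ℕ → E} {t : ℕ} (h : Γ.IsEntry e t x) :
    ∃ (a : E × Bool) (k : FreeGroup E) (ζ ζ' : FreeGroup E → Bool), k.toWord.head? = some a ∧
      Γ.IsConfiguration ζ ∧ Γ.IsConfiguration ζ' ∧ Γ.IsLocalConfig₁ ζ 1 (Γ.s (e 1)) ∧
      Γ.IsLocalConfig₁ ζ' 1 (Γ.s (e 1)) ∧ ζ k = true ∧ ζ' k = false := by
  obtain ⟨ht, hx, hs, X, hX, hxX, y, hy, y', hy', hne⟩ := h
  obtain ⟨t, rfl⟩ : ∃ t', t = t' + 1 := ⟨t - 1, by omega⟩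
  have e₀ : 2 * (t + 1) - 1 = 2 * t + 1 := by omega
  rw [e₀] at hx hX hxX
  have key : ∀ z ∈ X, ∃ ζ, Γ.IsConfiguration ζ ∧ Γ.IsLocalConfig₁ ζ 1 (Γ.s (e 1)) ∧
      ζ (FreeGroup.mk (pathWord x (2 * t + 1)).reverse * of z) = true ∧
      ζ (FreeGroup.mk (pathWord x (2 * t + 1)).reverse) = true ∧
      IsReduced ((pathWord x (2 * t + 1)).reverse ++ [(z, true)]) := by
    intro z hz
    -- The entry has the edges `1, …, 2t + 1`, so the new edge gets the index `2t + 2`.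
    let x' := Function.update x (2 * t + 2) z
    have hx' : ∀ i, i ≤ 2 * t + 1 → x' i = x i := fun i hi =>
      Function.update_of_ne (by omega) _ _
    have hz' : x' (2 * t + 2) = z := Function.update_self _ _ _
    have hadm : Γ.IsAdmissible (2 * t + 2) x' := by
      refine ⟨fun i hi => ?_, fun i hi => ?_⟩
      · by_cases hit : i = t
        · subst hit
          rw [hz', hx' _ le_rfl]
          refine ⟨(Γ.range_of_mem _ X hX z hz).symm, fun hC => hxX ?_⟩
          exact (sameClass_iff hX hz).1 hC.symm
        · rw [hx' _ (by omega), hx' _ (by omega)]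
          exact hx.1 i (by omega)
      · rw [hx' _ (by omega), hx' _ (by omega)]
        exact hx.2 i (by omega)
    obtain ⟨ζ, hζ, hroot, hpath, hred⟩ := exists_isConfiguration_of_isAdmissible hadm
    have hw : (pathWord x' (2 * t + 2)).reverse =
        (pathWord x (2 * t + 1)).reverse ++ [(z, true)] := by
      rw [pathWord, hz', List.reverse_cons, pathWord_congr fun i _ hi => hx' i hi]
      have : decide ((2 * t + 1) % 2 = 1) = true := by simp
      rw [this]
    rw [hw] at hpath hred
    rw [hx' 1 (by omega), hs] at hroot
    refine ⟨ζ, hζ, hroot, ?_, hζ.prefixClosed.of_append hred hpath, hred⟩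
    rwa [mk_append] at hpath
  obtain ⟨ζ, hζ, hroot, hy₁, -, hred⟩ := key y hy
  obtain ⟨ζ', hζ', hroot', hy₁', hq', -⟩ := key y' hy'
  refine ⟨(x 1, false), _, ζ, ζ', ?_, hζ, hζ', hroot, hroot', hy₁, ?_⟩
  · have : FreeGroup.mk (pathWord x (2 * t + 1)).reverse * of y =
        FreeGroup.mk ((pathWord x (2 * t + 1)).reverse ++ [(y, true)]) := (mk_append _ _).symm
    rw [this, hred.toWord_mk, List.head?_append, List.head?_reverse, getLast?_pathWord]
    rfl
  · by_contra hc
    rw [Bool.not_eq_false] at hc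
    exact hne ((hζ'.isLocalConfig₀ hq' hc).eq_of_sameClass ((sameClass_iff hX hy).2 hy') hc hy₁')

/-! ### Gluing of configurations -/

/-- The set which agrees with `ζ` on the words with first letter `a`, and with `ξ` elsewhere. -/
def glue (a : E × Bool) (ζ ξ : FreeGroup E → Bool) (k : FreeGroup E) : Bool :=
  if k.toWord.head? = some a then ζ k else ξ k

theorem glue_of_head {a : E × Bool} {ζ ξ : FreeGroup E → Bool} {k : FreeGroup E}
    (h : k.toWord.head? = some a) : glue a ζ ξ k = ζ k := if_pos h

theorem glue_of_head_ne {a : E × Bool} {ζ ξ : FreeGroup E → Bool} {k : FreeGroup E}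
    (h : k.toWord.head? ≠ some a) : glue a ζ ξ k = ξ k := if_neg h

/-- At a point other than `1`, all neighbours except possibly `1` lie behind the same first letter,
so the local configuration is that of `ζ` or that of `ξ`. At the root the two agree, because both
have the type `w`. -/
theorem isConfiguration_glue {a : E × Bool} {ζ ξ : FreeGroup E → Bool}
    (hζ : Γ.IsConfiguration ζ) (hξ : Γ.IsConfiguration ξ) (hζw : Γ.IsLocalConfig₁ ζ 1 w)
    (hξw : Γ.IsLocalConfig₁ ξ 1 w) : Γ.IsConfiguration (glue a ζ ξ) where
  one_mem := by
    rw [glue_of_head_ne (by simp)]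
    exact hξ.one_mem
  convex := by
    refine PrefixClosed.convex fun g x hw hx => ?_
    by_cases hg : g = 1
    · rw [hg, glue_of_head_ne (by simp)]
      exact hξ.one_mem
    · have hh := head?_mul_letter (x := x) hg (by
        rw [Ne, ← toWord_eq_nil_iff, hw]
        simp)
      by_cases h : g.toWord.head? = some a
      · rw [glue_of_head (hh.trans h)] at hx
        rw [glue_of_head h]
        exact hζ.prefixClosed g x hw hx
      · rw [glue_of_head_ne (hh.trans_ne h)] at hx
        rw [glue_of_head_ne h]
        exact hξ.prefixClosed g x hw hx
  isLocalConfig g hg := by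
    by_cases h1 : g = 1
    · subst h1
      have key : ∀ x : E × Bool, ζ (1 * FreeGroup.mk [x]) = ξ (1 * FreeGroup.mk [x]) := by
        rintro ⟨e, b⟩
        cases b
        · exact Bool.eq_iff_iff.2 ((hζw e).2.trans (hξw e).2.symm)
        · exact (hζw e).1.trans (hξw e).1.symm
      refine Or.inl ⟨w, hξw.congr fun x => ?_⟩
      rw [glue]
      split_ifs
      · exact key x
      · rfl
    · have hh : ∀ x : E × Bool, g * FreeGroup.mk [x] ≠ 1 →
          (g * FreeGroup.mk [x]).toWord.head? = g.toWord.head? := fun x hx =>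
        head?_mul_letter h1 hx
      by_cases h : g.toWord.head? = some a
      · rw [glue_of_head h] at hg
        have hc : ∀ x : E × Bool,
            glue a ζ ξ (g * FreeGroup.mk [x]) = ζ (g * FreeGroup.mk [x]) := by
          intro x
          by_cases hx : g * FreeGroup.mk [x] = 1
          · rw [hx, glue_of_head_ne (by simp), hξ.one_mem, hζ.one_mem]
          · exact glue_of_head ((hh x hx).trans h)
        exact (hζ.isLocalConfig g hg).imp (fun ⟨w, hw⟩ => ⟨w, hw.congr hc⟩)
          fun ⟨v, hv⟩ => ⟨v, hv.congr hc⟩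
      · rw [glue_of_head_ne h] at hg
        have hc : ∀ x : E × Bool,
            glue a ζ ξ (g * FreeGroup.mk [x]) = ξ (g * FreeGroup.mk [x]) := by
          intro x
          by_cases hx : g * FreeGroup.mk [x] = 1
          · rw [hx, glue_of_head_ne (by simp)]
          · exact glue_of_head_ne ((hh x hx).trans_ne h)
        exact (hξ.isLocalConfig g hg).imp (fun ⟨w, hw⟩ => ⟨w, hw.congr hc⟩)
          fun ⟨v, hv⟩ => ⟨v, hv.congr hc⟩

end BipartiteSeparatedGraph

/-! ### Closed paths and entries -/

namespace BipartiteSeparatedGraph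

variable {V₀ V₁ E : Type*} {Γ : BipartiteSeparatedGraph V₀ V₁ E}

/-- Under condition (L), every closed path visits a vertex of `V₁` from which an entry starts. -/
theorem IsClosedPath.exists_entry (hL : Γ.ConditionL) {r : ℕ} {e : ℕ → E}
    (h : Γ.IsClosedPath r e) :
    ∃ m < r, ∃ (t : ℕ) (x : ℕ → E), Γ.IsEntry (fun j => e (2 * m + j)) t x := by
  classical
  obtain ⟨hr, hadm, hcl⟩ := h
  -- Among the closed stretches of the path, take one with `d` minimal. It runs from `e_{2m+1}` to
  -- `e_{2(m+d+1)}`, and minimality gives the condition on sources required of a cycle.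
  have hex : ∃ d m, m + d + 1 ≤ r ∧ Γ.s (e (2 * m + 1)) = Γ.s (e (2 * (m + d + 1))) :=
    ⟨r - 1, 0, by omega, by rw [show 0 + (r - 1) + 1 = r by omega]; exact hcl⟩
  obtain ⟨m, hm, hs⟩ := Nat.find_spec hex
  have hmin := fun d' => Nat.find_min hex (m := d')
  generalize Nat.find hex = d at hm hs hmin
  have hmin' : ∀ i j, i ≤ j → j < i + d → m + j + 1 ≤ r →
      Γ.s (e (2 * m + (2 * i + 1))) ≠ Γ.s (e (2 * m + (2 * j + 2))) := by
    intro i j hij hjd hj hs'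
    refine hmin (j - i) (by omega) ⟨m + i, by omega, ?_⟩
    rw [show 2 * (m + i) + 1 = 2 * m + (2 * i + 1) by omega,
      show 2 * (m + i + (j - i) + 1) = 2 * m + (2 * j + 2) by omega]
    exact hs'
  clear hmin hex
  have hA : ∀ i, i ≤ d → Γ.r (e (2 * m + (2 * i + 1))) = Γ.r (e (2 * m + (2 * i + 2))) ∧
      ¬ Γ.SameClass (e (2 * m + (2 * i + 1))) (e (2 * m + (2 * i + 2))) := by
    intro i hi
    have := hadm.1 (m + i) (by omega)
    rwa [show 2 * (m + i) + 1 = 2 * m + (2 * i + 1) by omega,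
      show 2 * (m + i) + 2 = 2 * m + (2 * i + 2) by omega] at this
  have hB : ∀ i, i < d → Γ.s (e (2 * m + (2 * i + 2))) = Γ.s (e (2 * m + (2 * i + 3))) ∧
      e (2 * m + (2 * i + 2)) ≠ e (2 * m + (2 * i + 3)) := by
    intro i hi
    have := hadm.2 (m + i) (by omega)
    rwa [show 2 * (m + i) + 2 = 2 * m + (2 * i + 2) by omega,
      show 2 * (m + i) + 3 = 2 * m + (2 * i + 3) by omega] at this
  rw [show 2 * (m + d + 1) = 2 * m + (2 * d + 2) by omega] at hs
  -- The stretch fails to be a cycle only if its first and last edges coincide. Then both are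
  -- stripped off and the remaining path is closed at a vertex of `V₀`.
  by_cases hne : e (2 * m + 1) = e (2 * m + (2 * d + 2))
  · have hd : 1 ≤ d := by
      by_contra hd
      obtain rfl : d = 0 := by omega
      refine (hA 0 le_rfl).2 ?_
      rw [← hne]
      exact sameClass_refl _
    by_cases hC : Γ.SameClass (e (2 * m + 2)) (e (2 * m + (2 * d + 1)))
    -- The two ends of the stripped path lie in one class. They are distinct, by admissibility if `d
    -- = 1` and by minimality otherwise, so this class has two elements and the single edge
    -- `e_{2m+1}` is an entry.
    · have hne' : e (2 * m + 2) ≠ e (2 * m + (2 * d + 1)) := by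
        rcases eq_or_lt_of_le hd with rfl | hd'
        · exact (hB 0 (by omega)).2
        · intro heq
          refine hmin' 1 (d - 1) (by omega) (by omega) (by omega) ?_
          have h₁ := (hB 0 (by omega)).1
          have h₂ := (hB (d - 1) (by omega)).1
          rw [show 2 * (d - 1) + 3 = 2 * d + 1 by omega] at h₂
          rw [h₂, ← heq]
          exact h₁.symm
      obtain ⟨h₁, h₂⟩ := hA 0 (by omega)
      obtain ⟨v, X, hX, hX₁, hX₂⟩ := hC
      have hv : v = Γ.r (e (2 * m + 1)) := (Γ.range_of_mem v X hX _ hX₁).symm.trans h₁.symm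
      refine ⟨m, by omega, 1, fun j => e (2 * m + j), le_rfl,
        ⟨fun i hi => by omega, fun i hi => by omega⟩, rfl, X, ?_, ?_,
        ⟨_, hX₁, _, hX₂, hne'⟩⟩
      · rw [hv] at hX
        exact hX
      · intro hX'
        exact h₂ ⟨v, X, hX, hX', hX₁⟩
    -- The ends lie in different classes, so the stripped path can be rotated to start at `e_{2m+3}`
    -- and to end with `e_{2m+2}`. This is a cycle, and its entry starts at the visit with index `m
    -- + 1`.
    · let c : ℕ → E := fun j => if j = 2 * d then e (2 * m + 2) else e (2 * m + (j + 2))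
      have hc : ∀ j, j < 2 * d → c j = e (2 * m + (j + 2)) := fun j hj => if_neg (by omega)
      have hc' : c (2 * d) = e (2 * m + 2) := if_pos rfl
      have hcyc : Γ.IsCycle d c := by
        refine ⟨⟨hd, ⟨fun i hi => ?_, fun i hi => ?_⟩, ?_⟩, ?_, fun i j hi hij hj => ?_⟩
        · by_cases hid : 2 * i + 2 = 2 * d
          · rw [hid, hc', hc _ (by omega), show 2 * i + 1 + 2 = 2 * d + 1 by omega]
            refine ⟨?_, fun h => hC h.symm⟩
            rw [(hA d le_rfl).1, ← hne]
            exact (hA 0 (by omega)).1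
          · rw [hc _ (by omega), hc _ (by omega)]
            exact hA (i + 1) (by omega)
        · rw [hc _ (by omega)]
          by_cases hid : 2 * i + 3 = 2 * d
          · omega
          · rw [hc _ (by omega)]
            exact hB (i + 1) (by omega)
        · rw [hc', hc _ (by omega)]
          exact (hB 0 (by omega)).1.symm
        · rw [hc', hc _ (by omega)]
          exact (hB 0 (by omega)).2.symm
        · rw [hc _ (by omega), hc _ (by omega), show 2 * i - 1 + 2 = 2 * i + 1 by omega]
          exact hmin' i j hij (by omega) (by omega)
      obtain ⟨t, x, h₁, h₂, h₃, h₄⟩ := hL d c hcyc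
      refine ⟨m + 1, by omega, t, x, h₁, h₂, ?_, h₄⟩
      change _ = Γ.s (e (2 * (m + 1) + 1))
      rw [h₃, hc _ (by omega), show 2 * (m + 1) + 1 = 2 * m + (1 + 2) by omega]
  · refine ⟨m, by omega, hL (d + 1) _ ⟨⟨by omega, ⟨fun i hi => hA i (by omega),
      fun i hi => hB i (by omega)⟩, hs⟩, hne, fun i j hi hij hj => ?_⟩⟩
    obtain ⟨i, rfl⟩ : ∃ i', i = i' + 1 := ⟨i - 1, by omega⟩
    obtain ⟨j, rfl⟩ : ∃ j', j = j' + 1 := ⟨j - 1, by omega⟩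
    exact hmin' i j (by omega) (by omega) (by omega)

end BipartiteSeparatedGraph

/-! ### Topological freeness -/

namespace BipartiteSeparatedGraph

open FreeGroup hiding map_mul map_one map_inv

variable {V₀ V₁ E : Type*} {Γ : BipartiteSeparatedGraph V₀ V₁ E}

/-- The set with indicator function `ξ` is invariant under `g`. -/
def IsPeriodic (ξ : FreeGroup E → Bool) (g : FreeGroup E) : Prop := ∀ k, ξ (g⁻¹ * k) = ξ k

theorem IsPeriodic.inv {ξ : FreeGroup E → Bool} {g : FreeGroup E} (h : IsPeriodic ξ g) :
    IsPeriodic ξ g⁻¹ := fun k => by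
  rw [← h, inv_inv, inv_mul_cancel_left]

theorem IsPeriodic.pow {ξ : FreeGroup E → Bool} {g : FreeGroup E} (h : IsPeriodic ξ g) (n : ℕ) :
    IsPeriodic ξ (g ^ n) := by
  induction n with
  | zero => intro k; simp
  | succ n ih =>
    intro k
    rw [pow_succ, mul_inv_rev, mul_assoc, h, ih]

variable [DecidableEq E]

variable (Γ) in
/-- All configurations close to `ξ` are invariant under `g`. -/
def IsLocallyPeriodic (ξ : FreeGroup E → Bool) (g : FreeGroup E) : Prop :=
  ∃ F : Finset (FreeGroup E), ∀ η, Γ.IsConfiguration η → (∀ k ∈ F, η k = ξ k) → IsPeriodic η g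

theorem IsConfiguration.translate_inv {ξ : FreeGroup E → Bool} (hξ : Γ.IsConfiguration ξ)
    {p : FreeGroup E} (hp : ξ p = true) : Γ.IsConfiguration fun k => ξ (p * k) := by
  have := hξ.translate Γ (g := p⁻¹) (by rwa [inv_inv])
  rwa [inv_inv] at this

/-- The finite test set moves to `p⁻¹ F`. Adding `p⁻¹` guarantees that a configuration close to the
translate can be translated back. -/
theorem IsLocallyPeriodic.translate {ξ : FreeGroup E → Bool} {g p : FreeGroup E}
    (h : Γ.IsLocallyPeriodic ξ g) (hξ : Γ.IsConfiguration ξ) :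
    Γ.IsLocallyPeriodic (fun k => ξ (p * k)) (p⁻¹ * g * p) := by
  obtain ⟨F, hF⟩ := h
  refine ⟨insert p⁻¹ (F.image (p⁻¹ * ·)), fun η hη hηF => ?_⟩
  have hp' : η p⁻¹ = true := by
    rw [hηF _ (Finset.mem_insert_self _ _)]
    change ξ (p * p⁻¹) = true
    rw [mul_inv_cancel]
    exact hξ.one_mem
  have hper := hF _ (hη.translate Γ hp') fun k hk => by
    rw [hηF _ (Finset.mem_insert_of_mem (Finset.mem_image_of_mem _ hk))]
    exact congrArg ξ (mul_inv_cancel_left p k)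
  intro k
  have := hper (p * k)
  simp only [inv_mul_cancel_left] at this
  rw [← this]
  congr 1
  group

variable (Γ) in
/-- A configuration all of whose neighbours are invariant under `g ≠ 1`, where the root is a point
of minimal displacement of `g`. -/
structure IsMinimalPeriodic (ξ : FreeGroup E → Bool) (g : FreeGroup E) : Prop where
  isConfiguration : Γ.IsConfiguration ξ
  isLocallyPeriodic : Γ.IsLocallyPeriodic ξ g
  ne_one : g ≠ 1
  norm_le : ∀ p, ξ p = true → g.norm ≤ (p⁻¹ * g * p).norm

namespace IsMinimalPeriodic

variable {ξ : FreeGroup E → Bool} {g : FreeGroup E}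

theorem isPeriodic (h : Γ.IsMinimalPeriodic ξ g) : IsPeriodic ξ g := by
  obtain ⟨F, hF⟩ := h.isLocallyPeriodic
  exact hF ξ h.isConfiguration fun _ _ => rfl

theorem mem_self (h : Γ.IsMinimalPeriodic ξ g) : ξ g = true := by
  rw [← h.isPeriodic, inv_mul_cancel]
  exact h.isConfiguration.one_mem

theorem prefix_mem (h : Γ.IsMinimalPeriodic ξ g) {L M : List (E × Bool)}
    (hL : g.toWord = L ++ M) : ξ (FreeGroup.mk L) = true :=
  h.isConfiguration.prefixClosed.of_append (M := M) (hL ▸ isReduced_toWord) (by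
    rw [← hL, mk_toWord]
    exact h.mem_self)

/-- Conjugating by a prefix rotates the word of `g`, so it does not increase the norm, and the new
root still has minimal displacement. -/
theorem translate (h : Γ.IsMinimalPeriodic ξ g) {L M : List (E × Bool)}
    (hL : g.toWord = L ++ M) : Γ.IsMinimalPeriodic (fun k => ξ (FreeGroup.mk L * k))
      ((FreeGroup.mk L)⁻¹ * g * FreeGroup.mk L) where
  isConfiguration := h.isConfiguration.translate_inv (h.prefix_mem hL)
  isLocallyPeriodic := h.isLocallyPeriodic.translate h.isConfiguration
  ne_one h1 := h.ne_one (by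
    rw [mul_assoc, inv_mul_eq_one] at h1
    exact (mul_eq_right.1 h1.symm))
  norm_le p hp := by
    have h₁ : ((FreeGroup.mk L)⁻¹ * g * FreeGroup.mk L).norm ≤ g.norm := by
      have hg : g = FreeGroup.mk L * FreeGroup.mk M := by rw [← mk_append, ← hL, mk_toWord]
      have h₂ : (FreeGroup.mk L)⁻¹ * g * FreeGroup.mk L = FreeGroup.mk (M ++ L) := by
        rw [mk_append, hg]
        group
      rw [h₂]
      refine norm_mk_le.trans ?_
      rw [FreeGroup.norm, hL, List.length_append, List.length_append, add_comm]
    refine h₁.trans ((h.norm_le _ hp).trans_eq ?_)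
    congr 1
    group

theorem isCyclicallyReduced (h : Γ.IsMinimalPeriodic ξ g) : IsCyclicallyReduced g.toWord :=
  isCyclicallyReduced_of_norm_le fun _ _ hL => h.norm_le _ (h.prefix_mem hL)

/-- There are periods of large norm whose inverses avoid a given first letter. -/
theorem exists_period (h : Γ.IsMinimalPeriodic ξ g) (a : E × Bool) (N : ℕ) :
    ∃ G : FreeGroup E, (∀ η, IsPeriodic η g → IsPeriodic η G) ∧ N < G⁻¹.norm ∧
      G⁻¹.toWord.head? ≠ some a := by
  have hc := h.isCyclicallyReduced
  have hc' := isCyclicallyReduced_inv hc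
  have hpos : 1 ≤ g.norm := Nat.one_le_iff_ne_zero.2 (mt norm_eq_zero.1 h.ne_one)
  have hN : N < (N + 1) * g.norm := by nlinarith
  -- Cyclic reducedness means that `g` and `g⁻¹` have different first letters, so one of the two
  -- directions along the axis avoids `a`. The exponent `N + 1` suffices because the norm of `g` is
  -- at least one.
  by_cases ha : g.toWord.head? = some a
  · refine ⟨g ^ (N + 1), fun η hη => hη.pow _, ?_, ?_⟩
    · rwa [norm_inv_eq, norm_pow_of_isCyclicallyReduced hc]
    · rw [← inv_pow, head?_pow_of_isCyclicallyReduced hc' (by omega), toWord_inv, head?_invRev]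
      intro hl
      obtain ⟨b, hb, hba⟩ := Option.map_eq_some_iff.1 hl
      have := rel_iff_ne_letterInv.1 (hc.2 b hb a ha)
      exact this hba.symm
  · refine ⟨g⁻¹ ^ (N + 1), fun η hη => hη.inv.pow _, ?_, ?_⟩
    · rwa [norm_inv_eq, norm_pow_of_isCyclicallyReduced hc', norm_inv_eq]
    · rwa [inv_pow, inv_inv, head?_pow_of_isCyclicallyReduced hc (by omega)]

/-- An entry permits changing `ξ` behind the letter `a`, while the periods of `ξ` can be made long
in a direction other than `a`. The changed configuration still looks like `ξ` around a distant point
`G⁻¹`, so it must be periodic, which would undo the change. -/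
theorem not_isEntry (h : Γ.IsMinimalPeriodic ξ g) {e x : ℕ → E} {t : ℕ}
    (hw : Γ.IsLocalConfig₁ ξ 1 (Γ.s (e 1))) : ¬ Γ.IsEntry e t x := by
  intro hx
  obtain ⟨a, k, ζ, ζ', hk, hζ, hζ', hζw, hζw', hζk, hζk'⟩ := hx.exists_split
  -- Two configurations that differ at `k` cannot both agree with `ξ` there; keep one that does not.
  obtain ⟨ζ, hζ, hζw, hζk⟩ : ∃ ζ, Γ.IsConfiguration ζ ∧ Γ.IsLocalConfig₁ ζ 1 (Γ.s (e 1)) ∧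
      ζ k ≠ ξ k := by
    by_cases hξk : ξ k = true
    · exact ⟨ζ', hζ', hζw', by rw [hξk, hζk']; exact Bool.false_ne_true⟩
    · exact ⟨ζ, hζ, hζw, by rw [hζk]; exact Ne.symm hξk⟩
  obtain ⟨F, hF⟩ := h.isLocallyPeriodic
  -- The bound makes `G⁻¹` longer than all of `F` and `k`, so the points `G⁻¹ f` keep the first
  -- letter of `G⁻¹` and lie outside the modified branch.
  obtain ⟨G, hG, hGN, hGa⟩ := h.exists_period a ((insert k F).sup FreeGroup.norm)
  have hξG := hG ξ h.isPeriodic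
  have hnear : ∀ f ∈ insert k F, glue a ζ ξ (G⁻¹ * f) = ξ f := by
    intro f hf
    have hlt : f.norm < G⁻¹.norm := (Finset.le_sup (f := FreeGroup.norm) hf).trans_lt hGN
    rw [glue_of_head_ne ((head?_mul_of_norm_lt hlt).trans_ne hGa), hξG]
  have hη := isConfiguration_glue (a := a) hζ h.isConfiguration hζw hw
  have hG1 : glue a ζ ξ G⁻¹ = true := by
    rw [glue_of_head_ne hGa, ← mul_one G⁻¹, hξG]
    exact h.isConfiguration.one_mem
  have hper := hG _ (hF _ (hη.translate Γ hG1) fun f hf => hnear f (Finset.mem_insert_of_mem hf))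
  -- Periodicity compares the glued set at `G⁻¹ k`, where it is `ξ k`, with its value at `k`, where
  -- it is `ζ k`.
  have h₁ := hper (G * k)
  simp only [inv_mul_cancel_left] at h₁
  rw [hnear k (Finset.mem_insert_self _ _), glue_of_head hk] at h₁
  exact hζk h₁.symm

/-- The word of `g` is a walk inside `ξ` from `1` to `g`, along which types in `V₁` and `V₀`
alternate. By periodicity it ends at the type where it starts, so it is a closed path, and an entry
at some visited vertex contradicts `not_isEntry` after moving the root there. -/
theorem false_of_isLocalConfig₁ (hL : Γ.ConditionL) (h : Γ.IsMinimalPeriodic ξ g) {w : V₁}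
    (hw : Γ.IsLocalConfig₁ ξ 1 w) : False := by
  set L := g.toWord with hLdef
  have hξ := h.isConfiguration
  have hne : L ≠ [] := by rw [hLdef, Ne, toWord_eq_nil_iff]; exact h.ne_one
  obtain ⟨e₀⟩ : Nonempty E := ⟨(L.head hne).1⟩
  -- Paths are indexed from `1` and lists from `0`. The default `e₀` occurs only beyond the end of
  -- the word.
  let e : ℕ → E := fun j => ((L[j - 1]?).getD (e₀, false)).1
  have he : ∀ i (hi : i < L.length), e (i + 1) = L[i].1 := by
    intro i hi
    change ((L[i]?).getD (e₀, false)).1 = _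
    rw [List.getElem?_eq_getElem hi]
    rfl
  let P : ℕ → FreeGroup E := fun i => FreeGroup.mk (L.take i)
  have hPmem : ∀ i, ξ (P i) = true := fun i =>
    h.prefix_mem (M := L.drop i) (List.take_append_drop i L).symm
  have hPsucc : ∀ i (hi : i < L.length), P (i + 1) = P i * FreeGroup.mk [L[i]] := by
    intro i hi
    change FreeGroup.mk _ = FreeGroup.mk _ * _
    rw [List.take_succ_eq_append_getElem hi, mk_append]
  have hP0 : P 0 = 1 := rfl
  have hPg : P L.length = g := by
    change FreeGroup.mk _ = _
    rw [List.take_length, hLdef, mk_toWord]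
  -- one step from a vertex of `V₁`
  have step₁ : ∀ i (hi : i < L.length) w, Γ.IsLocalConfig₁ ξ (P i) w →
      P (i + 1) = P i * (of (e (i + 1)))⁻¹ ∧ L[i] = (e (i + 1), false) ∧
        Γ.s (e (i + 1)) = w ∧ Γ.IsLocalConfig₀ ξ (P (i + 1)) (Γ.r (e (i + 1))) := by
    intro i hi w hiw
    have hs := hPsucc i hi
    have hm := hPmem (i + 1)
    rw [he i hi]
    obtain ⟨⟨f, b⟩, hf⟩ : ∃ x, L[i] = x := ⟨_, rfl⟩
    rw [hf] at hs ⊢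
    cases b
    · have hs' : P (i + 1) = P i * (of f)⁻¹ := hs
      refine ⟨hs', rfl, (hiw f).2.1 (hs' ▸ hm), hξ.isLocalConfig₀ hm ?_⟩
      rw [hs', inv_mul_cancel_right]
      exact hPmem i
    · have hs' : P (i + 1) = P i * of f := hs
      rw [hs', (hiw f).1] at hm
      exact absurd hm Bool.false_ne_true
  -- one step from a vertex of `V₀`
  have step₀ : ∀ i (hi : i < L.length) v, Γ.IsLocalConfig₀ ξ (P i) v →
      P (i + 1) = P i * of (e (i + 1)) ∧ L[i] = (e (i + 1), true) ∧
        Γ.r (e (i + 1)) = v ∧ Γ.IsLocalConfig₁ ξ (P (i + 1)) (Γ.s (e (i + 1))) := by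
    intro i hi v hiv
    have hs := hPsucc i hi
    have hm := hPmem (i + 1)
    rw [he i hi]
    obtain ⟨⟨f, b⟩, hf⟩ : ∃ x, L[i] = x := ⟨_, rfl⟩
    rw [hf] at hs ⊢
    cases b
    · have hs' : P (i + 1) = P i * (of f)⁻¹ := hs
      rw [hs', hiv.1 f] at hm
      exact absurd hm Bool.false_ne_true
    · have hs' : P (i + 1) = P i * of f := hs
      refine ⟨hs', rfl, hiv.2.1 f (hs' ▸ hm), hξ.isLocalConfig₁ hm ?_⟩
      rw [hs', mul_inv_cancel_right]
      exact hPmem i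
  have even : ∀ i, 2 * i ≤ L.length → ∃ w, Γ.IsLocalConfig₁ ξ (P (2 * i)) w := by
    intro i
    induction i with
    | zero => exact fun _ => ⟨w, hw⟩
    | succ i ih =>
      intro hi
      obtain ⟨w, hiw⟩ := ih (by omega)
      exact ⟨_, (step₀ _ (by omega) _ (step₁ _ (by omega) w hiw).2.2.2).2.2.2⟩
  have hgw : Γ.IsLocalConfig₁ ξ g w := by
    intro f
    rw [← h.isPeriodic (g * of f), ← h.isPeriodic (g * (of f)⁻¹), inv_mul_cancel_left,
      inv_mul_cancel_left]
    simpa only [one_mul] using hw f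
  have hpos : 0 < L.length := List.length_pos_iff.2 hne
  -- A word of odd length would end at a point of type in `V₀`, whereas `g` has the type `w` of the
  -- root.
  obtain ⟨r, hr⟩ : ∃ r, L.length = 2 * r := by
    rcases Nat.even_or_odd' L.length with ⟨r, hr | hr⟩
    · exact ⟨r, hr⟩
    · exfalso
      obtain ⟨w', hw'⟩ := even r (by omega)
      have := (step₁ (2 * r) (by omega) w' hw').2.2.2
      rw [← hr, hPg] at this
      exact hgw.not_isLocalConfig₀ this
  have hred : ∀ i (hi : i + 1 < L.length), L[i + 1] ≠ letterInv L[i] := fun i hi =>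
    rel_iff_ne_letterInv.1 (List.isChain_iff_getElem.1 (isReduced_toWord (x := g)) i hi)
  have hclosed : Γ.IsClosedPath r e := by
    refine ⟨by omega, ⟨fun i hi => ?_, fun i hi => ?_⟩, ?_⟩
    · obtain ⟨w', hw'⟩ := even i (by omega)
      obtain ⟨h₁, h₂, -, h₃⟩ := step₁ (2 * i) (by omega) w' hw'
      obtain ⟨h₄, h₅, h₆, -⟩ := step₀ (2 * i + 1) (by omega) _ h₃
      -- Two edges of one class at the same point of a configuration are equal, so the walk would
      -- backtrack, against reducedness.
      refine ⟨h₆.symm, fun hC => hred (2 * i) (by omega) ?_⟩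
      rw [h₂, h₅, letterInv]
      congr 1
      refine (h₃.eq_of_sameClass hC ?_ ?_).symm
      · rw [h₁, inv_mul_cancel_right]
        exact hPmem _
      · rw [← h₄]
        exact hPmem _
    · obtain ⟨w', hw'⟩ := even i (by omega)
      have h₃ := (step₁ (2 * i) (by omega) w' hw').2.2.2
      obtain ⟨-, h₅, -, h₆⟩ := step₀ (2 * i + 1) (by omega) _ h₃
      obtain ⟨-, h₈, h₉, -⟩ := step₁ (2 * i + 2) (by omega) _ h₆
      refine ⟨h₉.symm, fun heq => hred (2 * i + 1) (by omega) ?_⟩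
      rw [h₅, h₈, letterInv]
      exact congrArg (·, false) heq.symm
    · obtain ⟨r, rfl⟩ : ∃ r', r = r' + 1 := ⟨r - 1, by omega⟩
      rw [(step₁ 0 hpos w (by rwa [hP0])).2.2.1]
      obtain ⟨w', hw'⟩ := even r (by omega)
      have h₃ := (step₁ (2 * r) (by omega) w' hw').2.2.2
      have h₆ := (step₀ (2 * r + 1) (by omega) _ h₃).2.2.2
      rw [show 2 * r + 1 + 1 = L.length by omega, hPg] at h₆
      rw [hr] at h₆
      exact hgw.unique h₆
  obtain ⟨m, hm, t, x, hx⟩ := hclosed.exists_entry hL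
  obtain ⟨w', hw'⟩ := even m (by omega)
  refine (h.translate (L := L.take (2 * m)) (M := L.drop (2 * m))
    (List.take_append_drop _ L).symm).not_isEntry ?_ hx
  rw [(step₁ (2 * m) (by omega) w' hw').2.2.1]
  intro f
  have := hw' f
  simpa only [one_mul] using this

end IsMinimalPeriodic

/-- Under condition (L), the partial action is topologically free: close to every configuration
there is one which is not invariant under a given `g ≠ 1`. -/
theorem not_isLocallyPeriodic (hL : Γ.ConditionL) {ξ : FreeGroup E → Bool}
    (hξ : Γ.IsConfiguration ξ) {g : FreeGroup E} (hg : g ≠ 1) : ¬ Γ.IsLocallyPeriodic ξ g := by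
  intro h
  obtain ⟨ξ, g, h⟩ : ∃ ξ g, Γ.IsMinimalPeriodic ξ g := by
    -- A point `p` of `ξ` at which `g` moves least becomes the new root.
    obtain ⟨p, hp, hmin⟩ := WellFounded.has_min (measure fun p : FreeGroup E =>
      (p⁻¹ * g * p).norm).wf {p | ξ p = true} ⟨1, hξ.one_mem⟩
    refine ⟨_, _, hξ.translate_inv hp, h.translate hξ, fun h1 => hg ?_, fun q hq => ?_⟩
    · rw [mul_assoc, inv_mul_eq_one] at h1
      exact mul_eq_right.1 h1.symm
    · have : (p⁻¹ * g * p).norm ≤ ((p * q)⁻¹ * g * (p * q)).norm := not_lt.1 (hmin (p * q) hq)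
      refine this.trans_eq ?_
      congr 1
      group
  rcases h.isConfiguration.isLocalConfig 1 h.isConfiguration.one_mem with ⟨w, hw⟩ | ⟨v, hv⟩
  · exact h.false_of_isLocalConfig₁ hL hw
  -- At a root of type in `V₀`, go one step along the word of `g`. The step must be along an edge,
  -- and it arrives at a point with type in `V₁`.
  · obtain ⟨x, M, hM⟩ : ∃ x M, g.toWord = x :: M :=
      List.exists_cons_of_ne_nil (by rw [Ne, toWord_eq_nil_iff]; exact h.ne_one)
    have hM' : g.toWord = [x] ++ M := hM
    have hx := h.prefix_mem hM'
    obtain ⟨e, b⟩ := x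
    cases b
    · have := hv.1 e
      rw [one_mul] at this
      rw [show FreeGroup.mk [(e, false)] = (of e)⁻¹ from rfl, this] at hx
      exact Bool.false_ne_true hx
    · have ht := h.translate hM'
      refine ht.false_of_isLocalConfig₁ hL (w := Γ.s e)
        (ht.isConfiguration.isLocalConfig₁ ht.isConfiguration.one_mem ?_)
      change ξ (of e * (1 * (of e)⁻¹)) = true
      rw [one_mul, mul_inv_cancel]
      exact h.isConfiguration.one_mem

end BipartiteSeparatedGraph

/-! ### Coefficients of products in crossed products -/

namespace TopPartialAction

variable {G X : Type*} [Group G] [TopologicalSpace X] (P : TopPartialAction G X)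
variable {K : Type*} [Field K] [DecidableEq G]

theorem coeff_ofFun_mul_mul_ofFun (f f' : LocallyConstant X K) (b : P.CrossedProduct K) (g : G) :
    P.coeff g (P.ofFun f * b * P.ofFun f') = f * P.coeff g b * P.α g f' := by
  induction b using induction_on with
  | zero => rw [mul_zero, zero_mul, map_zero, mul_zero, zero_mul]
  | add a b ha hb => rw [mul_add, add_mul, map_add, map_add, ha, hb, mul_add, add_mul]
  | single k a =>
    rw [ofFun_mul_single, single_mul_ofFun]
    by_cases hk : k = g
    · subst hk
      rw [coeff_single_self, coeff_single_self]
    · rw [coeff_single_of_ne _ hk, coeff_single_of_ne _ hk, mul_zero, zero_mul]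

theorem coeff_one_mul_δ_inv (b : P.CrossedProduct K) (g : G) :
    P.coeff 1 (b * P.δ K g⁻¹) = P.coeff g b := by
  induction b using induction_on with
  | zero => rw [zero_mul, map_zero, map_zero]
  | add a b ha hb => rw [add_mul, map_add, map_add, ha, hb]
  | single k a =>
    by_cases hk : k = g
    · subst hk
      rw [single_eq_ofFun_mul_δ, mul_assoc, δ_mul_δ, mul_inv_cancel, δ_one, mul_one, ← ofFun_mul,
        ofFun, coeff_single_self, δ, ofFun_mul_single, coeff_single_self]
    · rw [δ, single_mul_single, coeff_single_of_ne _ hk, coeff_single_of_ne]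
      rwa [Ne, mul_inv_eq_one]

theorem exists_finset_coeff_eq_zero (b : P.CrossedProduct K) :
    ∃ S : Finset G, ∀ g ∉ S, P.coeff g b = 0 := by
  induction b using induction_on with
  | zero => exact ⟨∅, fun g _ => map_zero _⟩
  | add a b ha hb =>
    obtain ⟨S, hS⟩ := ha
    obtain ⟨T, hT⟩ := hb
    refine ⟨S ∪ T, fun g hg => ?_⟩
    rw [Finset.notMem_union] at hg
    rw [map_add, hS g hg.1, hT g hg.2, add_zero]
  | single k a =>
    refine ⟨{k}, fun g hg => P.coeff_single_of_ne ?_ a⟩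
    rintro rfl
    exact hg (Finset.mem_singleton_self k)

end TopPartialAction

/-! ### Property (SP) -/

namespace BipartiteSeparatedGraph

open FreeGroup hiding map_mul map_one map_inv

variable {V₀ V₁ E : Type*} [DecidableEq E] {Γ : BipartiteSeparatedGraph V₀ V₁ E}

/-- The group elements are treated one at a time, as shrinking the set preserves what was achieved
before. For each `m ≠ 1`, topological freeness gives a point `η` of the current set that is not
invariant under `m`, and a small neighbourhood of `η` is disjoint from its translate. -/
theorem exists_isClopen_subset_disjoint (hL : Γ.ConditionL) (M : Finset (FreeGroup E))
    {W : Set Γ.Omega} (hW : IsClopen W) (hne : W.Nonempty) :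
    ∃ W' ⊆ W, IsClopen W' ∧ W'.Nonempty ∧ ∀ m ∈ M, m ≠ 1 → ∀ ξ ∈ W',
      ξ ∈ Γ.partialAction.dom m → Γ.partialAction.θ m⁻¹ ξ ∉ W' := by
  induction M using Finset.induction_on with
  | empty => exact ⟨W, subset_rfl, hW, hne, by simp⟩
  | insert m M _ ih =>
    obtain ⟨W', hW'W, hW', ⟨ξ, hξ⟩, hM⟩ := ih
    by_cases hm : m = 1
    · refine ⟨W', hW'W, hW', ⟨ξ, hξ⟩, fun k hk hk1 => hM k ?_ hk1⟩
      exact (Finset.mem_insert.1 hk).resolve_left fun h => hk1 (h.trans hm)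
    obtain ⟨F, hF⟩ := exists_finset_of_mem_isOpen hW'.isOpen hξ
    have hnot := not_isLocallyPeriodic hL ξ.2 hm
    simp only [IsLocallyPeriodic, IsPeriodic, not_exists, not_forall] at hnot
    obtain ⟨η, hη, hηF, k, hk⟩ := hnot F
    have hcl : ∀ j : FreeGroup E, IsClopen {ζ : Γ.Omega | ζ.1 j = η j} := fun j =>
      (isClopen_discrete {η j}).preimage (f := fun ζ : Γ.Omega => ζ.1 j)
        ((continuous_apply j).comp continuous_subtype_val)
    -- Non-invariance shows at some `k`, where `η (m⁻¹ k) ≠ η k`. Fixing both values suffices: if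
    -- `ζ` and `m⁻¹ ζ` lie in the new set, then `η k = ζ k = (m⁻¹ ζ)(m⁻¹ k) = η (m⁻¹ k)`.
    refine ⟨W' ∩ ({ζ : Γ.Omega | ζ.1 k = η k} ∩ {ζ : Γ.Omega | ζ.1 (m⁻¹ * k) = η (m⁻¹ * k)}),
      Set.inter_subset_left.trans hW'W, hW'.inter ((hcl _).inter (hcl _)),
      ⟨⟨η, hη⟩, hF _ hηF, rfl, rfl⟩, ?_⟩
    rintro j hj hj1 ζ ⟨hζ, hζ₁, -⟩ hdom ⟨hθ, -, hθ₂⟩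
    rcases Finset.mem_insert.1 hj with rfl | hj
    · have h₁ : (Γ.partialAction.θ j⁻¹ ζ).1 (j⁻¹ * k) = η (j⁻¹ * k) := hθ₂
      rw [Γ.θ_apply (by rw [inv_inv]; exact hdom), inv_inv, mul_inv_cancel_left] at h₁
      exact hk (h₁.symm.trans hζ₁)
    · exact hM j hj hj1 ζ hζ hdom hθ

variable {K : Type*} [Field K]

/-- Under condition (L), every nonzero element of the crossed product can be cut down to a nonzero
multiple of a projection of the coefficient algebra. -/
theorem exists_corner_eq_smul [StarRing K] (hL : Γ.ConditionL)
    {a : Γ.partialAction.CrossedProduct K} (ha : a ≠ 0) :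
    ∃ (h : LocallyConstant Γ.Omega K) (c : K) (g : FreeGroup E),
      IsStarProjection h ∧ h ≠ 0 ∧ c ≠ 0 ∧
        Γ.partialAction.ofFun h * (a * Γ.partialAction.δ K g) * Γ.partialAction.ofFun h =
          c • Γ.partialAction.ofFun h := by
  obtain ⟨g, hg⟩ : ∃ g, Γ.partialAction.coeff g a ≠ 0 := by
    by_contra! hg
    exact ha (Γ.partialAction.ext_coeff fun g => by rw [hg g, map_zero])
  set b := a * Γ.partialAction.δ K g⁻¹ with hb
  rw [← TopPartialAction.coeff_one_mul_δ_inv, ← hb] at hg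
  obtain ⟨ξ, hξ⟩ : ∃ ξ, Γ.partialAction.coeff 1 b ξ ≠ 0 := by
    by_contra! h
    exact hg (LocallyConstant.ext h)
  set c := Γ.partialAction.coeff 1 b ξ with hc
  obtain ⟨S, hS⟩ := Γ.partialAction.exists_finset_coeff_eq_zero b
  -- `W` is taken inside the fibre over `c`, so that the coefficient at the identity is the constant
  -- `c` on it, and disjoint from its translates by the remaining support.
  obtain ⟨W, hWc, hW, ⟨η, hη⟩, hdisj⟩ := exists_isClopen_subset_disjoint hL S
    ((Γ.partialAction.coeff 1 b).isLocallyConstant.isClopen_fiber c) ⟨ξ, rfl⟩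
  refine ⟨LocallyConstant.charFn K hW, c, g⁻¹, LocallyConstant.isStarProjection_charFn hW, ?_, hξ,
    ?_⟩
  · intro h0
    have := LocallyConstant.charFn_of_mem (K := K) hW hη
    rw [h0] at this
    exact zero_ne_one this
  · refine Γ.partialAction.ext_coeff fun m => ?_
    rw [← hb, TopPartialAction.coeff_ofFun_mul_mul_ofFun, ← TopPartialAction.ofFun_smul,
      TopPartialAction.ofFun]
    by_cases hm : m = 1
    · subst hm
      rw [TopPartialAction.coeff_single_self, TopPartialAction.α_one]
      ext ζ
      rw [LocallyConstant.mul_apply, LocallyConstant.mul_apply, LocallyConstant.smul_apply]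
      by_cases hζ : ζ ∈ W
      · rw [LocallyConstant.charFn_of_mem hW hζ, show Γ.partialAction.coeff 1 b ζ = c from hWc hζ]
        simp
      · rw [LocallyConstant.charFn_of_notMem hW hζ]
        simp
    -- For `m ≠ 1`, a point of `W` in the domain of `m` is moved out of `W` by `m⁻¹`, so the
    -- right-hand factor kills the coefficient.
    · rw [TopPartialAction.coeff_single_of_ne _ (Ne.symm hm)]
      ext ζ
      rw [LocallyConstant.mul_apply, LocallyConstant.mul_apply, LocallyConstant.zero_apply]
      by_cases hζ : ζ ∈ W
      · by_cases hmS : m ∈ S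
        · by_cases hdom : ζ ∈ Γ.partialAction.dom m
          · rw [Γ.partialAction.α_apply_of_mem hdom,
              LocallyConstant.charFn_of_notMem hW (hdisj m hmS hm ζ hζ hdom), mul_zero]
          · rw [Γ.partialAction.α_apply_of_notMem hdom, mul_zero]
        · rw [hS m hmS, LocallyConstant.zero_apply, mul_zero, zero_mul]
      · rw [LocallyConstant.charFn_of_notMem hW hζ, zero_mul, zero_mul]

end BipartiteSeparatedGraph

/-! ### Idempotents obtained from a relation `h a u h = c h`. -/

section Corner

variable {K A : Type*} [Field K] [Ring A] [Algebra K A] {a u h : A} {c : K}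

/-- Squaring `a u h` produces the middle factor `h a u h = c h`. This idempotent lies in the right
ideal of `a`, and its counterpart `c⁻¹ u h a` in the left ideal. -/
theorem isIdempotentElem_smul_mul_of_corner (hc : c ≠ 0) (H : h * (a * u) * h = c • h) :
    IsIdempotentElem (c⁻¹ • (a * (u * h))) := by
  have h₁ : a * (u * h) * (a * (u * h)) = c • (a * (u * h)) := by
    calc a * (u * h) * (a * (u * h)) = a * u * (h * (a * u) * h) := by simp only [mul_assoc]
      _ = c • (a * (u * h)) := by rw [H, mul_smul_comm, mul_assoc]
  rw [IsIdempotentElem, smul_mul_smul_comm, h₁, smul_smul, mul_assoc, inv_mul_cancel₀ hc, mul_one]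

theorem smul_mul_ne_zero_of_corner (hc : c ≠ 0) (hh : h ≠ 0) (H : h * (a * u) * h = c • h) :
    c⁻¹ • (a * (u * h)) ≠ 0 := by
  intro h0
  have h₁ := (smul_eq_zero.1 h0).resolve_left (inv_ne_zero hc)
  refine smul_ne_zero hc hh ?_
  rw [← H, mul_assoc, mul_assoc, h₁, mul_zero]

theorem isIdempotentElem_mul_smul_of_corner (hc : c ≠ 0)
    (H : h * (a * u) * h = c • h) : IsIdempotentElem (c⁻¹ • (u * h * a)) := by
  have h₁ : u * h * a * (u * h * a) = c • (u * h * a) := by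
    calc u * h * a * (u * h * a) = u * (h * (a * u) * h) * a := by simp only [mul_assoc]
      _ = c • (u * h * a) := by rw [H, mul_smul_comm, smul_mul_assoc]
  rw [IsIdempotentElem, smul_mul_smul_comm, h₁, smul_smul, mul_assoc, inv_mul_cancel₀ hc, mul_one]

/-- Multiplying the corner relation by itself gives `c² h = (h a)(u h a)(u h)`, so `u h a = 0` would
force `h = 0`. -/
theorem mul_smul_ne_zero_of_corner (hc : c ≠ 0) (hh : h ≠ 0) (hi : IsIdempotentElem h)
    (H : h * (a * u) * h = c • h) : c⁻¹ • (u * h * a) ≠ 0 := by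
  intro h0
  have h₁ := (smul_eq_zero.1 h0).resolve_left (inv_ne_zero hc)
  refine smul_ne_zero hc (smul_ne_zero hc hh) ?_
  have h₂ : c • c • h = h * a * (u * h * a) * (u * h) := by
    calc c • c • h = c • (h * (c • h)) := by rw [mul_smul_comm, hi.eq]
      _ = (c • h) * (h * (a * u) * h) := by rw [H, smul_mul_assoc]
      _ = h * (a * u) * (h * h) * (a * u) * h := by rw [← H]; simp only [mul_assoc]
      _ = h * a * (u * h * a) * (u * h) := by rw [hi.eq]; simp only [mul_assoc]
  rw [h₂, h₁, mul_zero, zero_mul]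

end Corner

/-! ### The theorem. -/

theorem theorem10p11 {V₀ V₁ E : Type*} [Fintype V₀] [Fintype V₁] [Fintype E] [DecidableEq E]
    (Γ : BipartiteSeparatedGraph V₀ V₁ E) (hL : Γ.ConditionL)
    (K : Type*) [Field K] [StarRing K] :
    ∃ Φ : Γ.LAb K ≃⋆ₐ[K] Γ.partialAction.CrossedProduct K,
      (∀ x : E, Φ (Γ.lAbEdge K x) =
        Γ.partialAction.single (FreeGroup.of x) (Γ.partialAction.e K (FreeGroup.of x))) ∧
      (∀ a : Γ.LAb K, a ≠ 0 →
        ∃ (h : LocallyConstant Γ.Omega K) (c : K) (g : FreeGroup E),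
          IsStarProjection h ∧ h ≠ 0 ∧ c ≠ 0 ∧
          Γ.partialAction.ofFun h *
              (Φ a * Γ.partialAction.single g (Γ.partialAction.e K g)) *
              Γ.partialAction.ofFun h =
            c • Γ.partialAction.ofFun h) ∧
      (∀ I : TwoSidedIdeal (Γ.LAb K), I ≠ ⊥ →
        ∃ h : LocallyConstant Γ.Omega K, IsStarProjection h ∧ h ≠ 0 ∧
          Φ.symm (Γ.partialAction.ofFun h) ∈ I) ∧
      (∀ I : Submodule (Γ.LAb K) (Γ.LAb K), I ≠ ⊥ → ∃ p ∈ I, IsIdempotentElem p ∧ p ≠ 0) ∧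
      (∀ I : Submodule (Γ.LAb K)ᵐᵒᵖ (Γ.LAb K), I ≠ ⊥ → ∃ p ∈ I, IsIdempotentElem p ∧ p ≠ 0) := by
  set Φ := Γ.lAbEquiv K with hΦ
  have hcorner : ∀ a : Γ.LAb K, a ≠ 0 →
      ∃ (h : LocallyConstant Γ.Omega K) (c : K) (g : FreeGroup E),
        IsStarProjection h ∧ h ≠ 0 ∧ c ≠ 0 ∧
          Γ.partialAction.ofFun h * (Φ a * Γ.partialAction.δ K g) * Γ.partialAction.ofFun h =
            c • Γ.partialAction.ofFun h := fun a ha =>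
    BipartiteSeparatedGraph.exists_corner_eq_smul hL
      fun h => ha ((map_eq_zero_iff Φ Φ.injective).1 h)
  -- the corner relation inside the abelianized Leavitt path algebra
  have hcorner' : ∀ a : Γ.LAb K, a ≠ 0 → ∃ (f : LocallyConstant Γ.Omega K) (c : K)
      (h u : Γ.LAb K), IsStarProjection f ∧ f ≠ 0 ∧ Φ.symm (Γ.partialAction.ofFun f) = h ∧
        IsIdempotentElem h ∧ h ≠ 0 ∧ c ≠ 0 ∧ h * (a * u) * h = c • h := by
    intro a ha
    obtain ⟨f, c, g, hf, hf0, hc, H⟩ := hcorner a ha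
    refine ⟨f, c, _, Φ.symm (Γ.partialAction.δ K g), hf, hf0, rfl, ?_, ?_, hc, ?_⟩
    · rw [IsIdempotentElem, ← map_mul, ← TopPartialAction.ofFun_mul, hf.isIdempotentElem.eq]
    · intro h0
      have h₁ := (map_eq_zero_iff Φ.symm Φ.symm.injective).1 h0
      exact hf0 (Γ.partialAction.ofFun_injective
        (h₁.trans (Γ.partialAction.ofFun_zero).symm))
    · have hinj : Function.Injective Φ := Φ.injective
      refine hinj ?_
      rw [map_mul, map_mul, map_mul, map_smul, Φ.apply_symm_apply, Φ.apply_symm_apply, H]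
  refine ⟨Φ, Γ.lAbHom_edge K, hcorner, fun I hI => ?_, fun I hI => ?_, fun I hI => ?_⟩
  · obtain ⟨a, haI, ha⟩ : ∃ a ∈ I, a ≠ 0 := by
      by_contra! h
      exact hI (le_bot_iff.1 fun a ha => (TwoSidedIdeal.mem_bot _).2 (h a ha))
    obtain ⟨f, c, h, u, hf, hf0, rfl, -, -, hc, H⟩ := hcorner' a ha
    refine ⟨f, hf, hf0, ?_⟩
    -- A two-sided ideal containing `a` contains `h a u h = c h`, hence the projection `h` itself.
    have hmem := I.mul_mem_right _ (Φ.symm (Γ.partialAction.ofFun f))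
      (I.mul_mem_left (Φ.symm (Γ.partialAction.ofFun f)) _ (I.mul_mem_right a u haI))
    rw [H] at hmem
    have := I.mul_mem_left (algebraMap K _ c⁻¹) _ hmem
    rwa [← Algebra.smul_def, smul_smul, inv_mul_cancel₀ hc, one_smul] at this
  · obtain ⟨a, haI, ha⟩ := I.exists_mem_ne_zero_of_ne_bot hI
    obtain ⟨f, c, h, u, -, -, -, hi, hh, hc, H⟩ := hcorner' a ha
    refine ⟨_, ?_, isIdempotentElem_mul_smul_of_corner hc H,
      mul_smul_ne_zero_of_corner hc hh hi H⟩
    rw [← smul_mul_assoc]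
    exact I.smul_mem _ haI
  · obtain ⟨a, haI, ha⟩ := I.exists_mem_ne_zero_of_ne_bot hI
    obtain ⟨f, c, h, u, -, -, -, hi, hh, hc, H⟩ := hcorner' a ha
    refine ⟨_, ?_, isIdempotentElem_smul_mul_of_corner hc H, smul_mul_ne_zero_of_corner hc hh H⟩
    rw [← mul_smul_comm]
    exact I.smul_mem (MulOpposite.op (c⁻¹ • (u * h))) haI
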